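/- Write $e(x)=\exp(2\pi i x)$. For integers $k\ge 2$, $d\ge 1$, $N\ge 1$ put $X=\lfloor N^{1/k}\rfloor$, $$f_X(\xi)=\sum_{n=1}^{X}e(\xi n^k),\qquad G(a/q)=\frac1q\sum_{r=1}^q e\Big(\frac{a r^k}{q}\Big),\qquad \mathfrak S(N)=\mathfrak S^k_d(N)=\sum_{q=1}^\infty\ \sum_{\substack{1\le a\le q\\(a,q)=1}}G(a/q)^d\,e(-Na/q).$$ For $\alpha\in(0,1/3)$ let the major arcs be $$\mathfrak M_X=\bigcup_{1\le q\le X^\alpha}\ \bigcup_{\substack{0\le a\le q\\(a,q)=1}}\Big\{\xi\in[0,1]:\ \Big|\xi-\frac aq\Big|\le X^{-k+\alpha}\Big\},$$ and let $M_k(N)=\int_{\mathfrak M_X}f_X(\xi)^d\,e(-\xi N)\,d\xi$. **Proposition.** For each integer $k\ge 2$ there is a constant $C_k>0$, depending only on $k$, such that for all $\alpha\in(0,1/3)$ and all $\delta$ with $0<\delta<1-3\alpha$ the following holds. For all integers $d\ge 2^{k+1}$ and all positive integers $N\ge C_k d^{d/\delta}$ the series over $q$ defining $\mathfrak S(N)$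 converges absolutely, and $$M_k(N)=\mathfrak S(N)\,\frac{\Gamma(1+\frac1k)^d}{\Gamma(\frac dk)}\,N^{d/k-1}\,(1+o(1)),$$ where $o(1)$ tends to $0$ as $N\to\infty$ uniformly in $d$; that is, for each such $k,\alpha,\delta$ there is a function $E:\mathbb N\to\mathbb R$ with $E(N)\to0$ as $N\to\infty$, such that for all $d\ge 2^{k+1}$ and all $N\ge C_k d^{d/\delta}$ the quantity written $o(1)$ may be taken to be a complex number of modulus at most $E(N)$. -/

import Mathlib

namespace WaringMajor

/-- `e(x) = exp(2πix)` for real `x`. -/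
noncomputable def e (x : ℝ) : ℂ := Complex.exp (2 * Real.pi * Complex.I * x)

/-- The Gauss sum `G_k(a/q) = (1/q) ∑_{r=1}^q e(a r^k / q)`. -/
noncomputable def gaussSum (k a q : ℕ) : ℂ :=
  (1 / (q : ℂ)) * ∑ r ∈ Finset.Icc 1 q, e ((a : ℝ) / (q : ℝ) * (r : ℝ) ^ k)

/-- The `q`-th term `∑_{1 ≤ a ≤ q, (a,q)=1} G_k(a/q)^d e(-Na/q)` of the singular series
(an empty sum, hence `0`, at `q = 0`). -/
noncomputable def singularTerm (k d N q : ℕ) : ℂ :=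
  ∑ a ∈ (Finset.Icc 1 q).filter (fun a => Nat.Coprime a q),
    gaussSum k a q ^ d * e (-((N : ℝ) * (a : ℝ) / (q : ℝ)))

/-- The singular series `𝔖_d^k(N) = ∑_{q ≥ 1} ∑_{1 ≤ a ≤ q, (a,q)=1} G_k(a/q)^d e(-Na/q)`. -/
noncomputable def singularSeries (k d N : ℕ) : ℂ := ∑' q : ℕ, singularTerm k d N q

/-- `X = ⌊N^{1/k}⌋`. -/
noncomputable def cutoff (k N : ℕ) : ℕ := ⌊(N : ℝ) ^ (1 / (k : ℝ))⌋₊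

/-- The exponential sum `f_X(ξ) = ∑_{n=1}^X e(ξ n^k)`. -/
noncomputable def expSum (k X : ℕ) (ξ : ℝ) : ℂ :=
  ∑ n ∈ Finset.Icc 1 X, e (ξ * (n : ℝ) ^ k)

/-- The single major arc `𝔐_X(a/q) = {ξ ∈ [0,1] : |ξ - a/q| ≤ X^{-k+α}}`. -/
def majorArc (k X : ℕ) (α : ℝ) (a q : ℕ) : Set ℝ :=
  {ξ : ℝ | ξ ∈ Set.Icc (0 : ℝ) 1 ∧ |ξ - (a : ℝ) / (q : ℝ)| ≤ (X : ℝ) ^ (-(k : ℝ) + α)}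

/-- The major arcs `𝔐_X`: the union of the `𝔐_X(a/q)` over `1 ≤ q ≤ X^α`, `0 ≤ a ≤ q`, `(a,q) = 1`.
The value `a = 0` occurs only for `q = 1`; it supplies the half near `0` of the arc which, modulo
one, is centred at `0 ≡ 1`. -/
def majorArcs (k X : ℕ) (α : ℝ) : Set ℝ :=
  {ξ : ℝ | ∃ q a : ℕ, 1 ≤ q ∧ (q : ℝ) ≤ (X : ℝ) ^ α ∧ a ≤ q ∧ Nat.Coprime a q ∧
    ξ ∈ majorArc k X α a q}

/-- The major arc integral `M_k(N) = ∫_{𝔐_X} f_X(ξ)^d e(-ξN) dξ` with `X = ⌊N^{1/k}⌋`. -/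
noncomputable def majorIntegral (k d : ℕ) (α : ℝ) (N : ℕ) : ℂ :=
  ∫ ξ in majorArcs k (cutoff k N) α, expSum k (cutoff k N) ξ ^ d * e (-(ξ * (N : ℝ)))

/-- The archimedean factor `Γ(1+1/k)^d / Γ(d/k) · N^{d/k-1}`. -/
noncomputable def archFactor (k d N : ℕ) : ℝ :=
  Real.Gamma (1 + 1 / (k : ℝ)) ^ d / Real.Gamma ((d : ℝ) / (k : ℝ)) *
    (N : ℝ) ^ ((d : ℝ) / (k : ℝ) - 1)

end WaringMajor

/-! ### Additive characters and Weyl's bound for Gauss sums -/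

namespace WaringMajor

open Polynomial

/-! Write `Y = N^{1/k}`, `v(β) = ∫_0^Y e(β x^k) dx`, `η = X^{-k+α}`, and let `A` be the archimedean
factor. On an arc `ξ = a/q + β`, cutting `[1, X]` into blocks of length `q` gives `f_X(ξ) = G(a/q)
v(β) + O_k(X^{2α})` (`norm_expSum_sub_le_of_major`). The arcs are disjoint modulo one, so up to this
error `M_k(N)` is the partial singular series over `q ≤ X^α` times `∫_{|β| ≤ η} v(β)^d e(-βN) dβ`
(`norm_majorIntegral_sub_main_le`). Completing the sum and the integral (`norm_main_sub_le`)
produces `𝔖(N) A`: Weyl differencing makes the series converge at a rate independent of `d`, the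
bound `|v(β)| ≪ |β|^{-1/k}` controls the tail of the integral, and the full integral equals `A` by
Fourier inversion of a `d`-fold convolution whose values are Beta integrals
(`integral_contSum_pow`).

The difficulty is uniformity in `d`, for which the relative error matters. Three losses occur. The
singular series may be exponentially small, but `|𝔖(N)| ≥ D^{-d}` with `D` depending only on `k`
(`exists_le_norm_singularSeries`). The natural size `Y^{d-k}` of the integral exceeds `A` by at most
`c^d d^{d/k}`, because of `Γ(d/k)` (`pow_div_le_archFactor`). Expanding a `d`-th power costs further
factors `c^d`. The hypothesis `d^{d/δ} ≤ N` says exactly that `d^{d/k} ≤ Y^δ`, and it makes every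
`c^d` at most a constant times an arbitrarily small power of `Y` (`exists_pow_le_rpow`). Replacing
`f_X` by `G v` gains `Y^{2α-1}`, and `δ < 1 - 3α` leaves the exponent `2α - 1 + δ < -α`. The total
relative error is `O(Y^{-α/(4k)})`.

For the lower bound on `𝔖(N)`, the sum of its terms over the divisors of `Q` is a normalised number
of solutions of `∑ x_i^k = N` modulo `Q` (`sum_divisors_singularTerm`). The part of `Q` free of
small primes contributes at least `1/2`, because the series tail is small; for the part built from
small primes, one solution with a unit coordinate modulo the fixed number `k² R` lifts by Hensel to
enough solutions. -/

lemma norm_e (x : ℝ) : ‖e x‖ = 1 := by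
  have : (2 * Real.pi * Complex.I * x : ℂ) = ((2 * Real.pi * x : ℝ) : ℂ) * Complex.I := by
    push_cast; ring
  rw [e, this, Complex.norm_exp_ofReal_mul_I]

lemma e_add (x y : ℝ) : e (x + y) = e x * e y := by
  rw [e, e, e, ← Complex.exp_add]; congr 1; push_cast; ring

lemma e_intCast (n : ℤ) : e n = 1 := by
  rw [e, Complex.exp_eq_one_iff]; exact ⟨n, by push_cast; ring⟩

lemma e_natCast (n : ℕ) : e n = 1 := by simpa using e_intCast n

lemma continuous_e : Continuous e := by
  unfold e; fun_prop

lemma hasDerivAt_e (x : ℝ) : HasDerivAt e (2 * Real.pi * Complex.I * e x) x := by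
  have h : HasDerivAt (fun y : ℂ => Complex.exp (2 * Real.pi * Complex.I * y))
      (Complex.exp (2 * Real.pi * Complex.I * x) * (2 * Real.pi * Complex.I * 1)) (x : ℂ) :=
    (((hasDerivAt_id (x : ℂ)).const_mul _)).cexp
  have := h.comp_ofReal
  convert! this using 1
  rw [e]; ring

lemma stdAddChar_intCast {q : ℕ} [NeZero q] (j : ℤ) :
    ZMod.stdAddChar (j : ZMod q) = e ((j : ℝ) / q) := by
  rw [ZMod.stdAddChar_coe, e]; congr 1; push_cast; ring

lemma sum_Icc_zmod {E : Type*} [AddCommMonoid E] (q : ℕ) [NeZero q] (F : ZMod q → E) :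
    ∑ r ∈ Finset.Icc 1 q, F (r : ZMod q) = ∑ x : ZMod q, F x := by
  have hq : 0 < q := Nat.pos_of_ne_zero (NeZero.ne q)
  have h1 : ∑ r ∈ Finset.Icc 1 q, F (r : ZMod q) = ∑ r ∈ Finset.range q, F (r : ZMod q) := by
    rw [Finset.range_eq_Ico, ← Finset.sum_Ioc_add_eq_sum_Icc (by omega : 1 ≤ q)]
    rw [Finset.sum_eq_sum_Ico_succ_bot hq]
    rw [show Finset.Ico (0+1) q = Finset.Ico 1 q from rfl]
    have : Finset.Ioc 1 q = insert q (Finset.Ioo 1 q) ∨ q = 1 := by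
      rcases Nat.lt_or_ge 1 q with h | h
      · left; exact (Finset.Ioo_insert_right h).symm
      · right; omega
    rcases this with h | h
    · have h1q : 1 < q := by
        by_contra hc
        have : q ∈ Finset.Ioc 1 q := by rw [h]; simp
        simp at this; omega
      rw [h, Finset.sum_insert (by simp), ← Finset.Ioo_insert_left h1q, Finset.sum_insert (by simp)]
      simp only [CharP.cast_eq_zero, Nat.cast_zero]
      rw [add_assoc, add_comm (∑ x ∈ Finset.Ioo 1 q, F x)]
    · subst h; simp
  rw [h1]
  refine Finset.sum_bij' (fun r _ => (r : ZMod q)) (fun x _ => x.val) ?_ ?_ ?_ ?_ ?_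
  · simp
  · intro x _; simpa using ZMod.val_lt x
  · intro r hr; exact ZMod.val_cast_of_lt (by simpa using hr)
  · intro x _; simp
  · simp

lemma gaussSum_eq (k a q : ℕ) [NeZero q] :
    gaussSum k a q = (1 / (q : ℂ)) * ∑ x : ZMod q, ZMod.stdAddChar ((a : ZMod q) * x ^ k) := by
  rw [gaussSum, ← sum_Icc_zmod]
  congr 1
  refine Finset.sum_congr rfl fun r _ => ?_
  have := stdAddChar_intCast (q := q) ((a : ℤ) * (r : ℤ) ^ k)
  push_cast at this
  rw [this]; congr 1; ring

lemma norm_gaussSum_le_one (k a q : ℕ) : ‖gaussSum k a q‖ ≤ 1 := by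
  rw [gaussSum, norm_mul]
  rcases Nat.eq_zero_or_pos q with rfl | hq
  · simp
  have : ‖∑ r ∈ Finset.Icc 1 q, e ((a : ℝ) / (q : ℝ) * (r : ℝ) ^ k)‖ ≤ q := by
    refine (norm_sum_le _ _).trans ?_
    simp [norm_e]
  have hq' : (0 : ℝ) < q := by exact_mod_cast hq
  calc _ ≤ ‖1 / (q : ℂ)‖ * q := by gcongr
    _ = 1 := by simp; field_simp

/-- The differencing step: substitute `y = x + h` in the double sum. Over a complete residue system
there are no boundary terms. -/
lemma norm_sum_sq_eq {q : ℕ} [NeZero q] (f : ZMod q → ℂ) :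
    ((‖∑ x, f x‖ ^ 2 : ℝ) : ℂ) = ∑ h, ∑ x, f (x + h) * (starRingEnd ℂ) (f x) := by
  have : ((‖∑ x, f x‖ ^ 2 : ℝ) : ℂ) = (∑ x, f x) * (starRingEnd ℂ) (∑ x, f x) := by
    rw [Complex.mul_conj, Complex.normSq_eq_norm_sq]
  rw [this, map_sum, Finset.sum_mul_sum, Finset.sum_comm]
  rw [Finset.sum_comm (s := Finset.univ) (t := Finset.univ)
    (f := fun h x => f (x + h) * (starRingEnd ℂ) (f x))]
  refine Finset.sum_congr rfl fun x _ => ?_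
  exact (Fintype.sum_equiv (Equiv.addLeft x) (fun h => f (x + h) * (starRingEnd ℂ) (f x))
    (fun y => f y * (starRingEnd ℂ) (f x)) fun _ => rfl).symm

/-- Each gcd is at most the sum of the divisors `g` of `q` dividing `h`, and such a `g` divides at
most `q / g` residues, so it contributes at most `q` in total. -/
lemma sum_gcd_val_le (q : ℕ) [NeZero q] :
    ∑ h : ZMod q, Nat.gcd h.val q ≤ q.divisors.card * q := by
  have hq : 0 < q := Nat.pos_of_ne_zero (NeZero.ne q)
  have h1 : ∑ h : ZMod q, Nat.gcd h.val q ≤ ∑ h : ZMod q, ∑ g ∈ q.divisors, if g ∣ h.val then g else 0 := by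
    refine Finset.sum_le_sum fun h _ => ?_
    have : Nat.gcd h.val q ∈ q.divisors := Nat.mem_divisors.2 ⟨Nat.gcd_dvd_right _ _, hq.ne'⟩
    refine le_trans ?_ (Finset.single_le_sum (fun _ _ => Nat.zero_le _) this)
    simp [Nat.gcd_dvd_left]
  refine h1.trans ?_
  rw [Finset.sum_comm, ← smul_eq_mul, ← Finset.sum_const]
  refine Finset.sum_le_sum fun g hg => ?_
  have hgq := Nat.dvd_of_mem_divisors hg
  obtain ⟨m, rfl⟩ := hgq
  have hg0 : 0 < g := Nat.pos_of_mul_pos_right hq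
  rw [← Finset.sum_filter, Finset.sum_const, smul_eq_mul]
  have : (Finset.univ.filter fun h : ZMod (g * m) => g ∣ h.val).card ≤ m := by
    conv_rhs => rw [← Finset.card_range m]
    refine Finset.card_le_card_of_injOn (fun h => h.val / g) ?_ ?_
    · intro h _
      simp only [Finset.coe_range, Set.mem_Iio]
      exact Nat.div_lt_of_lt_mul (ZMod.val_lt h)
    · intro a ha b hb hab
      simp only [Finset.coe_filter, Finset.mem_univ, true_and, Set.mem_ofPred_eq] at ha hb
      apply ZMod.val_injective
      rw [← Nat.mul_div_cancel' ha, ← Nat.mul_div_cancel' hb]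
      exact congrArg (g * ·) hab
  calc _ ≤ m * g := Nat.mul_le_mul_right _ this
    _ = g * m := mul_comm _ _

lemma int_gcd_mul_mul_le (n q h : ℕ) (hn : 0 < n) (hq : 0 < q) (c : ℤ) :
    Int.gcd ((n : ℤ) * c * h) q ≤ n * Int.gcd c q * Nat.gcd h q := by
  have : Int.gcd ((n : ℤ) * c * h) q ∣ n * Int.gcd c q * Nat.gcd h q := by
    rw [Int.gcd_eq_natAbs, Int.gcd_eq_natAbs, Int.natAbs_mul, Int.natAbs_mul]
    simp only [Int.natAbs_natCast]
    rw [Nat.gcd_comm _ q, Nat.gcd_comm _ q, Nat.gcd_comm _ q]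
    exact (Nat.gcd_mul_right_dvd_mul_gcd _ _ _).trans (Nat.mul_dvd_mul_right
      ((Nat.gcd_mul_right_dvd_mul_gcd _ _ _).trans
        (Nat.mul_dvd_mul_right (Nat.gcd_dvd_right _ _) _)) _)
  refine Nat.le_of_dvd ?_ this
  have h1 : 0 < Int.gcd c q := Int.gcd_pos_of_ne_zero_right _ (by exact_mod_cast hq.ne')
  have h2 : 0 < Nat.gcd h q := Nat.gcd_pos_of_pos_right _ hq
  positivity

/-- The difference polynomial `P(X + h) - P(X)`. -/
noncomputable def diffPoly (P : ℤ[X]) (h : ℤ) : ℤ[X] := taylor h P - P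

lemma aeval_diffPoly {R : Type*} [CommRing R] (P : ℤ[X]) (h : ℤ) (x : R) :
    aeval x (diffPoly P h) = aeval (x + h) P - aeval x P := by
  rw [diffPoly, map_sub, taylor_apply, aeval_comp]; simp

lemma natDegree_diffPoly_le (P : ℤ[X]) (h : ℤ) (n : ℕ) (hP : P.natDegree ≤ n + 1) :
    (diffPoly P h).natDegree ≤ n := by
  rw [natDegree_le_iff_coeff_eq_zero]
  intro m hm
  rw [diffPoly, coeff_sub, taylor_coeff]
  rcases Nat.lt_or_ge (n + 1) m with h1 | h1
  · have h2 : P.natDegree < m := by omega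
    rw [hasseDeriv_eq_zero_of_lt_natDegree _ _ h2, coeff_eq_zero_of_natDegree_lt h2]; simp
  · have h2 : m = n + 1 := by omega
    subst h2
    have h3 : (hasseDeriv (n + 1) P).natDegree ≤ 0 :=
      (natDegree_hasseDeriv_le P (n + 1)).trans (by omega)
    rw [eq_C_of_natDegree_le_zero h3, hasseDeriv_coeff]; simp

lemma coeff_diffPoly (P : ℤ[X]) (h : ℤ) (n : ℕ) (hP : P.natDegree ≤ n + 1) :
    (diffPoly P h).coeff n = ((n + 1 : ℕ) : ℤ) * P.coeff (n + 1) * h := by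
  rw [diffPoly, coeff_sub, taylor_coeff]
  have h3 : (hasseDeriv n P).natDegree ≤ 1 :=
    (natDegree_hasseDeriv_le P n).trans (by omega)
  rw [eval_eq_sum_range' (n := 2) (by omega)]
  simp [Finset.sum_range_succ, hasseDeriv_coeff, Nat.choose_succ_self_right, add_comm 1 n]

/-- Weyl's inequality for complete sums, by induction on the degree. Squaring replaces `P` by its
differences, whose leading coefficient is `(m + 2) c h`; averaging `gcd(h, q)` over `h` costs one
divisor function per step. Keeping the gcd with the leading coefficient in the bound is what lets
the induction run. -/
lemma weyl_zmod (q : ℕ) [NeZero q] (ψ : AddChar (ZMod q) ℂ) (hψ : ψ.IsPrimitive) (m : ℕ) :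
    ∀ P : ℤ[X], P.natDegree ≤ m + 1 →
    (‖∑ x : ZMod q, ψ (aeval x P)‖ / q) ^ (2 ^ m) ≤
      (m + 1).factorial * (q.divisors.card : ℝ) ^ m * Int.gcd (P.coeff (m + 1)) q / q := by
  have hq : 0 < q := Nat.pos_of_ne_zero (NeZero.ne q)
  have hq' : (0 : ℝ) < q := by exact_mod_cast hq
  induction m with
  | zero =>
    -- A complete sum of a linear phase vanishes unless `q` divides the linear coefficient, in which
    -- case the gcd is `q`.
    intro P hP
    have hev : ∀ x : ZMod q, ψ (aeval x P) = ψ ((P.coeff 0 : ℤ) : ZMod q) *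
        ψ (x * ((P.coeff 1 : ℤ) : ZMod q)) := by
      intro x
      rw [← AddChar.map_add_eq_mul, aeval_eq_sum_range' (n := 2) (by omega)]
      simp [Finset.sum_range_succ, mul_comm]
    simp_rw [hev]
    rw [← Finset.mul_sum, AddChar.sum_mulShift _ hψ]
    simp only [norm_mul, AddChar.norm_apply, pow_zero, pow_one, one_mul, zero_add,
      Nat.factorial_one, Nat.cast_one, mul_one]
    gcongr
    split_ifs with h
    · rw [ZMod.card]
      have : Int.gcd (P.coeff 1) q = q := by
        have := (ZMod.intCast_zmod_eq_zero_iff_dvd (P.coeff 1) q).1 h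
        exact_mod_cast Int.gcd_eq_natAbs_right this
      rw [this]; simp
    · simp
  | succ m ih =>
    intro P hP
    set f : ZMod q → ℂ := fun x => ψ (aeval x P) with hf
    have hexp : ∀ h x : ZMod q, f (x + h) * (starRingEnd ℂ) (f x) =
        ψ (aeval x (diffPoly P (h.val : ℤ))) := by
      intro h x
      simp only [hf]
      rw [aeval_diffPoly, ← AddChar.map_neg_eq_conj, ← AddChar.map_add_eq_mul]
      simp [sub_eq_add_neg]
    have h1 : (‖∑ x, f x‖ / q) ^ 2 ≤
        ∑ h : ZMod q, (1 / (q : ℝ)) * (‖∑ x : ZMod q, ψ (aeval x (diffPoly P (h.val : ℤ)))‖ / q) := by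
      have h2 : ‖∑ x, f x‖ ^ 2 ≤ ∑ h : ZMod q, ‖∑ x : ZMod q, ψ (aeval x (diffPoly P (h.val : ℤ)))‖ := by
        have h3 := norm_sum_sq_eq f
        simp_rw [hexp] at h3
        have h4 := congrArg norm h3
        rw [Complex.norm_real, Real.norm_of_nonneg (by positivity)] at h4
        rw [h4]; exact norm_sum_le _ _
      rw [← Finset.mul_sum, ← Finset.sum_div, div_pow]
      calc ‖∑ x, f x‖ ^ 2 / (q : ℝ) ^ 2 ≤ (∑ h : ZMod q, ‖∑ x : ZMod q, ψ (aeval x (diffPoly P (h.val : ℤ)))‖) / (q : ℝ) ^ 2 := by gcongr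
        _ = _ := by field_simp
    calc (‖∑ x, f x‖ / q) ^ 2 ^ (m + 1) = ((‖∑ x, f x‖ / q) ^ 2) ^ 2 ^ m := by
          rw [← pow_mul, pow_succ' 2 m]
      _ ≤ (∑ h : ZMod q, (1 / (q : ℝ)) * (‖∑ x : ZMod q, ψ (aeval x (diffPoly P (h.val : ℤ)))‖ / q)) ^ 2 ^ m := by
          gcongr
      _ ≤ ∑ h : ZMod q, (1 / (q : ℝ)) * (‖∑ x : ZMod q, ψ (aeval x (diffPoly P (h.val : ℤ)))‖ / q) ^ 2 ^ m := by
          -- Jensen with the uniform weights `1/q` moves the exponent `2^m` inside the average over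
          -- `h`, where the induction hypothesis applies.
          refine Real.pow_arith_mean_le_arith_mean_pow _ _ _ (fun _ _ => by positivity) ?_
            (fun _ _ => by positivity) _
          simp [ZMod.card]
      _ ≤ ∑ h : ZMod q, (1 / (q : ℝ)) * ((m + 1).factorial * (q.divisors.card : ℝ) ^ m *
            (((m + 2 : ℕ) : ℝ) * Int.gcd (P.coeff (m + 2)) q * Nat.gcd h.val q) / q) := by
          refine Finset.sum_le_sum fun h _ => ?_
          have h5 := ih (diffPoly P (h.val : ℤ)) (natDegree_diffPoly_le P _ _ hP)
          rw [coeff_diffPoly P _ _ hP] at h5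
          have h6 := int_gcd_mul_mul_le (m + 2) q h.val (by omega) hq (P.coeff (m + 2))
          refine mul_le_mul_of_nonneg_left (h5.trans ?_) (by positivity)
          gcongr
          exact_mod_cast h6
      _ = (m + 1).factorial * (q.divisors.card : ℝ) ^ m * ((m + 2 : ℕ) : ℝ) *
            Int.gcd (P.coeff (m + 2)) q / q ^ 2 * ((∑ h : ZMod q, Nat.gcd h.val q : ℕ) : ℝ) := by
          push_cast
          rw [Finset.mul_sum]
          refine Finset.sum_congr rfl fun h _ => ?_
          field_simp
      _ ≤ (m + 1).factorial * (q.divisors.card : ℝ) ^ m * ((m + 2 : ℕ) : ℝ) *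
            Int.gcd (P.coeff (m + 2)) q / q ^ 2 * ((q.divisors.card * q : ℕ) : ℝ) := by
          gcongr
          exact sum_gcd_val_le q
      _ = _ := by
          rw [Nat.factorial_succ (m + 1)]
          push_cast
          field_simp
          ring

lemma norm_gaussSum_pow_le (m a q : ℕ) (hq : 0 < q) (ha : Nat.Coprime a q) :
    ‖gaussSum (m + 1) a q‖ ^ (2 ^ m) ≤
      (m + 1).factorial * (q.divisors.card : ℝ) ^ m / q := by
  have : NeZero q := ⟨hq.ne'⟩
  have h := weyl_zmod q ZMod.stdAddChar (ZMod.isPrimitive_stdAddChar q) m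
    (C (a : ℤ) * X ^ (m + 1)) (natDegree_C_mul_X_pow_le _ _)
  have hg : Int.gcd ((C (a : ℤ) * X ^ (m + 1)).coeff (m + 1)) q = 1 := by
    rw [coeff_C_mul_X_pow, if_pos rfl]
    exact_mod_cast ha
  rw [hg] at h
  have h2 : ‖gaussSum (m + 1) a q‖ =
      ‖∑ x : ZMod q, ZMod.stdAddChar (aeval x (C (a : ℤ) * X ^ (m + 1)))‖ / q := by
    rw [gaussSum_eq, norm_mul]
    simp [div_eq_inv_mul]
  rw [h2]
  simpa using h

end WaringMajor

/-! ### The divisor bound and moments of Gauss sums -/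

namespace WaringMajor

lemma succ_le_mul_rpow {ε : ℝ} (hε : 0 < ε) (p v : ℕ) (hp : 2 ≤ p) :
    (v : ℝ) + 1 ≤ (1 + 1 / (ε * Real.log 2)) * ((p : ℝ) ^ v) ^ ε := by
  have hl : 0 < Real.log 2 := Real.log_pos (by norm_num)
  have h1 : 1 + ε * Real.log 2 * v ≤ ((p : ℝ) ^ v) ^ ε := by
    calc 1 + ε * Real.log 2 * v ≤ Real.exp (ε * Real.log 2 * v) := by
          have := Real.add_one_le_exp (ε * Real.log 2 * v); linarith
      _ = ((2 : ℝ) ^ v) ^ ε := by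
          rw [← Real.rpow_natCast, ← Real.rpow_mul (by norm_num), Real.rpow_def_of_pos (by norm_num)]
          congr 1; ring
      _ ≤ ((p : ℝ) ^ v) ^ ε := by
          gcongr; exact_mod_cast hp
  have h2 : (v : ℝ) + 1 ≤ (1 + 1 / (ε * Real.log 2)) * (1 + ε * Real.log 2 * v) := by
    have : (1 + 1 / (ε * Real.log 2)) * (1 + ε * Real.log 2 * v) =
        1 + v + (ε * Real.log 2 * v + 1 / (ε * Real.log 2)) := by field_simp; ring
    rw [this]
    have : 0 ≤ ε * Real.log 2 * v + 1 / (ε * Real.log 2) := by positivity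
    linarith
  exact h2.trans (by gcongr)

lemma succ_le_rpow_of_large {ε : ℝ} (p v : ℕ) (hp : 2 ≤ (p : ℝ) ^ ε) :
    (v : ℝ) + 1 ≤ ((p : ℝ) ^ v) ^ ε := by
  have h1 : (v : ℝ) + 1 ≤ 2 ^ v := by
    exact_mod_cast Nat.lt_two_pow_self (n := v)
  calc (v : ℝ) + 1 ≤ 2 ^ v := h1
    _ ≤ ((p : ℝ) ^ ε) ^ v := by gcongr
    _ = ((p : ℝ) ^ v) ^ ε := by
      rw [← Real.rpow_natCast, ← Real.rpow_natCast, ← Real.rpow_mul (by positivity),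
        ← Real.rpow_mul (by positivity), mul_comm]

/-- Compare `∏ (v_p + 1)` with `∏ p^{ε v_p}` factor by factor. Once `p^ε ≥ 2` the comparison holds
without a constant; each of the fewer than `T` remaining primes costs at most `L`. -/
theorem card_divisors_le_rpow {ε : ℝ} (hε : 0 < ε) :
    ∃ C : ℝ, 1 ≤ C ∧ ∀ n : ℕ, n ≠ 0 → (n.divisors.card : ℝ) ≤ C * (n : ℝ) ^ ε := by
  set L : ℝ := 1 + 1 / (ε * Real.log 2) with hL
  have hl : 0 < Real.log 2 := Real.log_pos (by norm_num)
  have hL1 : 1 ≤ L := by rw [hL]; have : 0 < 1 / (ε * Real.log 2) := by positivity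
                         linarith
  set T : ℕ := ⌈(2 : ℝ) ^ (1 / ε)⌉₊ with hT
  refine ⟨L ^ T, one_le_pow₀ hL1, fun n hn => ?_⟩
  have hprod : (n : ℝ) ^ ε = ∏ p ∈ n.primeFactors, ((p : ℝ) ^ n.factorization p) ^ ε := by
    rw [Real.finsetProd_rpow _ _ (fun _ _ => by positivity)]
    congr 1
    conv_lhs => rw [← Nat.prod_factorization_pow_eq_self hn]
    rw [Finsupp.prod]; push_cast; rfl
  rw [Nat.card_divisors hn, hprod]
  push_cast
  calc ∏ p ∈ n.primeFactors, ((n.factorization p : ℝ) + 1)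
      ≤ ∏ p ∈ n.primeFactors, ((if p < T then L else 1) * ((p : ℝ) ^ n.factorization p) ^ ε) := by
        refine Finset.prod_le_prod (fun _ _ => by positivity) fun p hp => ?_
        have hp2 := (Nat.prime_of_mem_primeFactors hp).two_le
        split_ifs with h
        · exact succ_le_mul_rpow hε p _ hp2
        · rw [one_mul]
          refine succ_le_rpow_of_large p _ ?_
          have h1 : (2 : ℝ) ^ (1 / ε) ≤ p := (Nat.le_ceil _).trans (by exact_mod_cast not_lt.1 h)
          calc (2 : ℝ) = ((2 : ℝ) ^ (1 / ε)) ^ ε := by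
                rw [← Real.rpow_mul (by norm_num)]; field_simp; simp
            _ ≤ (p : ℝ) ^ ε := by gcongr
    _ = (∏ p ∈ n.primeFactors, (if p < T then L else 1)) *
          ∏ p ∈ n.primeFactors, ((p : ℝ) ^ n.factorization p) ^ ε := Finset.prod_mul_distrib
    _ ≤ L ^ T * ∏ p ∈ n.primeFactors, ((p : ℝ) ^ n.factorization p) ^ ε := by
        refine mul_le_mul_of_nonneg_right ?_ (Finset.prod_nonneg fun _ _ => by positivity)
        rw [← Finset.prod_filter, Finset.prod_const]
        refine pow_le_pow_right₀ hL1 ?_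
        calc _ ≤ (Finset.range T).card := Finset.card_le_card fun p hp => by
              simpa using (Finset.mem_filter.1 hp).2
          _ = T := Finset.card_range T

/-- The `d`-th absolute moment of the Gauss sums with denominator `q`. -/
noncomputable def gaussMoment (k d q : ℕ) : ℝ :=
  ∑ a ∈ (Finset.Icc 1 q).filter (fun a => Nat.Coprime a q), ‖gaussSum k a q‖ ^ d

lemma gaussMoment_nonneg (k d q : ℕ) : 0 ≤ gaussMoment k d q :=
  Finset.sum_nonneg fun _ _ => by positivity

lemma norm_singularTerm_le (k d N q : ℕ) : ‖singularTerm k d N q‖ ≤ gaussMoment k d q := by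
  rw [singularTerm, gaussMoment]
  refine (norm_sum_le _ _).trans (Finset.sum_le_sum fun a _ => ?_)
  rw [norm_mul, norm_e, norm_pow, mul_one]

/-- Three copies of Weyl's bound give `|G|^d ≪ q^{-3+1/2}` and there are at most `q` numerators.
Since `|G| ≤ 1`, a larger `d` only helps, so the constant is independent of `d`. -/
theorem gaussMoment_le (k : ℕ) (hk : 2 ≤ k) :
    ∃ K : ℝ, 1 ≤ K ∧ ∀ d : ℕ, 3 * 2 ^ (k - 1) ≤ d → ∀ q : ℕ,
      gaussMoment k d q ≤ K * (q : ℝ) ^ (-(3 / 2 : ℝ)) := by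
  obtain ⟨m, rfl⟩ : ∃ m, k = m + 1 := ⟨k - 1, by omega⟩
  have hm : 1 ≤ m := by omega
  have hm' : (0 : ℝ) < m := by exact_mod_cast hm
  -- With this exponent the `m`-th power of the divisor function costs `q^{1/6}`, hence `q^{1/2}`
  -- after cubing.
  obtain ⟨C, hC1, hC⟩ := card_divisors_le_rpow (ε := 1 / (6 * m)) (by positivity)
  have hf1 : (1 : ℝ) ≤ ((m + 1).factorial : ℝ) := by exact_mod_cast Nat.factorial_pos _
  refine ⟨((m + 1).factorial * C ^ m) ^ 3,
    one_le_pow₀ (one_le_mul_of_one_le_of_one_le hf1 (one_le_pow₀ hC1)), fun d hd q => ?_⟩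
  rcases Nat.eq_zero_or_pos q with rfl | hq
  · simp [gaussMoment]
  have hq' : (0 : ℝ) < q := by exact_mod_cast hq
  have hterm : ∀ a ∈ (Finset.Icc 1 q).filter (fun a => Nat.Coprime a q),
      ‖gaussSum (m + 1) a q‖ ^ d ≤ ((m + 1).factorial * C ^ m) ^ 3 * (q : ℝ) ^ (-(5 / 2 : ℝ)) := by
    intro a ha
    have ha' := (Finset.mem_filter.1 ha).2
    calc ‖gaussSum (m + 1) a q‖ ^ d ≤ ‖gaussSum (m + 1) a q‖ ^ (3 * 2 ^ m) :=
          pow_le_pow_of_le_one (norm_nonneg _) (norm_gaussSum_le_one _ _ _) hd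
      _ = (‖gaussSum (m + 1) a q‖ ^ (2 ^ m)) ^ 3 := by rw [← pow_mul, mul_comm]
      _ ≤ ((m + 1).factorial * (q.divisors.card : ℝ) ^ m / q) ^ 3 := by
          gcongr; exact norm_gaussSum_pow_le m a q hq ha'
      _ ≤ ((m + 1).factorial * (C * (q : ℝ) ^ (1 / (6 * m : ℝ))) ^ m / q) ^ 3 := by
          gcongr; exact hC q hq.ne'
      _ = ((m + 1).factorial * C ^ m) ^ 3 * ((q : ℝ) ^ (1 / 6 : ℝ) / q) ^ 3 := by
          have : ((q : ℝ) ^ (1 / (6 * m : ℝ))) ^ m = (q : ℝ) ^ (1 / 6 : ℝ) := by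
            rw [← Real.rpow_natCast, ← Real.rpow_mul hq'.le]; congr 1; field_simp
          rw [mul_pow C, this]; ring
      _ = _ := by
          congr 1
          rw [div_pow, ← Real.rpow_natCast, ← Real.rpow_natCast, ← Real.rpow_mul hq'.le,
            ← Real.rpow_sub hq']
          norm_num
  calc gaussMoment (m + 1) d q
      ≤ ∑ a ∈ (Finset.Icc 1 q).filter (fun a => Nat.Coprime a q),
          ((m + 1).factorial * C ^ m) ^ 3 * (q : ℝ) ^ (-(5 / 2 : ℝ)) := Finset.sum_le_sum hterm
    _ ≤ q * (((m + 1).factorial * C ^ m) ^ 3 * (q : ℝ) ^ (-(5 / 2 : ℝ))) := by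
        rw [Finset.sum_const, nsmul_eq_mul]
        gcongr
        calc _ ≤ (Finset.Icc 1 q).card := Finset.card_filter_le _ _
          _ = q := by simp
    _ = _ := by
        rw [show (-(3 / 2 : ℝ)) = 1 + -(5 / 2 : ℝ) by norm_num, Real.rpow_add hq', Real.rpow_one]
        ring

lemma summable_rpow_three_halves : Summable fun q : ℕ => (q : ℝ) ^ (-(3 / 2 : ℝ)) :=
  Real.summable_nat_rpow.2 (by norm_num)

lemma summable_gaussMoment (k d : ℕ) (hk : 2 ≤ k) (hd : 3 * 2 ^ (k - 1) ≤ d) :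
    Summable (gaussMoment k d) := by
  obtain ⟨K, _, hK⟩ := gaussMoment_le k hk
  exact Summable.of_nonneg_of_le (gaussMoment_nonneg k d) (hK d hd)
    (summable_rpow_three_halves.mul_left K)

lemma summable_norm_singularTerm (k d N : ℕ) (hk : 2 ≤ k) (hd : 3 * 2 ^ (k - 1) ≤ d) :
    Summable fun q => ‖singularTerm k d N q‖ :=
  Summable.of_nonneg_of_le (fun _ => norm_nonneg _) (norm_singularTerm_le k d N)
    (summable_gaussMoment k d hk hd)

/-- Uniform bounds for the moments of the Gauss sums and for their tails. -/
theorem sum_gaussMoment_le (k : ℕ) (hk : 2 ≤ k) :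
    ∃ K : ℝ, 1 ≤ K ∧ ∀ d : ℕ, 3 * 2 ^ (k - 1) ≤ d →
      (∀ s : Finset ℕ, ∑ q ∈ s, gaussMoment k d q ≤ K) ∧
      ∀ B : ℝ, 0 < B → ∀ s : Finset ℕ, (∀ q ∈ s, B ≤ (q : ℝ)) →
        ∑ q ∈ s, gaussMoment k d q ≤ K * B ^ (-(1 / 4 : ℝ)) := by
  obtain ⟨K, hK1, hK⟩ := gaussMoment_le k hk
  have hs2 : Summable fun q : ℕ => (q : ℝ) ^ (-(5 / 4 : ℝ)) :=
    Real.summable_nat_rpow.2 (by norm_num)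
  set Z : ℝ := 1 + ∑' q : ℕ, (q : ℝ) ^ (-(3 / 2 : ℝ)) + ∑' q : ℕ, (q : ℝ) ^ (-(5 / 4 : ℝ)) with hZ
  have hz1 : 0 ≤ ∑' q : ℕ, (q : ℝ) ^ (-(3 / 2 : ℝ)) := tsum_nonneg fun _ => by positivity
  have hz2 : 0 ≤ ∑' q : ℕ, (q : ℝ) ^ (-(5 / 4 : ℝ)) := tsum_nonneg fun _ => by positivity
  refine ⟨K * Z, one_le_mul_of_one_le_of_one_le hK1 (by linarith), fun d hd => ⟨fun s => ?_,
    fun B hB s hs => ?_⟩⟩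
  · calc ∑ q ∈ s, gaussMoment k d q ≤ ∑ q ∈ s, K * (q : ℝ) ^ (-(3 / 2 : ℝ)) :=
          Finset.sum_le_sum fun q _ => hK d hd q
      _ = K * ∑ q ∈ s, (q : ℝ) ^ (-(3 / 2 : ℝ)) := by rw [Finset.mul_sum]
      _ ≤ K * Z := by
          gcongr
          have := summable_rpow_three_halves.sum_le_tsum s (fun _ _ => by positivity)
          linarith
  · calc ∑ q ∈ s, gaussMoment k d q
        ≤ ∑ q ∈ s, K * (B ^ (-(1 / 4 : ℝ)) * (q : ℝ) ^ (-(5 / 4 : ℝ))) := by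
          refine Finset.sum_le_sum fun q hq => (hK d hd q).trans ?_
          have hq0 : (0 : ℝ) < q := hB.trans_le (hs q hq)
          -- The factor `q^{-1/4}` supplies the saving in `B`; the exponent `-5/4` is still
          -- summable.
          rw [show (-(3 / 2 : ℝ)) = -(1 / 4) + -(5 / 4 : ℝ) by norm_num, Real.rpow_add hq0]
          gcongr ?_ * (?_ * ?_)
          exact Real.rpow_le_rpow_of_nonpos hB (hs q hq) (by norm_num)
      _ = K * B ^ (-(1 / 4 : ℝ)) * ∑ q ∈ s, (q : ℝ) ^ (-(5 / 4 : ℝ)) := by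
          rw [Finset.mul_sum]; refine Finset.sum_congr rfl fun q _ => by ring
      _ ≤ K * B ^ (-(1 / 4 : ℝ)) * Z := by
          gcongr
          have := hs2.sum_le_tsum s (fun _ _ => by positivity)
          linarith
      _ = _ := by ring

end WaringMajor

/-! ### Congruence counts and local solubility -/

namespace WaringMajor

lemma sum_Icc_one_eq {E : Type*} [AddCommMonoid E] (f : ℕ → E) (n : ℕ) :
    ∑ r ∈ Finset.Icc 1 n, f r = ∑ i ∈ Finset.range n, f (1 + i) := by
  rw [show Finset.Icc 1 n = Finset.Ico 1 (n + 1) by ext; simp,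
    Finset.sum_Ico_eq_sum_range]; simp

lemma sum_Icc_periodic {f : ℕ → ℂ} {q : ℕ} (hf : ∀ r, f (r + q) = f r) (g : ℕ) :
    ∑ r ∈ Finset.Icc 1 (g * q), f r = g * ∑ r ∈ Finset.Icc 1 q, f r := by
  have hg : ∀ g r, f (g * q + r) = f r := by
    intro g r
    induction g with
    | zero => simp
    | succ g ih => rw [← ih, ← hf (g * q + r)]; congr 1; ring
  rw [sum_Icc_one_eq, sum_Icc_one_eq]
  induction g with
  | zero => simp
  | succ g ih =>
    rw [add_mul, one_mul, Finset.sum_range_add, ih]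
    have : ∀ i, f (1 + (g * q + i)) = f (1 + i) := by
      intro i; rw [← hg g (1 + i)]; congr 1; ring
    simp_rw [this]
    push_cast; ring

lemma gaussSum_mul_mul (k a q g : ℕ) (hg : 0 < g) (hq : 0 < q) :
    gaussSum k (g * a) (g * q) = gaussSum k a q := by
  have hg' : (g : ℝ) ≠ 0 := by exact_mod_cast hg.ne'
  have hq' : (q : ℝ) ≠ 0 := by exact_mod_cast hq.ne'
  have h1 : ((g * a : ℕ) : ℝ) / ((g * q : ℕ) : ℝ) = (a : ℝ) / q := by
    push_cast; rw [mul_div_mul_left _ _ hg']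
  rw [gaussSum, gaussSum, h1, sum_Icc_periodic]
  · have hg'' : (g : ℂ) ≠ 0 := by exact_mod_cast hg.ne'
    have hq'' : (q : ℂ) ≠ 0 := by exact_mod_cast hq.ne'
    push_cast; field_simp
  · intro r
    have : NeZero q := ⟨hq.ne'⟩
    have h2 : ∀ s : ℕ, e ((a : ℝ) / q * (s : ℝ) ^ k) =
        ZMod.stdAddChar ((a : ZMod q) * (s : ZMod q) ^ k) := by
      intro s
      have := stdAddChar_intCast (q := q) ((a : ℤ) * (s : ℤ) ^ k)
      push_cast at this
      rw [this]; congr 1; ring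
    rw [h2, h2]; simp

/-- Sort the fractions `b/Q` by their denominator in lowest terms. -/
lemma sum_Icc_eq_sum_divisors {F : ℕ → ℕ → ℂ} (hF : ∀ g a q, 0 < g → 0 < q → F (g * a) (g * q) = F a q)
    (Q : ℕ) (hQ : 0 < Q) :
    ∑ b ∈ Finset.Icc 1 Q, F b Q =
      ∑ q ∈ Q.divisors, ∑ a ∈ (Finset.Icc 1 q).filter (fun a => Nat.Coprime a q), F a q := by
  rw [Finset.sum_sigma']
  refine Finset.sum_bij' (fun b _ => ⟨Q / Nat.gcd b Q, b / Nat.gcd b Q⟩)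
    (fun x _ => x.2 * (Q / x.1)) ?_ ?_ ?_ ?_ ?_
  · intro b hb
    simp only [Finset.mem_Icc] at hb
    have hg : 0 < Nat.gcd b Q := Nat.gcd_pos_of_pos_right _ hQ
    simp only [Finset.mem_sigma, Nat.mem_divisors, Finset.mem_filter, Finset.mem_Icc]
    refine ⟨⟨Nat.div_dvd_of_dvd (Nat.gcd_dvd_right _ _), hQ.ne'⟩, ⟨?_, Nat.div_le_div_right hb.2⟩,
      Nat.coprime_div_gcd_div_gcd hg⟩
    exact Nat.div_pos (Nat.le_of_dvd hb.1 (Nat.gcd_dvd_left _ _)) hg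
  · rintro ⟨q, a⟩ hx
    simp only [Finset.mem_sigma, Nat.mem_divisors, Finset.mem_filter, Finset.mem_Icc] at hx
    obtain ⟨⟨⟨c, rfl⟩, _⟩, ⟨ha1, ha2⟩, _⟩ := hx
    have hq : 0 < q := Nat.pos_of_mul_pos_right hQ
    have hc : 0 < c := Nat.pos_of_mul_pos_left hQ
    simp only [Finset.mem_Icc, Nat.mul_div_cancel_left c hq]
    exact ⟨Nat.mul_pos ha1 hc, Nat.mul_le_mul_right _ ha2⟩
  · intro b hb
    have hg : 0 < Nat.gcd b Q := Nat.gcd_pos_of_pos_right _ hQ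
    simp only
    rw [Nat.div_div_self (Nat.gcd_dvd_right _ _) hQ.ne', Nat.div_mul_cancel (Nat.gcd_dvd_left _ _)]
  · rintro ⟨q, a⟩ hx
    simp only [Finset.mem_sigma, Nat.mem_divisors, Finset.mem_filter, Finset.mem_Icc] at hx
    obtain ⟨⟨⟨c, rfl⟩, _⟩, ⟨ha1, ha2⟩, hco⟩ := hx
    have hq : 0 < q := Nat.pos_of_mul_pos_right hQ
    have hc : 0 < c := Nat.pos_of_mul_pos_left hQ
    have h1 : q * c / q = c := Nat.mul_div_cancel_left c hq
    have h2 : Nat.gcd (a * c) (q * c) = c := by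
      rw [Nat.gcd_mul_right, Nat.Coprime.gcd_eq_one hco, one_mul]
    simp only [h1, h2, Nat.mul_div_cancel _ hc]
  · intro b hb
    have hg : 0 < Nat.gcd b Q := Nat.gcd_pos_of_pos_right _ hQ
    have := hF (Nat.gcd b Q) (b / Nat.gcd b Q) (Q / Nat.gcd b Q) hg
      (Nat.div_pos (Nat.le_of_dvd hQ (Nat.gcd_dvd_right _ _)) hg)
    rw [Nat.mul_div_cancel' (Nat.gcd_dvd_left _ _), Nat.mul_div_cancel' (Nat.gcd_dvd_right _ _)] at this
    exact this

lemma addChar_map_sum {A M ι : Type*} [AddCommMonoid A] [CommMonoid M] (ψ : AddChar A M)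
    (s : Finset ι) (f : ι → A) : ψ (∑ i ∈ s, f i) = ∏ i ∈ s, ψ (f i) := by
  classical
  induction s using Finset.induction_on with
  | empty => simp
  | insert a s ha ih => rw [Finset.sum_insert ha, Finset.prod_insert ha, AddChar.map_add_eq_mul, ih]

/-- The number of solutions of `x₁^k + ⋯ + x_d^k = N` in `ZMod Q`. -/
noncomputable def solCount (k d Q : ℕ) [NeZero Q] (N : ZMod Q) : ℕ :=
  (Finset.univ.filter fun x : Fin d → ZMod Q => ∑ i, x i ^ k = N).card

/-- Both sides count solutions: the sum over `q ∣ Q` of reduced fractions is a sum over all `b/Q`,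
and orthogonality of the characters modulo `Q` detects the congruence. -/
theorem sum_divisors_singularTerm (k d N Q : ℕ) [NeZero Q] :
    (Q : ℂ) ^ d * ∑ q ∈ Q.divisors, singularTerm k d N q = Q * solCount k d Q N := by
  have hQ : 0 < Q := Nat.pos_of_ne_zero (NeZero.ne Q)
  have hQ' : (Q : ℂ) ≠ 0 := by exact_mod_cast hQ.ne'
  have h1 : ∑ q ∈ Q.divisors, singularTerm k d N q =
      ∑ b ∈ Finset.Icc 1 Q, gaussSum k b Q ^ d * e (-((N : ℝ) * (b : ℝ) / (Q : ℝ))) := by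
    rw [sum_Icc_eq_sum_divisors (F := fun b Q => gaussSum k b Q ^ d * e (-((N : ℝ) * (b : ℝ) / (Q : ℝ))))
      _ Q hQ]
    · rfl
    · intro g a q hg hq
      have hg' : (g : ℝ) ≠ 0 := by exact_mod_cast hg.ne'
      rw [gaussSum_mul_mul k a q g hg hq]
      congr 3
      push_cast
      rw [mul_left_comm, mul_div_mul_left _ _ hg']
  have h2 : ∀ b : ℕ, (Q : ℂ) ^ d * (gaussSum k b Q ^ d * e (-((N : ℝ) * (b : ℝ) / (Q : ℝ)))) =
      ∑ x : Fin d → ZMod Q, ZMod.stdAddChar ((b : ZMod Q) * (∑ i, x i ^ k - (N : ZMod Q))) := by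
    intro b
    have h3 : e (-((N : ℝ) * (b : ℝ) / (Q : ℝ))) = ZMod.stdAddChar (-((b : ZMod Q) * (N : ZMod Q))) := by
      have := stdAddChar_intCast (q := Q) (-((b : ℤ) * (N : ℤ)))
      push_cast at this
      rw [this]; congr 1; ring
    rw [h3, gaussSum_eq, ← mul_assoc, ← mul_pow, ← mul_assoc, mul_one_div_cancel hQ', one_mul,
      Fintype.sum_pow, Finset.sum_mul]
    refine Finset.sum_congr rfl fun x _ => ?_
    rw [mul_sub, sub_eq_add_neg, AddChar.map_add_eq_mul, Finset.mul_sum, addChar_map_sum]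
  rw [h1, Finset.mul_sum]
  simp_rw [h2]
  rw [sum_Icc_zmod Q (fun b => ∑ x : Fin d → ZMod Q, ZMod.stdAddChar (b * (∑ i, x i ^ k - (N : ZMod Q)))),
    Finset.sum_comm]
  simp_rw [AddChar.sum_mulShift _ (ZMod.isPrimitive_stdAddChar Q)]
  push_cast
  rw [solCount, ← Finset.sum_filter, Finset.sum_const]
  simp [sub_eq_zero, mul_comm]

lemma norm_sum_divisors_singularTerm (k d N Q : ℕ) [NeZero Q] :
    ‖∑ q ∈ Q.divisors, singularTerm k (d + 1) N q‖ = solCount k (d + 1) Q N / (Q : ℝ) ^ d := by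
  have hQ : (0 : ℝ) < Q := by exact_mod_cast Nat.pos_of_ne_zero (NeZero.ne Q)
  have h := congrArg norm (sum_divisors_singularTerm k (d + 1) N Q)
  rw [norm_mul, norm_pow, norm_mul] at h
  simp only [Complex.norm_natCast] at h
  rw [eq_div_iff (by positivity)]
  apply mul_left_cancel₀ hQ.ne'
  rw [← h]; ring

/-- Pairs of solutions glue by the Chinese remainder theorem. Only this inequality is needed for a
lower bound. -/
lemma solCount_mul_le (k d a b N : ℕ) [NeZero a] [NeZero b] [NeZero (a * b)] (hab : Nat.Coprime a b) :
    solCount k d a N * solCount k d b N ≤ solCount k d (a * b) N := by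
  rw [solCount, solCount, solCount, ← Finset.card_product]
  refine Finset.card_le_card_of_injOn
    (fun xy i => (ZMod.chineseRemainder hab).symm (xy.1 i, xy.2 i)) ?_ ?_
  · rintro ⟨x, y⟩ h
    simp only [Finset.coe_product, Finset.coe_filter, Finset.mem_univ, true_and, Set.mem_prod,
      Set.mem_ofPred_eq] at h ⊢
    apply (ZMod.chineseRemainder hab).injective
    simp only [map_sum, map_pow, RingEquiv.apply_symm_apply, map_natCast]
    ext
    · simp [Prod.fst_sum, h.1]
    · simp [Prod.snd_sum, h.2]
  · rintro ⟨x, y⟩ _ ⟨x', y'⟩ _ h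
    have : ∀ i, x i = x' i ∧ y i = y' i := by
      intro i
      have := congrFun h i
      simpa using this
    ext i
    · exact (this i).1
    · exact (this i).2

/-- Hensel lifting for `k`-th powers with a composite modulus. -/
lemma exists_pow_lift (k R : ℕ) (u y : ℤ) (hy : IsCoprime y (R : ℤ))
    (h : ((k ^ 2 * R : ℕ) : ℤ) ∣ y ^ k - u) (n : ℕ) :
    ∃ z : ℤ, IsCoprime z (R : ℤ) ∧ ((k ^ 2 * R ^ (n + 1) : ℕ) : ℤ) ∣ z ^ k - u := by
  induction n with
  | zero => exact ⟨y, hy, by simpa using h⟩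
  | succ n ih =>
    obtain ⟨z, hz, w, hw⟩ := ih
    obtain ⟨a, b, hab⟩ : IsCoprime (z ^ (k - 1)) (R : ℤ) := hz.pow_left
    -- Newton step with increment a multiple of `M`: the linear term is `k z^{k-1} M = k² R^{n+1}
    -- z^{k-1}`, matching the error up to a unit modulo `R`, and `M² = k² R^{2n+2}` is already
    -- divisible by `k² R^{n+2}`. This is why the starting modulus carries `k²`.
    set M : ℤ := k * R ^ (n + 1) with hM
    obtain ⟨c, hc⟩ := Polynomial.powAddExpansion z (M * (-(w * a))) k
    refine ⟨z + M * (-(w * a)), ?_, ?_⟩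
    · have : M * (-(w * a)) = (R : ℤ) * (k * R ^ n * (-(w * a))) := by rw [hM]; ring
      rw [this]
      exact hz.add_mul_left_left _
    · rw [hc]
      refine ⟨w * b + c * R ^ n * (w * a) ^ 2, ?_⟩
      have h1 : z ^ k = u + ((k ^ 2 * R ^ (n + 1) : ℕ) : ℤ) * w := by linarith
      have h2 : z ^ (k - 1) * a = 1 - b * R := by linarith
      rw [h1, hM]
      push_cast
      linear_combination (-(k ^ 2 * R ^ (n + 1) * w)) * h2

/-- Every residue class modulo `D` is a sum of `d + 1` `k`-th powers, the first one of a unit. -/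
def RepresentsAll (k d D : ℕ) : Prop :=
  ∀ N : ℤ, ∃ x : Fin (d + 1) → ℤ, IsCoprime (x 0) (D : ℤ) ∧ (D : ℤ) ∣ ∑ i, x i ^ k - N

lemma RepresentsAll.mul {k d a b : ℕ} (ha : RepresentsAll k d a) (hb : RepresentsAll k d b)
    (hab : Nat.Coprime a b) : RepresentsAll k d (a * b) := by
  intro N
  obtain ⟨x, hx0, hx⟩ := ha N
  obtain ⟨y, hy0, hy⟩ := hb N
  obtain ⟨u, v, huv⟩ : IsCoprime (a : ℤ) (b : ℤ) := Nat.isCoprime_iff_coprime.2 hab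
  set z : Fin (d + 1) → ℤ := fun i => x i * (v * b) + y i * (u * a) with hz
  have hza : ∀ i, z i = x i + a * (u * (y i - x i)) := by
    intro i; simp only [hz]; linear_combination (x i) * huv
  have hzb : ∀ i, z i = y i + b * (v * (x i - y i)) := by
    intro i; simp only [hz]; linear_combination (y i) * huv
  have key : ∀ (D : ℕ) (s t : Fin (d + 1) → ℤ), (∀ i, z i = s i + D * t i) →
      (D : ℤ) ∣ ∑ i, s i ^ k - N → (D : ℤ) ∣ ∑ i, z i ^ k - N := by
    intro D s t hst hs
    have h1 : (D : ℤ) ∣ ∑ i, (z i ^ k - s i ^ k) := by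
      refine Finset.dvd_sum fun i _ => ?_
      refine dvd_trans ?_ (sub_dvd_pow_sub_pow (z i) (s i) k)
      rw [hst i]; simp
    rw [Finset.sum_sub_distrib] at h1
    have := dvd_add h1 hs
    rwa [sub_add_sub_cancel] at this
  refine ⟨z, ?_, ?_⟩
  · push_cast
    refine IsCoprime.mul_right ?_ ?_
    · rw [hza]; exact hx0.add_mul_left_left _
    · rw [hzb]; exact hy0.add_mul_left_left _
  · push_cast
    refine IsCoprime.mul_dvd (Nat.isCoprime_iff_coprime.2 hab) ?_ ?_
    · exact key a x _ hza hx
    · exact key b y _ hzb hy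

lemma sum_fin_ite_lt (d n : ℕ) (hn : n ≤ d) (s : ℤ) (k : ℕ) (hk : k ≠ 0) :
    ∑ i : Fin d, (if (i : ℕ) < n then s else 0) ^ k = n * s ^ k := by
  have : ∀ i : Fin d, (if (i : ℕ) < n then s else 0) ^ k = if (i : ℕ) < n then s ^ k else 0 := by
    intro i; split_ifs <;> simp [hk]
  simp_rw [this]
  rw [Fin.sum_univ_eq_sum_range (fun i => if i < n then s ^ k else 0) d, ← Finset.sum_filter,
    Finset.sum_const]
  have : (Finset.range d).filter (fun i => i < n) = Finset.range n := by
    ext i; simp; omega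
  rw [this]; simp

/-- For a small modulus, zeros and ones suffice. -/
lemma representsAll_of_le (k d D : ℕ) (hk : k ≠ 0) (hD : 0 < D) (h : D ≤ d + 1) :
    RepresentsAll k d D := by
  intro N
  have hD' : (0 : ℤ) < D := by exact_mod_cast hD
  -- The shift by one takes the representative of `N` in `[1, D]`, so that the first coordinate is
  -- `1` even when `D` divides `N`.
  set n : ℕ := ((N - 1) % D).toNat + 1 with hn
  have h0 := Int.emod_nonneg (N - 1) hD'.ne'
  have h1 := Int.emod_lt_of_pos (N - 1) hD'
  have h2 : (n : ℤ) = (N - 1) % D + 1 := by rw [hn]; push_cast; rw [Int.toNat_of_nonneg h0]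
  have h3 : n ≤ d + 1 := by omega
  refine ⟨fun i => if (i : ℕ) < n then 1 else 0, ?_, ?_⟩
  · simp [hn, isCoprime_one_left]
  · rw [sum_fin_ite_lt (d + 1) n h3 1 k hk, h2]
    have := Int.emod_add_mul_ediv (N - 1) D
    refine ⟨-((N - 1) / D), ?_⟩
    rw [one_pow]; linarith

/-- For odd `k` the value `-1` is also a `k`-th power, so the balanced residue of `N` needs only
about half as many variables. The class of zero is written `1 + (-1)` to keep a unit coordinate. -/
lemma representsAll_of_odd (k d D : ℕ) (hk : Odd k) (hD : 0 < D) (hd : 1 ≤ d)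
    (h : D ≤ 2 * (d + 1)) : RepresentsAll k d D := by
  intro N
  have hk0 : k ≠ 0 := by rintro rfl; simp at hk
  have h1 := Int.le_bmod (x := N) hD
  have h2 := Int.bmod_le (x := N) hD
  have hdvd : (D : ℤ) ∣ N.bmod D - N := Int.dvd_bmod_sub_self
  rcases lt_trichotomy (N.bmod D) 0 with h0 | h0 | h0
  · obtain ⟨n, hn⟩ : ∃ n : ℕ, N.bmod D = -((n : ℤ) + 1) := ⟨(-N.bmod D - 1).toNat, by omega⟩
    refine ⟨fun i => if (i : ℕ) < n + 1 then -1 else 0, ?_, ?_⟩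
    · simpa using isCoprime_one_left.neg_left
    · rw [sum_fin_ite_lt (d + 1) (n + 1) (by omega) (-1) k hk0, hk.neg_one_pow]
      rw [hn] at hdvd; push_cast; convert hdvd using 1; ring
  · refine ⟨Fin.cons 1 fun i => if (i : ℕ) < 1 then -1 else 0, ?_, ?_⟩
    · simp [isCoprime_one_left]
    · rw [Fin.sum_univ_succ]
      simp only [Fin.cons_zero, Fin.cons_succ]
      rw [sum_fin_ite_lt d 1 hd (-1) k hk0, hk.neg_one_pow]
      rw [h0] at hdvd; simpa using hdvd
  · obtain ⟨n, hn⟩ : ∃ n : ℕ, N.bmod D = (n : ℤ) + 1 := ⟨(N.bmod D - 1).toNat, by omega⟩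
    refine ⟨fun i => if (i : ℕ) < n + 1 then 1 else 0, ?_, ?_⟩
    · simp [isCoprime_one_left]
    · rw [sum_fin_ite_lt (d + 1) (n + 1) (by omega) 1 k hk0]
      rw [hn] at hdvd; push_cast; convert hdvd using 1; ring

lemma cube_le_two_pow (k : ℕ) (hk : 2 ≤ k) : k ^ 3 ≤ 2 ^ (k + 2) := by
  rcases Nat.lt_or_ge k 8 with h | h
  · interval_cases k <;> norm_num
  · induction k, h using Nat.le_induction with
    | base => norm_num
    | succ n hn ih =>
      have h1 := ih (by omega)
      have h2 : (n + 1) ^ 3 ≤ 2 * n ^ 3 := by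
        nlinarith [Nat.mul_le_mul hn (Nat.mul_le_mul hn hn), Nat.mul_le_mul hn hn,
          Nat.mul_le_mul hn (le_refl (n * n))]
      calc (n + 1) ^ 3 ≤ 2 * n ^ 3 := h2
        _ ≤ 2 * 2 ^ (n + 2) := by omega
        _ = _ := by ring

/-- Here the modulus is at most `p k² ≤ k³ ≤ 2^{k+2}`, twice the guaranteed number of variables. Odd
`k` gains the factor two from signs; even `k > 2` gains it from `2p ≤ k`; for `k = 2` the modulus is
at most `8 = 2^{k+1}`. -/
lemma representsAll_prime_pow_of_dvd (k d p n : ℕ) (hk : 2 ≤ k) (hd : 2 ^ (k + 1) ≤ d + 1)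
    (hp : p.Prime) (hpk : p ∣ k) (hn : n ≤ 2 * k.factorization p + 1) :
    RepresentsAll k d (p ^ n) := by
  have hple : p ≤ k := Nat.le_of_dvd (by omega) hpk
  have hv : p ^ k.factorization p ≤ k := Nat.ordProj_le p (by omega)
  have h1 : p ^ n ≤ p * k ^ 2 := by
    calc p ^ n ≤ p ^ (2 * k.factorization p + 1) := Nat.pow_le_pow_right hp.pos hn
      _ = p * (p ^ k.factorization p) ^ 2 := by rw [pow_succ', mul_comm 2, pow_mul]
      _ ≤ p * k ^ 2 := Nat.mul_le_mul_left _ (Nat.pow_le_pow_left hv 2)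
  have hc := cube_le_two_pow k hk
  have hpos : 0 < p ^ n := pow_pos hp.pos n
  have e1 : 2 ^ (k + 2) = 2 * 2 ^ (k + 1) := by ring
  have hd1 : 2 ^ 3 ≤ 2 ^ (k + 1) := Nat.pow_le_pow_right (by norm_num) (by omega)
  rcases Nat.even_or_odd k with he | ho
  · refine representsAll_of_le k d _ (by omega) hpos ?_
    rcases Nat.lt_or_ge 2 k with h2 | h2
    · have h3 : 2 * p ≤ k := by
        obtain ⟨c, hc⟩ := hpk
        rcases Nat.lt_or_ge c 2 with hc2 | hc2
        · interval_cases c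
          · omega
          · exfalso
            have : k = p := by omega
            rw [this] at he h2
            have := (hp.even_iff).1 he
            omega
        · rw [hc, mul_comm p c]; exact Nat.mul_le_mul_right _ hc2
      have : 2 * (p * k ^ 2) ≤ k ^ 3 := by
        calc 2 * (p * k ^ 2) = (2 * p) * k ^ 2 := by ring
          _ ≤ k * k ^ 2 := Nat.mul_le_mul_right _ h3
          _ = k ^ 3 := by ring
      omega
    · have hk2 : k = 2 := by omega
      subst hk2
      have : p * 2 ^ 2 ≤ 2 * 2 ^ 2 := Nat.mul_le_mul_right _ hple
      omega
  · refine representsAll_of_odd k d _ ho hpos (by omega) ?_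
    have : p * k ^ 2 ≤ k ^ 3 := by
      calc p * k ^ 2 ≤ k * k ^ 2 := Nat.mul_le_mul_right _ hple
        _ = k ^ 3 := by ring
    omega

open Finset Pointwise in
-- Nonzero `k`-th powers number at least `(p - 1)/k`, since each has at most `k` roots. By
-- Cauchy–Davenport each further summand enlarges the set of sums by at least that amount until it
-- is everything.
lemma exists_sum_pow_eq_zmod (k p : ℕ) (hk : 0 < k) (hp : p.Prime) (s : ZMod p) :
    ∃ x : Fin k → ZMod p, ∑ i, x i ^ k = s := by
  classical
  have : Fact p.Prime := ⟨hp⟩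
  set A : Finset (ZMod p) := univ.image fun x => x ^ k with hA
  have h0A : (0 : ZMod p) ∈ A := mem_image.2 ⟨0, mem_univ _, by simp [hk.ne']⟩
  have hAcard : p ≤ k * (#A - 1) + 1 := by
    have h1 : #((univ : Finset (ZMod p)).erase 0) ≤ k * #(((univ : Finset (ZMod p)).erase 0).image fun x => x ^ k) := by
      refine card_le_mul_card_image _ _ fun a _ => ?_
      calc _ ≤ #(Polynomial.nthRoots k a).toFinset := card_le_card fun x hx => by
            simp only [mem_filter] at hx
            simp [Polynomial.mem_nthRoots hk, hx.2]
        _ ≤ Multiset.card (Polynomial.nthRoots k a) := Multiset.toFinset_card_le _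
        _ ≤ k := Polynomial.card_nthRoots k a
    have h2 : ((univ : Finset (ZMod p)).erase 0).image (fun x => x ^ k) ⊆ A.erase 0 := by
      intro a ha
      obtain ⟨x, hx, rfl⟩ := mem_image.1 ha
      exact mem_erase.2 ⟨pow_ne_zero _ (mem_erase.1 hx).1, mem_image_of_mem _ (mem_univ _)⟩
    have h3 := card_le_card h2
    rw [card_erase_of_mem h0A] at h3
    rw [card_erase_of_mem (mem_univ _), card_univ, ZMod.card] at h1
    have := h1.trans (Nat.mul_le_mul_left k h3)
    omega
  have key : ∀ j : ℕ, ∃ S : Finset (ZMod p), S.Nonempty ∧ min p (j * (#A - 1) + 1) ≤ #S ∧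
      ∀ s ∈ S, ∃ x : Fin j → ZMod p, ∑ i, x i ^ k = s := by
    intro j
    induction j with
    | zero => exact ⟨{0}, by simp, by simp, by simp⟩
    | succ j ih =>
      obtain ⟨S, hS, hSc, hSx⟩ := ih
      refine ⟨S + A, hS.add ⟨0, h0A⟩, ?_, ?_⟩
      · have := ZMod.cauchy_davenport hp hS ⟨0, h0A⟩
        have hA1 : 0 < #A := card_pos.2 ⟨0, h0A⟩
        rw [add_mul, one_mul]
        omega
      · intro s hs
        obtain ⟨a, ha, b, hb, rfl⟩ := mem_add.1 hs
        obtain ⟨x, rfl⟩ := hSx a ha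
        obtain ⟨y, _, rfl⟩ := mem_image.1 hb
        exact ⟨Fin.cons y x, by simp [Fin.sum_univ_succ, add_comm]⟩
  obtain ⟨S, -, hSc, hSx⟩ := key k
  rw [min_eq_left hAcard] at hSc
  have : S = univ := by
    rw [← card_eq_iff_eq_univ, ZMod.card]
    exact le_antisymm ((card_le_univ S).trans (ZMod.card p).le) hSc
  exact hSx s (this ▸ mem_univ s)

/-- One coordinate is spent on the unit `1`; `k` others represent `N - 1` and the rest are zero. -/
lemma representsAll_prime (k d p : ℕ) (hk : 0 < k) (hd : k ≤ d) (hp : p.Prime) :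
    RepresentsAll k d p := by
  have : NeZero p := ⟨hp.ne_zero⟩
  intro N
  obtain ⟨x, hx⟩ := exists_sum_pow_eq_zmod k p hk hp ((N : ZMod p) - 1)
  refine ⟨Fin.cons 1 fun i => if h : (i : ℕ) < k then ((x ⟨i, h⟩).val : ℤ) else 0, ?_, ?_⟩
  · simp [isCoprime_one_left]
  · rw [← ZMod.intCast_zmod_eq_zero_iff_dvd, Fin.sum_univ_succ]
    simp only [Fin.cons_zero, Fin.cons_succ]
    obtain ⟨r, rfl⟩ := Nat.exists_eq_add_of_le hd
    rw [Fin.sum_univ_add]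
    simp [hk.ne', hx]

lemma representsAll_of_factorization (k d : ℕ) (hk : 2 ≤ k) (hd : 2 ^ (k + 1) ≤ d + 1) (D : ℕ) :
    D ≠ 0 → (∀ p, p.Prime → D.factorization p ≤ 2 * k.factorization p + 1) →
      RepresentsAll k d D := by
  have hkd : k ≤ d := by
    have := Nat.lt_two_pow_self (n := k + 1); omega
  induction D using Nat.recOnPosPrimePosCoprime with
  | prime_pow p n hp hn =>
    intro _ h
    have h1 := h p hp
    rw [hp.factorization_pow, Finsupp.single_eq_same] at h1
    by_cases hpk : p ∣ k
    · exact representsAll_prime_pow_of_dvd k d p n hk hd hp hpk h1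
    · rw [Nat.factorization_eq_zero_of_not_dvd hpk] at h1
      have : n = 1 := by omega
      rw [this, pow_one]
      exact representsAll_prime k d p (by omega) hkd hp
  | zero => intro h; exact absurd rfl h
  | one => intro _ _; exact representsAll_of_le k d 1 (by omega) one_pos (by omega)
  | coprime a b ha hb hab iha ihb =>
    intro _ h
    refine (iha (by omega) fun p hp => ?_).mul (ihb (by omega) fun p hp => ?_) hab
    · refine le_trans ?_ (h p hp)
      rw [Nat.factorization_mul (by omega) (by omega)]; simp
    · refine le_trans ?_ (h p hp)
      rw [Nat.factorization_mul (by omega) (by omega)]; simp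

end WaringMajor

/-! ### Exponential lower bound for the singular series -/

namespace WaringMajor

/-- Allows a modulus to be a multiple of any given integer while being split into a power of `R` and
a part coprime to `R`. -/
lemma exists_coprime_part (R : ℕ) (m : ℕ) (hm : 0 < m) :
    ∃ j w : ℕ, 0 < w ∧ Nat.Coprime w R ∧ m ∣ R ^ j * w := by
  induction m using Nat.strong_induction_on with
  | _ m ih =>
    by_cases h : Nat.Coprime m R
    · exact ⟨0, m, hm, h, by simp⟩
    · have hg : 1 < Nat.gcd m R := by
        have : 0 < Nat.gcd m R := Nat.gcd_pos_of_pos_left _ hm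
        have : Nat.gcd m R ≠ 1 := h
        omega
      obtain ⟨j, w, hw, hco, hdvd⟩ := ih (m / Nat.gcd m R) (Nat.div_lt_self hm hg)
        (Nat.div_pos (Nat.le_of_dvd hm (Nat.gcd_dvd_left _ _)) (by omega))
      refine ⟨j + 1, w, hw, hco, ?_⟩
      rw [← Nat.mul_div_cancel' (Nat.gcd_dvd_left m R), pow_succ', mul_assoc]
      exact Nat.mul_dvd_mul (Nat.gcd_dvd_right _ _) hdvd

/-- Fix one solution modulo `k² R`. Each of the `d` other coordinates moves freely within its class,
in `R^j` ways; the unit coordinate is then adjusted by Hensel lifting. -/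
lemma le_solCount_of_representsAll (k d R N j : ℕ) (hk : 0 < k) [NeZero (k ^ 2 * R ^ (j + 1))]
    (h : RepresentsAll k d (k ^ 2 * R)) :
    (R ^ j) ^ d ≤ solCount k (d + 1) (k ^ 2 * R ^ (j + 1)) N := by
  have hR : 0 < R := by
    by_contra hR
    have : R = 0 := by omega
    exact NeZero.ne (k ^ 2 * R ^ (j + 1)) (by simp [this])
  have : NeZero (R ^ j) := ⟨by positivity⟩
  obtain ⟨s, hs0, hs⟩ := h N
  have hs0R : IsCoprime (s 0) (R : ℤ) := by
    push_cast at hs0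
    exact hs0.of_mul_right_right
  set x : (Fin d → ZMod (R ^ j)) → Fin d → ℤ :=
    fun t i => s i.succ + (k ^ 2 * R : ℕ) * ((t i).val : ℤ) with hx
  have hex : ∀ t, ∃ z : ℤ, ((k ^ 2 * R ^ (j + 1) : ℕ) : ℤ) ∣ z ^ k - (N - ∑ i, x t i ^ k) := by
    intro t
    obtain ⟨z, -, hz⟩ := exists_pow_lift k R (N - ∑ i, x t i ^ k) (s 0) hs0R (by
      have h1 : ((k ^ 2 * R : ℕ) : ℤ) ∣ ∑ i : Fin d, (x t i ^ k - s i.succ ^ k) := by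
        refine Finset.dvd_sum fun i _ => dvd_trans ?_ (sub_dvd_pow_sub_pow _ _ k)
        simp [hx]
      rw [Fin.sum_univ_succ] at hs
      rw [Finset.sum_sub_distrib] at h1
      refine (dvd_add h1 hs).trans (dvd_of_eq ?_)
      ring) j
    exact ⟨z, hz⟩
  choose z hz using hex
  have hcard : (R ^ j) ^ d = (Finset.univ : Finset (Fin d → ZMod (R ^ j))).card := by
    rw [Finset.card_univ, Fintype.card_fun, ZMod.card, Fintype.card_fin]
  rw [hcard, solCount]
  refine Finset.card_le_card_of_injOn (fun t => Fin.cons (z t : ZMod _) fun i => (x t i : ZMod _)) ?_ ?_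
  · intro t _
    simp only [Finset.coe_filter, Finset.mem_univ, true_and, Set.mem_ofPred_eq]
    rw [Fin.sum_univ_succ]
    have := (ZMod.intCast_zmod_eq_zero_iff_dvd _ _).2 (hz t)
    push_cast at this
    simp only [Fin.cons_zero, Fin.cons_succ]
    rw [sub_eq_zero] at this
    rw [this]; simp
  · intro t _ t' _ htt
    have h1 := (Fin.cons_injective2 htt).2
    ext i
    have h2 := congrFun h1 i
    rw [ZMod.intCast_eq_intCast_iff_dvd_sub] at h2
    have h3 : ((k ^ 2 * R ^ (j + 1) : ℕ) : ℤ) = ((k ^ 2 * R : ℕ) : ℤ) * ((R ^ j : ℕ) : ℤ) := by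
      push_cast; ring
    have h4 : x t' i - x t i = ((k ^ 2 * R : ℕ) : ℤ) * (((t' i).val : ℤ) - (t i).val) := by
      simp only [hx]; ring
    rw [h3, h4] at h2
    have h5 := Int.dvd_of_mul_dvd_mul_left (by positivity) h2
    have h6 := (ZMod.intCast_eq_intCast_iff_dvd_sub _ _ (R ^ j)).2 h5
    simpa using h6

lemma singularTerm_one (k d N : ℕ) : singularTerm k d N 1 = 1 := by
  have h1 : ((Finset.Icc 1 1).filter fun a => Nat.Coprime a 1) = {1} := by decide
  rw [singularTerm, h1, Finset.sum_singleton, gaussSum]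
  have h2 : e (-((N : ℝ) * ((1 : ℕ) : ℝ) / ((1 : ℕ) : ℝ))) = 1 := by
    have := e_intCast (-(N : ℤ)); push_cast at this; simpa using this
  have h3 : e 1 = 1 := by simpa using e_natCast 1
  rw [h2]; simp [h3]

/-- The singular series is bounded below by `D ^ (-d)`, with `D` depending only on `k`. -/
theorem exists_le_norm_singularSeries (k : ℕ) (hk : 2 ≤ k) :
    ∃ D : ℝ, 1 ≤ D ∧ ∀ d : ℕ, 2 ^ (k + 1) ≤ d → ∀ N : ℕ, 1 ≤ D ^ d * ‖singularSeries k d N‖ := by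
  obtain ⟨K, hK1, hK⟩ := sum_gaussMoment_le k hk
  -- `P ≥ (2K)^4` makes the tail bound `K B^{-1/4}` at most `1/2`; `P ≥ k` puts every prime factor
  -- of `k` into `R`.
  set P : ℕ := k + ⌈(2 * K) ^ 4⌉₊ with hP
  set R : ℕ := primorial P with hR
  have hRpos : 0 < R := primorial_pos P
  have hD1 : (1 : ℝ) ≤ (k ^ 2 * R : ℕ) := by
    exact_mod_cast Nat.succ_le_of_lt (by positivity)
  refine ⟨2 * (k ^ 2 * R : ℕ), by linarith, fun d' hd' N => ?_⟩
  obtain ⟨d, rfl⟩ : ∃ d, d' = d + 1 := ⟨d' - 1, by have := Nat.two_pow_pos (k + 1); omega⟩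
  have h3d : 3 * 2 ^ (k - 1) ≤ d + 1 := by
    obtain ⟨m, rfl⟩ : ∃ m, k = m + 1 := ⟨k - 1, by omega⟩
    have : 2 ^ (m + 1 + 1) = 4 * 2 ^ m := by ring
    simp only [Nat.add_sub_cancel]; omega
  have hrep : RepresentsAll k d (k ^ 2 * R) := by
    refine representsAll_of_factorization k d hk hd' _ (by positivity) fun p hp => ?_
    rw [Nat.factorization_mul (by positivity) hRpos.ne', Nat.factorization_pow]
    simp only [Finsupp.coe_add, Finsupp.coe_smul, Pi.add_apply, Pi.smul_apply, smul_eq_mul]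
    have : R.factorization p ≤ 1 := by
      have hsq : Squarefree R := squarefree_primorial P
      exact hsq.natFactorization_le_one p
    omega
  -- lower bound along a sequence of moduli
  have hmain : ∀ n : ℕ, ∃ Q : ℕ, Q ≠ 0 ∧ n.factorial ∣ Q ∧
      1 ≤ (2 * (k ^ 2 * R : ℕ) : ℝ) ^ (d + 1) * ‖∑ q ∈ Q.divisors, singularTerm k (d + 1) N q‖ := by
    intro n
    obtain ⟨j, w, hw, hco, hdvd⟩ := exists_coprime_part R n.factorial (Nat.factorial_pos n)
    have hwne : NeZero w := ⟨hw.ne'⟩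
    have hQ1 : NeZero (k ^ 2 * R ^ (j + 1)) := ⟨by positivity⟩
    have hQ2 : NeZero (k ^ 2 * R ^ (j + 1) * w) := ⟨by positivity⟩
    refine ⟨k ^ 2 * R ^ (j + 1) * w, by positivity, ?_, ?_⟩
    · exact hdvd.trans (Nat.mul_dvd_mul_right ((pow_dvd_pow R (Nat.le_succ j)).trans
        (Dvd.intro_left _ rfl)) _)
    have hminFac : ∀ q ∈ w.divisors.erase 1, (2 * K) ^ 4 ≤ (q : ℝ) := by
      intro q hq
      obtain ⟨hq1, hqw⟩ := Finset.mem_erase.1 hq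
      have hqw := Nat.dvd_of_mem_divisors hqw
      have hpr := Nat.minFac_prime hq1
      have hlt : P < q.minFac := by
        by_contra hle
        have h1 : q.minFac ∣ R := (hpr.dvd_primorial_iff).2 (not_lt.1 hle)
        have h2 : q.minFac ∣ w := (Nat.minFac_dvd q).trans hqw
        exact hpr.one_lt.ne' (Nat.dvd_one.1 (hco ▸ Nat.dvd_gcd h2 h1))
      have h3 : q.minFac ≤ q := Nat.minFac_le (Nat.pos_of_dvd_of_pos hqw hw)
      have h4 : ⌈(2 * K) ^ 4⌉₊ ≤ q := by omega
      exact (Nat.le_ceil _).trans (by exact_mod_cast h4)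
    -- The divisor `1` contributes `1`, and every other divisor of `w` exceeds `P`, so the rest is
    -- at most `1/2`.
    have hw2 : 1 / 2 ≤ (solCount k (d + 1) w N : ℝ) / (w : ℝ) ^ d := by
      rw [← norm_sum_divisors_singularTerm]
      have h1 : (1 : ℕ) ∈ w.divisors := Nat.one_mem_divisors.2 hw.ne'
      rw [← Finset.add_sum_erase _ _ h1, singularTerm_one]
      have h2 : ‖∑ q ∈ w.divisors.erase 1, singularTerm k (d + 1) N q‖ ≤ 1 / 2 := by
        calc _ ≤ ∑ q ∈ w.divisors.erase 1, gaussMoment k (d + 1) q :=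
              (norm_sum_le _ _).trans (Finset.sum_le_sum fun q _ => norm_singularTerm_le _ _ _ _)
          _ ≤ K * ((2 * K) ^ 4) ^ (-(1 / 4 : ℝ)) :=
              (hK (d + 1) h3d).2 _ (by positivity) _ hminFac
          _ = 1 / 2 := by
              rw [← Real.rpow_natCast, ← Real.rpow_mul (by positivity)]
              norm_num
              rw [Real.rpow_neg_one]
              field_simp
      have h3 := norm_sub_norm_le (1 : ℂ) (-∑ q ∈ w.divisors.erase 1, singularTerm k (d + 1) N q)
      rw [sub_neg_eq_add, norm_neg, norm_one] at h3
      linarith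
    have hcop : Nat.Coprime (k ^ 2 * R ^ (j + 1)) w := by
      have h1 : Nat.Coprime k w := by
        rw [Nat.coprime_iff_gcd_eq_one] 
        by_contra hne
        have hpr := Nat.minFac_prime hne
        have h1 := (Nat.minFac_dvd _).trans (Nat.gcd_dvd_left k w)
        have h2 := (Nat.minFac_dvd _).trans (Nat.gcd_dvd_right k w)
        have h3 : (Nat.gcd k w).minFac ∣ R := (hpr.dvd_primorial_iff).2
          ((Nat.le_of_dvd (by omega) h1).trans (by omega))
        exact hpr.one_lt.ne' (Nat.dvd_one.1 (hco ▸ Nat.dvd_gcd h2 h3))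
      exact Nat.Coprime.mul_left (h1.pow_left 2) (hco.symm.pow_left _)
    have h1 := le_solCount_of_representsAll k d R N j (by omega) hrep
    have h2 := solCount_mul_le k (d + 1) (k ^ 2 * R ^ (j + 1)) w N hcop
    rw [norm_sum_divisors_singularTerm]
    have h3 : ((R : ℝ) ^ j) ^ d * solCount k (d + 1) w N ≤
        solCount k (d + 1) (k ^ 2 * R ^ (j + 1) * w) N := by
      exact_mod_cast (Nat.mul_le_mul_right _ h1).trans (by simpa using h2)
    have hRr : (0 : ℝ) < R := by exact_mod_cast hRpos
    have hkr : (0 : ℝ) < k := by exact_mod_cast (by omega : 0 < k)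
    have hwr : (0 : ℝ) < w := by exact_mod_cast hw
    calc (1 : ℝ) ≤ (2 * (k ^ 2 * R : ℕ) : ℝ) ^ (d + 1) * ((1 / 2) / (k ^ 2 * R : ℕ) ^ d) := by
          rw [pow_succ, mul_pow]
          have : (1 : ℝ) ≤ 2 ^ d := one_le_pow₀ (by norm_num)
          have h5 : (0 : ℝ) < (k ^ 2 * R : ℕ) ^ d := by positivity
          have : (2 : ℝ) ^ d * ((k ^ 2 * R : ℕ) : ℝ) ^ d * (2 * (k ^ 2 * R : ℕ)) * (1 / 2 / (k ^ 2 * R : ℕ) ^ d)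
              = 2 ^ d * (k ^ 2 * R : ℕ) := by field_simp
          rw [this]
          nlinarith
      _ ≤ (2 * (k ^ 2 * R : ℕ) : ℝ) ^ (d + 1) * ((solCount k (d + 1) w N / (w : ℝ) ^ d) / (k ^ 2 * R : ℕ) ^ d) := by
          gcongr
      _ = (2 * (k ^ 2 * R : ℕ) : ℝ) ^ (d + 1) * ((((R : ℝ) ^ j) ^ d * solCount k (d + 1) w N) / ((k ^ 2 * R ^ (j + 1) * w : ℕ) : ℝ) ^ d) := by
          congr 1
          push_cast
          rw [show (k : ℝ) ^ 2 * (R : ℝ) ^ (j + 1) * w = (R : ℝ) ^ j * w * (k ^ 2 * R) by ring,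
            mul_pow ((R : ℝ) ^ j * w), mul_pow ((R : ℝ) ^ j)]
          field_simp
      _ ≤ _ := by
          refine mul_le_mul_of_nonneg_left ?_ (by positivity)
          gcongr
  choose Q hQ0 hQd hQ using hmain
  -- Since `n! ∣ Q n`, these divisor sets eventually contain any finite set of indices, so the
  -- bounds pass to the full series. The index `0` is inserted for this reason; its term is zero.
  have htend : Filter.Tendsto (fun n => insert 0 (Q n).divisors) Filter.atTop Filter.atTop := by
    rw [Filter.tendsto_atTop]
    intro s
    filter_upwards [Filter.eventually_ge_atTop (s.sup id)] with n hn
    intro q hq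
    have hqn : q ≤ n := (Finset.le_sup (f := id) hq).trans hn
    rcases Nat.eq_zero_or_pos q with rfl | hq0
    · simp
    · exact Finset.mem_insert_of_mem (Nat.mem_divisors.2
        ⟨(Nat.dvd_factorial hq0 hqn).trans (hQd n), hQ0 n⟩)
  have hsum := (summable_norm_singularTerm k (d + 1) N hk h3d).of_norm.hasSum
  have hlim := ((hsum.comp htend).norm).const_mul ((2 * (k ^ 2 * R : ℕ) : ℝ) ^ (d + 1))
  refine ge_of_tendsto' hlim fun n => ?_
  have h0 : singularTerm k (d + 1) N 0 = 0 := by simp [singularTerm]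
  simp only [Function.comp_apply]
  rw [Finset.sum_insert (by simp), h0, zero_add]
  exact hQ n

end WaringMajor

/-! ### The exponential sum near a rational; decay of the oscillatory integral -/

namespace WaringMajor

open MeasureTheory intervalIntegral

/-- The continuous analogue `∫_0^Y e(β x^k) dx` of the exponential sum. -/
noncomputable def contSum (k : ℕ) (Y β : ℝ) : ℂ := ∫ x in (0 : ℝ)..Y, e (β * x ^ k)

lemma norm_e_sub_le (s t : ℝ) : ‖e s - e t‖ ≤ 2 * Real.pi * |s - t| := by
  have := Convex.norm_image_sub_le_of_norm_hasDerivWithin_le (f := e)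
    (f' := fun x => 2 * Real.pi * Complex.I * e x) (s := Set.univ) (C := 2 * Real.pi) (x := t) (y := s)
    (fun x _ => (hasDerivAt_e x).hasDerivWithinAt) (fun x _ => by
      rw [norm_mul, norm_e]; simp [abs_of_pos Real.pi_pos]) convex_univ trivial trivial
  simpa using this

lemma continuous_e_mul_pow (k : ℕ) (β : ℝ) : Continuous fun x : ℝ => e (β * x ^ k) :=
  continuous_e.comp (by fun_prop)

lemma norm_e_mul_pow_sub_le (k : ℕ) (β X x y : ℝ) (hx : |x| ≤ X) (hy : |y| ≤ X) :
    ‖e (β * x ^ k) - e (β * y ^ k)‖ ≤ 2 * Real.pi * |β| * k * X ^ (k - 1) * |x - y| := by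
  refine (norm_e_sub_le _ _).trans ?_
  rw [← mul_sub, abs_mul]
  have h1 := abs_pow_sub_pow_le x y k
  have h2 : max |x| |y| ^ (k - 1) ≤ X ^ (k - 1) := by gcongr; exact max_le hx hy
  calc 2 * Real.pi * (|β| * |x ^ k - y ^ k|)
      ≤ 2 * Real.pi * (|β| * (|x - y| * k * X ^ (k - 1))) := by
        gcongr
        exact h1.trans (by gcongr)
    _ = _ := by ring

lemma norm_mul_sub_integral_le (k : ℕ) (β X A : ℝ) (q : ℕ) (x : ℝ) (hA : 0 ≤ A)
    (hX : A + q ≤ X) (hx : x ∈ Set.Icc A (A + q)) :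
    ‖(q : ℂ) * e (β * x ^ k) - ∫ t in A..(A + q), e (β * t ^ k)‖ ≤
      q * (2 * Real.pi * |β| * k * X ^ (k - 1) * q) := by
  have h1 : (q : ℂ) * e (β * x ^ k) - ∫ t in A..(A + q), e (β * t ^ k) =
      ∫ t in A..(A + q), (e (β * x ^ k) - e (β * t ^ k)) := by
    rw [intervalIntegral.integral_sub (by simp) ((continuous_e_mul_pow k β).intervalIntegrable _ _)]
    simp
  rw [h1]
  have hX0 : 0 ≤ X := hA.trans ((le_add_of_nonneg_right (Nat.cast_nonneg q)).trans hX)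
  have := intervalIntegral.norm_integral_le_of_norm_le_const (a := A) (b := A + q)
    (f := fun t => e (β * x ^ k) - e (β * t ^ k))
    (C := 2 * Real.pi * |β| * k * X ^ (k - 1) * q) (fun t ht => by
      rw [Set.uIoc_of_le (by simp)] at ht
      refine (norm_e_mul_pow_sub_le k β X x t ?_ ?_).trans ?_
      · rw [abs_of_nonneg (hA.trans hx.1)]; exact hx.2.trans hX
      · rw [abs_of_nonneg (hA.trans ht.1.le)]; exact ht.2.trans hX
      · gcongr
        rw [abs_le]; constructor <;> linarith [hx.1, hx.2, ht.1, ht.2])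
  simp only [add_sub_cancel_left, Nat.abs_cast] at this
  linarith

lemma e_div_mul_pow_periodic (k a q : ℕ) (hq : 0 < q) (m r : ℕ) :
    e ((a : ℝ) / q * ((m * q + r : ℕ) : ℝ) ^ k) = e ((a : ℝ) / q * (r : ℝ) ^ k) := by
  have : NeZero q := ⟨hq.ne'⟩
  have h2 : ∀ s : ℕ, e ((a : ℝ) / q * (s : ℝ) ^ k) =
      ZMod.stdAddChar ((a : ZMod q) * (s : ZMod q) ^ k) := by
    intro s
    have := stdAddChar_intCast (q := q) ((a : ℤ) * (s : ℤ) ^ k)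
    push_cast at this
    rw [this]; congr 1; ring
  rw [h2, h2]; simp

lemma expSum_add (k m n : ℕ) (ξ : ℝ) :
    expSum k (m + n) ξ = expSum k m ξ + ∑ j ∈ Finset.Icc 1 n, e (ξ * ((m + j : ℕ) : ℝ) ^ k) := by
  rw [expSum, expSum, sum_Icc_one_eq, sum_Icc_one_eq, sum_Icc_one_eq, Finset.sum_range_add]
  congr 1
  refine Finset.sum_congr rfl fun i _ => ?_
  congr 4; ring

/-- Over one period the arithmetic phase runs through the Gauss sum, while `e(β x^k)` varies so
little that each value can be replaced by its mean over the block. -/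
lemma norm_expSum_block_sub_le (k a q m : ℕ) (hq : 0 < q) (β X : ℝ) (hX : ((m * q + q : ℕ) : ℝ) ≤ X) :
    ‖∑ j ∈ Finset.Icc 1 q, e (((a : ℝ) / q + β) * ((m * q + j : ℕ) : ℝ) ^ k) -
      gaussSum k a q * ∫ t in ((m * q : ℕ) : ℝ)..((m * q : ℕ) : ℝ) + q, e (β * t ^ k)‖ ≤
      q * (2 * Real.pi * |β| * k * X ^ (k - 1) * q) := by
  have hq' : (0 : ℝ) < q := by exact_mod_cast hq
  have hqc : (q : ℂ) ≠ 0 := by exact_mod_cast hq.ne'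
  set J := ∫ t in ((m * q : ℕ) : ℝ)..((m * q : ℕ) : ℝ) + q, e (β * t ^ k) with hJ
  have h1 : ∑ j ∈ Finset.Icc 1 q, e (((a : ℝ) / q + β) * ((m * q + j : ℕ) : ℝ) ^ k) -
      gaussSum k a q * J = ∑ j ∈ Finset.Icc 1 q, (1 / (q : ℂ)) * e ((a : ℝ) / q * (j : ℝ) ^ k) *
        (q * e (β * ((m * q + j : ℕ) : ℝ) ^ k) - J) := by
    rw [gaussSum, mul_assoc, Finset.sum_mul, Finset.mul_sum, ← Finset.sum_sub_distrib]
    refine Finset.sum_congr rfl fun j _ => ?_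
    rw [add_mul, e_add, e_div_mul_pow_periodic k a q hq]
    field_simp
  rw [h1]
  calc _ ≤ ∑ j ∈ Finset.Icc 1 q, (1 / (q : ℝ)) * (q * (2 * Real.pi * |β| * k * X ^ (k - 1) * q)) := by
        refine (norm_sum_le _ _).trans (Finset.sum_le_sum fun j hj => ?_)
        rw [norm_mul, norm_mul, norm_e]
        simp only [norm_div, norm_one, Complex.norm_natCast, mul_one]
        refine mul_le_mul_of_nonneg_left ?_ (by positivity)
        refine norm_mul_sub_integral_le k β X _ q _ (by positivity) (by push_cast at hX ⊢; exact hX) ?_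
        have hj2 := (Finset.mem_Icc.1 hj).2
        have : (j : ℝ) ≤ q := by exact_mod_cast hj2
        push_cast
        constructor
        · simp
        · linarith
    _ = _ := by
        rw [Finset.sum_const, nsmul_eq_mul, Nat.card_Icc, Nat.add_sub_cancel]; field_simp

lemma norm_expSum_mul_sub_le (k a q : ℕ) (hq : 0 < q) (β X : ℝ) (m : ℕ) (hm : ((m * q : ℕ) : ℝ) ≤ X) :
    ‖expSum k (m * q) ((a : ℝ) / q + β) - gaussSum k a q * contSum k ((m * q : ℕ) : ℝ) β‖ ≤
      m * (q * (2 * Real.pi * |β| * k * X ^ (k - 1) * q)) := by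
  induction m with
  | zero => simp [expSum, contSum]
  | succ m ih =>
    have h1 : (m + 1) * q = m * q + q := by ring
    rw [h1] at hm ⊢
    have hm' : ((m * q : ℕ) : ℝ) ≤ X := le_trans (by push_cast; simp) hm
    have h2 := norm_expSum_block_sub_le k a q m hq β X hm
    have h3 : contSum k ((m * q + q : ℕ) : ℝ) β = contSum k ((m * q : ℕ) : ℝ) β +
        ∫ t in ((m * q : ℕ) : ℝ)..((m * q : ℕ) : ℝ) + q, e (β * t ^ k) := by
      rw [contSum, contSum, intervalIntegral.integral_add_adjacent_intervals]
      · push_cast; rfl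
      · exact (continuous_e_mul_pow k β).intervalIntegrable _ _
      · exact (continuous_e_mul_pow k β).intervalIntegrable _ _
    rw [expSum_add, h3, mul_add, add_sub_add_comm]
    refine (norm_add_le _ _).trans ((add_le_add (ih hm') h2).trans (le_of_eq ?_))
    push_cast; ring

lemma norm_contSum_sub_le (k : ℕ) (X Y β : ℝ) : ‖contSum k Y β - contSum k X β‖ ≤ |Y - X| := by
  have h : contSum k Y β - contSum k X β = ∫ x in X..Y, e (β * x ^ k) := by
    rw [contSum, contSum, intervalIntegral.integral_interval_sub_left] <;>
    exact (continuous_e_mul_pow k β).intervalIntegrable _ _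
  rw [h]
  have := intervalIntegral.norm_integral_le_of_norm_le_const (a := X) (b := Y)
    (f := fun x => e (β * x ^ k)) (C := 1) (fun t _ => (norm_e _).le)
  linarith

/-- Full blocks of length `q` give the term in `β`; the incomplete last block, trivially bounded in
both the sum and the integral, gives the `2`. -/
theorem norm_expSum_sub_le (k a q : ℕ) (hk : 1 ≤ k) (hq : 0 < q) (β : ℝ) (X : ℕ) :
    ‖expSum k X ((a : ℝ) / q + β) - gaussSum k a q * contSum k X β‖ ≤
      q * (2 + 2 * Real.pi * k * (|β| * (X : ℝ) ^ k)) := by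
  set m := X / q with hm
  set r := X % q with hr
  have hX : X = m * q + r := by rw [hm, hr, mul_comm]; exact (Nat.div_add_mod X q).symm
  have hrq : (r : ℝ) ≤ q := by exact_mod_cast (Nat.mod_lt X hq).le
  have hmq : ((m * q : ℕ) : ℝ) ≤ (X : ℝ) := by exact_mod_cast (by omega)
  have h1 := norm_expSum_mul_sub_le k a q hq β X m hmq
  have h2 : ‖∑ j ∈ Finset.Icc 1 r, e (((a : ℝ) / q + β) * ((m * q + j : ℕ) : ℝ) ^ k)‖ ≤ r := by
    refine (norm_sum_le _ _).trans ?_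
    simp [norm_e]
  have h3 : ‖gaussSum k a q * (contSum k X β - contSum k ((m * q : ℕ) : ℝ) β)‖ ≤ r := by
    rw [norm_mul]
    calc _ ≤ 1 * |(X : ℝ) - ((m * q : ℕ) : ℝ)| := by
          gcongr
          · exact norm_gaussSum_le_one k a q
          · exact norm_contSum_sub_le _ _ _ _
      _ = r := by
          rw [one_mul]
          conv_lhs => rw [hX]
          push_cast; simp
  have h4 : expSum k X ((a : ℝ) / q + β) = expSum k (m * q) ((a : ℝ) / q + β) +
      ∑ j ∈ Finset.Icc 1 r, e (((a : ℝ) / q + β) * ((m * q + j : ℕ) : ℝ) ^ k) := by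
    rw [← expSum_add, ← hX]
  have h5 : expSum k X ((a : ℝ) / q + β) - gaussSum k a q * contSum k X β =
      (expSum k (m * q) ((a : ℝ) / q + β) - gaussSum k a q * contSum k ((m * q : ℕ) : ℝ) β) +
      ∑ j ∈ Finset.Icc 1 r, e (((a : ℝ) / q + β) * ((m * q + j : ℕ) : ℝ) ^ k) -
      gaussSum k a q * (contSum k X β - contSum k ((m * q : ℕ) : ℝ) β) := by
    rw [h4]; ring
  rw [h5]
  refine (norm_sub_le _ _).trans ?_
  have h6 : (m : ℝ) * (q * (2 * Real.pi * |β| * k * (X : ℝ) ^ (k - 1) * q)) ≤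
      q * (2 * Real.pi * k * (|β| * (X : ℝ) ^ k)) := by
    have h7 : (X : ℝ) ^ k = X ^ (k - 1) * X := by rw [← pow_succ]; congr 1; omega
    rw [h7]
    calc _ = q * (2 * Real.pi * k * (|β| * ((X : ℝ) ^ (k - 1) * ((m * q : ℕ) : ℝ)))) := by
          push_cast; ring
      _ ≤ _ := by gcongr
  have h8 := (norm_add_le (expSum k (m * q) ((a : ℝ) / q + β) - gaussSum k a q * contSum k ((m * q : ℕ) : ℝ) β)
    (∑ j ∈ Finset.Icc 1 r, e (((a : ℝ) / q + β) * ((m * q + j : ℕ) : ℝ) ^ k)))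
  nlinarith

lemma contSum_eq_scale (k : ℕ) (Y β : ℝ) : contSum k Y β = Y * contSum k 1 (β * Y ^ k) := by
  rw [contSum, contSum]
  have := intervalIntegral.smul_integral_comp_mul_left (a := 0) (b := 1)
    (fun x : ℝ => e (β * x ^ k)) Y
  simp only [mul_zero, mul_one] at this
  rw [← this, Complex.real_smul]
  congr 2
  ext x; congr 1; ring

lemma norm_contSum_one_le_one (k : ℕ) (b : ℝ) : ‖contSum k 1 b‖ ≤ 1 := by
  have := norm_contSum_sub_le k 0 1 b
  simpa [contSum] using this

/-- Split at `x₀ = |b|^{-1/k}`, where the phase `b x^k` has absolute value one. The initial piece is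
bounded trivially, the rest by integration by parts; each is at most `x₀`. -/
lemma norm_contSum_one_le (k : ℕ) (hk : 2 ≤ k) (b : ℝ) (hb : 1 ≤ |b|) :
    ‖contSum k 1 b‖ ≤ 2 * |b| ^ (-(1 / k : ℝ)) := by
  have hk0 : (0 : ℝ) < k := by exact_mod_cast (by omega : 0 < k)
  have hb0 : 0 < |b| := by linarith
  set x₀ : ℝ := |b| ^ (-(1 / k : ℝ)) with hx₀
  have hx0 : 0 < x₀ := Real.rpow_pos_of_pos hb0 _
  have hx1 : x₀ ≤ 1 := Real.rpow_le_one_of_one_le_of_nonpos hb (by simp)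
  have hxk : |b| * x₀ ^ k = 1 := by
    rw [hx₀, ← Real.rpow_natCast, ← Real.rpow_mul hb0.le]
    have : -(1 / (k : ℝ)) * k = -1 := by field_simp
    rw [this, Real.rpow_neg_one, mul_inv_cancel₀ hb0.ne']
  have hcont := continuous_e_mul_pow k b
  have hsplit : contSum k 1 b = (∫ x in (0 : ℝ)..x₀, e (b * x ^ k)) + ∫ x in x₀..1, e (b * x ^ k) := by
    rw [contSum, intervalIntegral.integral_add_adjacent_intervals] <;>
    exact hcont.intervalIntegrable _ _
  have h1 : ‖∫ x in (0 : ℝ)..x₀, e (b * x ^ k)‖ ≤ x₀ := by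
    have := intervalIntegral.norm_integral_le_of_norm_le_const (a := 0) (b := x₀)
      (f := fun x => e (b * x ^ k)) (C := 1) (fun t _ => (norm_e _).le)
    simpa [abs_of_pos hx0] using this
  have hne : ∀ x ∈ Set.uIcc x₀ 1, x ≠ 0 := by
    intro x hx; rw [Set.uIcc_of_le hx1] at hx; exact (hx0.trans_le hx.1).ne'
  -- the real function `x ^ (1 - k)` and its derivative
  have hderR : ∀ x : ℝ, x ≠ 0 → HasDerivAt (fun y : ℝ => (y ^ (k - 1))⁻¹)
      (-((k - 1 : ℕ) : ℝ) * (x ^ k)⁻¹) x := by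
    intro x hx
    have := (hasDerivAt_pow (k - 1) x).inv (pow_ne_zero _ hx)
    convert! this using 1
    obtain ⟨m, rfl⟩ : ∃ m, k = m + 2 := ⟨k - 2, by omega⟩
    simp only [show m + 2 - 1 = m + 1 by omega, Nat.add_sub_cancel]
    field_simp
    ring
  have hderE : ∀ x : ℝ, HasDerivAt (fun y : ℝ => e (b * y ^ k))
      (((b * (k * x ^ (k - 1)) : ℝ) : ℂ) * (2 * Real.pi * Complex.I * e (b * x ^ k))) x := by
    intro x
    have := HasDerivAt.scomp x (hasDerivAt_e (b * x ^ k)) ((hasDerivAt_pow k x).const_mul b)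
    simpa [Complex.real_smul, Function.comp_def] using this
  -- The weight `x^{1-k}` cancels the inner derivative, so the main term of the derivative is a
  -- constant multiple of the integrand `e(b x^k)`.
  have hderH : ∀ x ∈ Set.uIcc x₀ 1, HasDerivAt (fun y : ℝ => (((y ^ (k - 1))⁻¹ : ℝ) : ℂ) * e (b * y ^ k))
      (((-((k - 1 : ℕ) : ℝ) * (x ^ k)⁻¹ : ℝ) : ℂ) * e (b * x ^ k) +
        (2 * Real.pi * Complex.I * b * k) * e (b * x ^ k)) x := by
    intro x hx
    have hx' := hne x hx
    convert! ((hderR x hx').ofReal_comp).mul (hderE x) using 1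
    have : ((x : ℂ) ^ (k - 1)) ≠ 0 := pow_ne_zero _ (by exact_mod_cast hx')
    push_cast
    field_simp
  have hinvcont : ContinuousOn (fun x : ℝ => (x ^ k)⁻¹) (Set.uIcc x₀ 1) :=
    (continuous_pow k).continuousOn.inv₀ fun x hx => pow_ne_zero _ (hne x hx)
  have hci : IntervalIntegrable (fun x : ℝ => ((-((k - 1 : ℕ) : ℝ) * (x ^ k)⁻¹ : ℝ) : ℂ) * e (b * x ^ k))
      volume x₀ 1 := by
    refine ContinuousOn.intervalIntegrable (ContinuousOn.mul ?_ hcont.continuousOn)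
    exact Complex.continuous_ofReal.comp_continuousOn (continuousOn_const.mul hinvcont)
  have hFTC := intervalIntegral.integral_eq_sub_of_hasDerivAt hderH
    (hci.add ((hcont.intervalIntegrable _ _).const_mul _))
  rw [intervalIntegral.integral_add hci ((hcont.intervalIntegrable _ _).const_mul _),
    intervalIntegral.integral_const_mul] at hFTC
  have hR := intervalIntegral.integral_eq_sub_of_hasDerivAt (fun x hx => hderR x (hne x hx))
    ((continuousOn_const.mul hinvcont).intervalIntegrable)
  set Z : ℝ := (x₀ ^ (k - 1))⁻¹ with hZ
  have hZ0 : 0 < Z := by positivity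
  -- The weight is monotone, so its total variation is `Z - 1`; with the boundary terms `1 + Z` this
  -- sums to `2Z = 2|b|x₀`.
  have h2 : ‖∫ x in x₀..1, ((-((k - 1 : ℕ) : ℝ) * (x ^ k)⁻¹ : ℝ) : ℂ) * e (b * x ^ k)‖ ≤ Z - 1 := by
    calc _ ≤ ∫ x in x₀..1, -(-((k - 1 : ℕ) : ℝ) * (x ^ k)⁻¹) := by
          refine intervalIntegral.norm_integral_le_of_norm_le hx1 ?_ ?_
          · refine Filter.Eventually.of_forall fun x hx => ?_
            rw [norm_mul, norm_e, mul_one, Complex.norm_real, Real.norm_eq_abs, neg_mul, abs_neg, neg_neg]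
            have : 0 < x := hx0.trans hx.1
            rw [abs_of_nonneg (by positivity)]
          · exact (continuousOn_const.mul hinvcont).neg.intervalIntegrable
      _ = Z - 1 := by rw [intervalIntegral.integral_neg, hR]; simp [hZ]
  have h3 : ‖∫ x in x₀..1, e (b * x ^ k)‖ ≤ x₀ := by
    have h4 : (2 * Real.pi * Complex.I * b * k) * ∫ x in x₀..1, e (b * x ^ k) =
        (((((1 : ℝ) ^ (k - 1))⁻¹ : ℝ) : ℂ) * e (b * 1 ^ k) - (Z : ℂ) * e (b * x₀ ^ k)) -
        ∫ x in x₀..1, ((-((k - 1 : ℕ) : ℝ) * (x ^ k)⁻¹ : ℝ) : ℂ) * e (b * x ^ k) := by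
      rw [← hFTC]; ring
    have h5 := congrArg norm h4
    have h6 : ‖(2 * Real.pi * Complex.I * b * k : ℂ)‖ = 2 * Real.pi * k * |b| := by
      simp [abs_of_pos Real.pi_pos]; ring
    rw [norm_mul, h6] at h5
    have h7 : 2 * Real.pi * k * |b| * ‖∫ x in x₀..1, e (b * x ^ k)‖ ≤ 2 * Z := by
      rw [h5]
      refine (norm_sub_le _ _).trans ?_
      have h8 : ‖(((((1 : ℝ) ^ (k - 1))⁻¹ : ℝ) : ℂ) * e (b * 1 ^ k) - (Z : ℂ) * e (b * x₀ ^ k))‖ ≤ 1 + Z := by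
        refine (norm_sub_le _ _).trans ?_
        rw [norm_mul, norm_mul, norm_e, norm_e]
        simp [abs_of_pos hZ0]
      linarith
    have h9 : Z = |b| * x₀ := by
      rw [hZ]
      have : x₀ ^ k = x₀ ^ (k - 1) * x₀ := by rw [← pow_succ]; congr 1; omega
      rw [this] at hxk
      field_simp
      linarith
    rw [h9] at h7
    have h10 : 2 * |b| ≤ 2 * Real.pi * k * |b| := by
      have : 1 ≤ Real.pi * k := by
        have := Real.pi_gt_three
        have : (2 : ℝ) ≤ k := by exact_mod_cast hk
        nlinarith
      nlinarith
    have h11 := mul_le_mul_of_nonneg_right h10 (norm_nonneg (∫ x in x₀..1, e (b * x ^ k)))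
    have h12 : 2 * |b| * ‖∫ x in x₀..1, e (b * x ^ k)‖ ≤ 2 * |b| * x₀ := by linarith
    exact le_of_mul_le_mul_left h12 (by positivity)
  rw [hsplit]
  refine (norm_add_le _ _).trans ?_
  linarith

end WaringMajor

/-! ### The singular integral -/

namespace WaringMajor

open MeasureTheory intervalIntegral FourierTransform

lemma continuous_contSum (k : ℕ) (Y : ℝ) : Continuous (contSum k Y) := by
  unfold contSum
  refine intervalIntegral.continuous_parametric_intervalIntegral_of_continuous' ?_ 0 Y
  exact continuous_e.comp (by fun_prop)

/-- The decay `|b|^{-1/k}` becomes `b^{-2}` at the power `2k`, hence integrable against all larger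
powers with one bound. -/
lemma norm_contSum_one_pow_le (k : ℕ) (hk : 2 ≤ k) (b : ℝ) :
    ‖contSum k 1 b‖ ^ (2 * k) ≤ 2 * 4 ^ k * (1 + b ^ 2)⁻¹ := by
  have hk0 : (0 : ℝ) < k := by exact_mod_cast (by omega : 0 < k)
  rw [← div_eq_mul_inv, le_div_iff₀ (by positivity)]
  rcases lt_or_ge |b| 1 with hb | hb
  · have h1 : ‖contSum k 1 b‖ ^ (2 * k) ≤ 1 := pow_le_one₀ (norm_nonneg _) (norm_contSum_one_le_one k b)
    have h2 : b ^ 2 ≤ 1 := by rw [sq_le_one_iff_abs_le_one]; exact hb.le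
    have h3 : (1 : ℝ) ≤ 4 ^ k := one_le_pow₀ (by norm_num)
    calc _ ≤ 1 * (1 + b ^ 2) := by gcongr
      _ ≤ _ := by linarith
  · have hb0 : 0 < |b| := by linarith
    have h1 : ‖contSum k 1 b‖ ^ (2 * k) ≤ 4 ^ k * (b ^ 2)⁻¹ := by
      calc _ ≤ (2 * |b| ^ (-(1 / k : ℝ))) ^ (2 * k) := by
            gcongr; exact norm_contSum_one_le k hk b hb
        _ = 4 ^ k * (b ^ 2)⁻¹ := by
            rw [mul_pow, pow_mul, ← Real.rpow_natCast (|b| ^ _), ← Real.rpow_mul hb0.le, ← sq_abs b]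
            have : -(1 / (k : ℝ)) * (2 * k : ℕ) = -(2 : ℕ) := by push_cast; field_simp
            rw [this, Real.rpow_neg hb0.le, Real.rpow_natCast]
            norm_num
    have h2 : 1 ≤ b ^ 2 := by rwa [one_le_sq_iff_one_le_abs]
    have h3 : (0 : ℝ) < 4 ^ k := by positivity
    calc _ ≤ 4 ^ k * (b ^ 2)⁻¹ * (1 + b ^ 2) := by gcongr
      _ ≤ 4 ^ k * (b ^ 2)⁻¹ * (2 * b ^ 2) := by gcongr; linarith
      _ = _ := by
          have : b ≠ 0 := abs_pos.1 hb0
          field_simp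

lemma integrable_norm_contSum_one_pow (k : ℕ) (hk : 2 ≤ k) (d : ℕ) (hd : 2 * k ≤ d) :
    Integrable fun b => ‖contSum k 1 b‖ ^ d := by
  refine (integrable_inv_one_add_sq.const_mul (2 * 4 ^ k)).mono'
    ((continuous_contSum k 1).norm.pow d).aestronglyMeasurable ?_
  refine Filter.Eventually.of_forall fun b => ?_
  rw [Real.norm_of_nonneg (by positivity)]
  exact (pow_le_pow_of_le_one (norm_nonneg _) (norm_contSum_one_le_one k b) hd).trans
    (norm_contSum_one_pow_le k hk b)

/-- The moment `∫ |∫_0^1 e(b x^k) dx|^{2k} db`. -/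
noncomputable def contMoment (k : ℕ) : ℝ := ∫ b : ℝ, ‖contSum k 1 b‖ ^ (2 * k)

lemma contMoment_nonneg (k : ℕ) : 0 ≤ contMoment k := integral_nonneg fun _ => by positivity

lemma integral_contSum_comp {E : Type*} [NormedAddCommGroup E] [NormedSpace ℝ E] (k : ℕ) (Y : ℝ)
    (hY : 0 < Y) (F : ℂ → ℝ → E) :
    ∫ β : ℝ, F (contSum k Y β) (β * Y ^ k) = (Y ^ k)⁻¹ • ∫ b : ℝ, F (Y * contSum k 1 b) b := by
  have := Measure.integral_comp_mul_right (fun b : ℝ => F (Y * contSum k 1 b) b) (Y ^ k)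
  rw [abs_of_pos (by positivity)] at this
  rw [← this]
  congr 1; ext β; rw [contSum_eq_scale]

lemma integrable_norm_contSum_pow (k : ℕ) (hk : 2 ≤ k) (d : ℕ) (hd : 2 * k ≤ d) (Y : ℝ) (hY : 0 < Y) :
    Integrable fun β => ‖contSum k Y β‖ ^ d := by
  have h := ((integrable_norm_contSum_one_pow k hk d hd).comp_mul_right'
    (R := Y ^ k) (by positivity)).const_mul (Y ^ d)
  convert h using 2 with β
  rw [contSum_eq_scale, norm_mul, mul_pow, Complex.norm_real, Real.norm_of_nonneg hY.le]

lemma integral_norm_contSum_pow_le (k : ℕ) (hk : 2 ≤ k) (d : ℕ) (hd : 2 * k ≤ d) (Y : ℝ) (hY : 0 < Y) :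
    ∫ β, ‖contSum k Y β‖ ^ d ≤ contMoment k * (Y ^ d / Y ^ k) := by
  have h := integral_contSum_comp k Y hY (fun z _ => ‖z‖ ^ d)
  rw [h]
  have h2 : ∀ b, ‖(Y : ℂ) * contSum k 1 b‖ ^ d = Y ^ d * ‖contSum k 1 b‖ ^ d := by
    intro b
    rw [norm_mul, mul_pow, Complex.norm_real, Real.norm_of_nonneg hY.le]
  simp_rw [h2]
  rw [MeasureTheory.integral_const_mul, smul_eq_mul]
  have h3 : ∫ b, ‖contSum k 1 b‖ ^ d ≤ contMoment k := by
    refine integral_mono (integrable_norm_contSum_one_pow k hk d hd)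
      (integrable_norm_contSum_one_pow k hk _ le_rfl) fun b => ?_
    exact pow_le_pow_of_le_one (norm_nonneg _) (norm_contSum_one_le_one k b) hd
  calc _ ≤ (Y ^ k)⁻¹ * (Y ^ d * contMoment k) := by gcongr
    _ = _ := by ring

/-- Keep `2k` factors for integrability and bound the other `d - 2k` by the pointwise decay at `|β|
= η`. -/
lemma setIntegral_norm_contSum_pow_le (k : ℕ) (hk : 2 ≤ k) (d : ℕ) (hd : 2 * k ≤ d) (Y η : ℝ)
    (hY : 0 < Y) (hη : 1 ≤ η * Y ^ k) :
    ∫ β in {β : ℝ | η < |β|}, ‖contSum k Y β‖ ^ d ≤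
      contMoment k * (Y ^ d / Y ^ k) * (2 * (η * Y ^ k) ^ (-(1 / k : ℝ))) ^ (d - 2 * k) := by
  have hk0 : (0 : ℝ) < k := by exact_mod_cast (by omega : 0 < k)
  have hmeas : MeasurableSet {β : ℝ | η < |β|} :=
    measurableSet_lt measurable_const measurable_norm
  set c : ℝ := (Y * (2 * (η * Y ^ k) ^ (-(1 / k : ℝ)))) ^ (d - 2 * k) with hc
  have hc0 : 0 ≤ c := by positivity
  calc ∫ β in {β : ℝ | η < |β|}, ‖contSum k Y β‖ ^ d
      ≤ ∫ β in {β : ℝ | η < |β|}, ‖contSum k Y β‖ ^ (2 * k) * c := by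
        refine setIntegral_mono_on (integrable_norm_contSum_pow k hk d hd Y hY).integrableOn
          ((integrable_norm_contSum_pow k hk _ le_rfl Y hY).mul_const c).integrableOn hmeas
          fun β hβ => ?_
        have hβ' : η < |β| := hβ
        rw [show ‖contSum k Y β‖ ^ d = ‖contSum k Y β‖ ^ (2 * k) * ‖contSum k Y β‖ ^ (d - 2 * k) by
          rw [← pow_add]; congr 1; omega]
        refine mul_le_mul_of_nonneg_left (pow_le_pow_left₀ (norm_nonneg _) ?_ _) (by positivity)
        rw [contSum_eq_scale, norm_mul, Complex.norm_real, Real.norm_of_nonneg hY.le]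
        have h1 : η * Y ^ k ≤ |β * Y ^ k| := by
          rw [abs_mul, abs_of_pos (by positivity : 0 < Y ^ k)]; gcongr
        refine mul_le_mul_of_nonneg_left ?_ hY.le
        refine (norm_contSum_one_le k hk _ (hη.trans h1)).trans ?_
        refine mul_le_mul_of_nonneg_left ?_ (by norm_num)
        exact Real.rpow_le_rpow_of_nonpos (by linarith) h1 (by simp)
    _ ≤ ∫ β, ‖contSum k Y β‖ ^ (2 * k) * c :=
        setIntegral_le_integral ((integrable_norm_contSum_pow k hk _ le_rfl Y hY).mul_const c)
          (Filter.Eventually.of_forall fun β => by positivity)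
    _ = (∫ β, ‖contSum k Y β‖ ^ (2 * k)) * c := MeasureTheory.integral_mul_const _ _
    _ ≤ (contMoment k * (Y ^ (2 * k) / Y ^ k)) * c := by
        gcongr; exact integral_norm_contSum_pow_le k hk _ le_rfl Y hY
    _ = _ := by
        rw [hc, mul_pow]
        have : Y ^ d = Y ^ (2 * k) * Y ^ (d - 2 * k) := by rw [← pow_add]; congr 1; omega
        rw [this]; ring

/-- The density of `x ^ k` for `x` uniform in `(0, 1)`. -/
noncomputable def powDensity (k : ℕ) (t : ℝ) : ℂ :=
  if t ∈ Set.Ioo (0 : ℝ) 1 then ((1 / k * t ^ (1 / k - 1 : ℝ) : ℝ) : ℂ) else 0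

/-- Convolution powers of `powDensity`: the `(n + 1)`-fold convolution. -/
noncomputable def convPow (k : ℕ) : ℕ → ℝ → ℂ
  | 0 => powDensity k
  | n + 1 => convolution (powDensity k) (convPow k n) (ContinuousLinearMap.mul ℂ ℂ) volume

lemma integrable_powDensity (k : ℕ) (hk : 0 < k) : Integrable (powDensity k) := by
  have hk0 : (0 : ℝ) < k := by exact_mod_cast hk
  have h : IntegrableOn (fun t : ℝ => ((1 / k * t ^ (1 / k - 1 : ℝ) : ℝ) : ℂ)) (Set.Ioo 0 1) := by
    have h1 := (intervalIntegral.intervalIntegrable_rpow' (a := 0) (b := 1)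
      (r := (1 / k - 1 : ℝ)) (by have : 0 < 1 / (k : ℝ) := by positivity
                                 linarith))
    rw [intervalIntegrable_iff_integrableOn_Ioo_of_le zero_le_one] at h1
    exact (h1.const_mul (1 / k : ℝ)).ofReal
  have := h.integrable_indicator measurableSet_Ioo
  refine this.congr (Filter.Eventually.of_forall fun t => ?_)
  simp only [powDensity, Set.indicator]

lemma integrable_convPow (k : ℕ) (hk : 0 < k) (n : ℕ) : Integrable (convPow k n) := by
  induction n with
  | zero => exact integrable_powDensity k hk
  | succ n ih => exact (integrable_powDensity k hk).integrable_convolution _ ih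

/-- Substitute `t = y^k`. -/
lemma fourier_powDensity (k : ℕ) (hk : 0 < k) (b : ℝ) :
    𝓕 (powDensity k) b = contSum k 1 (-b) := by
  have hk0 : (0 : ℝ) < k := by exact_mod_cast hk
  have h1 := integral_comp_rpow_Ioi (fun y : ℝ => if y ∈ Set.Ioo (0 : ℝ) 1 then e (-b * y ^ k) else 0)
    (p := 1 / k) (by positivity)
  have h2 : contSum k 1 (-b) = ∫ y in Set.Ioi (0 : ℝ), if y ∈ Set.Ioo (0 : ℝ) 1 then e (-b * y ^ k) else 0 := by
    rw [contSum, intervalIntegral.integral_of_le zero_le_one, integral_Ioc_eq_integral_Ioo]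
    rw [setIntegral_eq_of_subset_of_forall_sdiff_eq_zero (s := Set.Ioo (0 : ℝ) 1) measurableSet_Ioi
      (fun x hx => hx.1) (fun x hx => by simp only [hx.2, if_false])]
    exact setIntegral_congr_fun measurableSet_Ioo fun x hx => by simp only [hx, if_true]
  rw [h2, ← h1, Real.fourier_real_eq_integral_exp_smul]
  rw [← setIntegral_eq_integral_of_forall_compl_eq_zero (s := Set.Ioi (0 : ℝ))]
  · refine setIntegral_congr_fun measurableSet_Ioi fun t ht => ?_
    have ht0 : (0 : ℝ) < t := ht
    have h3 : t ^ (1 / k : ℝ) ∈ Set.Ioo (0 : ℝ) 1 ↔ t ∈ Set.Ioo (0 : ℝ) 1 := by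
      simp only [Set.mem_Ioo, Real.rpow_pos_of_pos ht0, ht0, true_and]
      constructor
      · intro h
        by_contra hc
        exact absurd h (not_lt.2 (Real.one_le_rpow (not_lt.1 hc) (by positivity)))
      · exact fun h => Real.rpow_lt_one ht0.le h (by positivity)
    simp only [h3, powDensity]
    by_cases h4 : t ∈ Set.Ioo (0 : ℝ) 1
    · rw [if_pos h4, if_pos h4, ← Real.rpow_natCast, ← Real.rpow_mul ht0.le, one_div_mul_cancel hk0.ne',
        Real.rpow_one, abs_of_pos (by positivity), e, Complex.real_smul, smul_eq_mul, mul_comm]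
      congr 2
      push_cast; ring
    · simp [h4]
  · intro t ht
    have : t ∉ Set.Ioo (0 : ℝ) 1 := fun h => ht h.1
    simp [powDensity, this]

lemma fourier_convPow (k : ℕ) (hk : 0 < k) (n : ℕ) (b : ℝ) :
    𝓕 (convPow k n) b = contSum k 1 (-b) ^ (n + 1) := by
  induction n with
  | zero => simpa [convPow] using fourier_powDensity k hk b
  | succ n ih =>
    rw [convPow, Real.fourier_mul_convolution_eq (integrable_powDensity k hk) (integrable_convPow k hk n),
      ih, fourier_powDensity k hk, ← pow_succ']

lemma convPow_of_nonpos (k : ℕ) (n : ℕ) (t : ℝ) (ht : t ≤ 0) : convPow k n t = 0 := by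
  induction n generalizing t with
  | zero => rw [convPow, powDensity, if_neg]; intro h; exact absurd h.1 (not_lt.2 ht)
  | succ n ih =>
    rw [convPow, convolution]
    refine integral_eq_zero_of_ae (Filter.Eventually.of_forall fun s => ?_)
    by_cases hs : s ∈ Set.Ioo (0 : ℝ) 1
    · simp [ih (t - s) (by linarith [hs.1])]
    · simp [powDensity, hs]

/-- For `0 < t < 1` the truncation of the density at `1` is never felt: `s` and `t - s` both lie in
`(0, 1)`. Each convolution is then a Beta integral, and the Gamma factors telescope. -/
lemma convPow_of_mem (k : ℕ) (hk : 0 < k) (n : ℕ) (t : ℝ) (ht : t ∈ Set.Ioo (0 : ℝ) 1) :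
    convPow k n t = ((Real.Gamma (1 + 1 / k) ^ (n + 1) / Real.Gamma ((n + 1 : ℕ) / k) *
      t ^ (((n + 1 : ℕ) : ℝ) / k - 1) : ℝ) : ℂ) := by
  have hk0 : (0 : ℝ) < k := by exact_mod_cast hk
  have hGk : 0 < Real.Gamma (1 / k) := Real.Gamma_pos_of_pos (by positivity)
  have hG1 : Real.Gamma (1 + 1 / k) = 1 / k * Real.Gamma (1 / k) := by
    rw [add_comm, Real.Gamma_add_one (by positivity)]
  induction n generalizing t with
  | zero =>
    rw [convPow, powDensity, if_pos ht, hG1]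
    congr 1
    simp only [zero_add, Nat.cast_one, pow_one]
    field_simp
  | succ n ih =>
    set c : ℝ := Real.Gamma (1 + 1 / k) ^ (n + 1) / Real.Gamma ((n + 1 : ℕ) / k) with hc
    have hn0 : (0 : ℝ) < (n + 1 : ℕ) / k := by positivity
    have h1 : convPow k (n + 1) t = ∫ s in (0 : ℝ)..t, (1 / k * c : ℝ) *
        ((s : ℂ) ^ (((1 / k : ℝ) : ℂ) - 1) * ((t : ℂ) - s) ^ ((((n + 1 : ℕ) / k : ℝ) : ℂ) - 1)) := by
      rw [convPow, convolution, intervalIntegral.integral_of_le ht.1.le, integral_Ioc_eq_integral_Ioo,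
        ← setIntegral_eq_integral_of_forall_compl_eq_zero (s := Set.Ioo (0 : ℝ) t)]
      · refine setIntegral_congr_fun measurableSet_Ioo fun s hs => ?_
        have hs1 : s ∈ Set.Ioo (0 : ℝ) 1 := ⟨hs.1, hs.2.trans ht.2⟩
        have hs2 : t - s ∈ Set.Ioo (0 : ℝ) 1 := ⟨by linarith [hs.2], by linarith [hs.1, ht.2]⟩
        simp only [ContinuousLinearMap.mul_apply']
        rw [ih _ hs2, powDensity, if_pos hs1]
        have e1 : (s : ℂ) ^ (((1 / k : ℝ) : ℂ) - 1) = ((s ^ (1 / k - 1 : ℝ) : ℝ) : ℂ) := by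
          rw [Complex.ofReal_cpow hs.1.le]; push_cast; rfl
        have e2 : ((t : ℂ) - s) ^ ((((n + 1 : ℕ) / k : ℝ) : ℂ) - 1) =
            (((t - s) ^ (((n + 1 : ℕ) : ℝ) / k - 1) : ℝ) : ℂ) := by
          rw [Complex.ofReal_cpow hs2.1.le]; push_cast; rfl
        rw [e1, e2]
        push_cast; ring
      · intro s hs
        simp only [ContinuousLinearMap.mul_apply']
        by_cases hs1 : 0 < s
        · have : t ≤ s := by
            by_contra h; exact hs ⟨hs1, not_le.1 h⟩
          rw [convPow_of_nonpos k n (t - s) (by linarith), mul_zero]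
        · have : s ∉ Set.Ioo (0 : ℝ) 1 := fun h => hs1 h.1
          simp [powDensity, this]
    rw [h1, intervalIntegral.integral_const_mul, Complex.betaIntegral_scaled _ _ ht.1]
    have hB := Complex.Gamma_mul_Gamma_eq_betaIntegral (s := ((1 / k : ℝ) : ℂ))
      (t := (((n + 1 : ℕ) / k : ℝ) : ℂ)) (by rw [Complex.ofReal_re]; positivity)
      (by rw [Complex.ofReal_re]; exact hn0)
    have hsum : ((1 / k : ℝ) : ℂ) + (((n + 1 : ℕ) / k : ℝ) : ℂ) = ((((n + 1 + 1 : ℕ) : ℝ) / k : ℝ) : ℂ) := by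
      push_cast; ring
    rw [hsum, Complex.Gamma_ofReal, Complex.Gamma_ofReal, Complex.Gamma_ofReal] at hB
    rw [hsum]
    have hG2 : 0 < Real.Gamma (((n + 1 + 1 : ℕ) : ℝ) / k) := Real.Gamma_pos_of_pos (by positivity)
    have hG3 : 0 < Real.Gamma (((n + 1 : ℕ) : ℝ) / k) := Real.Gamma_pos_of_pos (by positivity)
    have hB' : Complex.betaIntegral ((1 / k : ℝ) : ℂ) (((n + 1 : ℕ) / k : ℝ) : ℂ) =
        ((Real.Gamma (1 / k) * Real.Gamma ((n + 1 : ℕ) / k) / Real.Gamma (((n + 1 + 1 : ℕ) : ℝ) / k) : ℝ) : ℂ) := by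
      have : (Real.Gamma (((n + 1 + 1 : ℕ) : ℝ) / k) : ℂ) ≠ 0 := by exact_mod_cast hG2.ne'
      rw [Complex.ofReal_div (_ * _), Complex.ofReal_mul (Real.Gamma _), hB, mul_div_cancel_left₀ _ this]
    rw [hB']
    have e3 : (t : ℂ) ^ ((((n + 1 + 1 : ℕ) : ℝ) / k : ℝ) - 1 : ℂ) =
        ((t ^ (((n + 1 + 1 : ℕ) : ℝ) / k - 1) : ℝ) : ℂ) := by
      rw [Complex.ofReal_cpow ht.1.le]; push_cast; rfl
    rw [e3, ← Complex.ofReal_mul, ← Complex.ofReal_mul]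
    congr 1
    rw [hc, pow_succ _ (n + 1)]
    rw [show Real.Gamma (1 + 1 / k) ^ (n + 1) * Real.Gamma (1 + 1 / k) =
      Real.Gamma (1 + 1 / k) ^ (n + 1) * (1 / k * Real.Gamma (1 / k)) by rw [hG1]]
    field_simp

lemma continuous_integral_contSum_pow (k : ℕ) (hk : 2 ≤ k) (d : ℕ) (hd : 2 * k ≤ d) :
    Continuous fun t : ℝ => ∫ b : ℝ, contSum k 1 b ^ d * e (-(b * t)) := by
  refine continuous_of_dominated (bound := fun b => ‖contSum k 1 b‖ ^ d) (fun t => ?_) (fun t => ?_)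
    (integrable_norm_contSum_one_pow k hk d hd) ?_
  · exact (((continuous_contSum k 1).pow d).mul (continuous_e.comp (by fun_prop))).aestronglyMeasurable
  · refine Filter.Eventually.of_forall fun b => ?_
    rw [norm_mul, norm_e, norm_pow, mul_one]
  · refine Filter.Eventually.of_forall fun b => ?_
    exact continuous_const.mul (continuous_e.comp (by fun_prop))

/-- Fourier inversion for the `d`-fold convolution at a point of continuity; its transform is
integrable because `d ≥ 2k`. -/
lemma integral_contSum_pow_of_mem (k : ℕ) (hk : 2 ≤ k) (d : ℕ) (hd : 2 * k ≤ d) (t : ℝ)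
    (ht : t ∈ Set.Ioo (0 : ℝ) 1) :
    ∫ b : ℝ, contSum k 1 b ^ d * e (-(b * t)) =
      ((Real.Gamma (1 + 1 / k) ^ d / Real.Gamma (d / k) * t ^ ((d : ℝ) / k - 1) : ℝ) : ℂ) := by
  obtain ⟨n, rfl⟩ : ∃ n, d = n + 1 := ⟨d - 1, by omega⟩
  have hk0 : 0 < k := by omega
  have hcont : ContinuousAt (convPow k n) t := by
    have h1 : ContinuousAt (fun t : ℝ => ((Real.Gamma (1 + 1 / k) ^ (n + 1) / Real.Gamma ((n + 1 : ℕ) / k) *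
        t ^ (((n + 1 : ℕ) : ℝ) / k - 1) : ℝ) : ℂ)) t :=
      Complex.continuous_ofReal.continuousAt.comp
        (continuousAt_const.mul (Real.continuousAt_rpow_const _ _ (Or.inl ht.1.ne')))
    refine h1.congr ?_
    filter_upwards [isOpen_Ioo.mem_nhds ht] with s hs
    exact (convPow_of_mem k hk0 n s hs).symm
  have hF : 𝓕 (convPow k n) = fun b => contSum k 1 (-b) ^ (n + 1) :=
    funext (fourier_convPow k hk0 n)
  have hint : Integrable (𝓕 (convPow k n)) := by
    rw [hF]
    refine Integrable.comp_neg (f := fun b => contSum k 1 b ^ (n + 1)) ?_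
    refine (integrable_norm_iff ((continuous_contSum k 1).pow _).aestronglyMeasurable).1 ?_
    simpa using integrable_norm_contSum_one_pow k hk (n + 1) hd
  have hinv := (integrable_convPow k hk0 n).fourierInv_fourier_eq hint hcont
  rw [convPow_of_mem k hk0 n t ht, Real.fourierInv_eq_fourier_neg, hF,
    Real.fourier_real_eq_integral_exp_smul] at hinv
  rw [← hinv, ← integral_neg_eq_self]
  congr 1
  ext b
  rw [smul_eq_mul, mul_comm, e]
  congr 2
  push_cast; ring

/-- The point `t = 1` is an endpoint of the interval where the convolution is known. Both sides are
continuous there, so the identity follows by letting `t` increase to `1`. -/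
theorem integral_contSum_one_pow (k : ℕ) (hk : 2 ≤ k) (d : ℕ) (hd : 2 * k ≤ d) :
    ∫ b : ℝ, contSum k 1 b ^ d * e (-b) =
      ((Real.Gamma (1 + 1 / k) ^ d / Real.Gamma (d / k) : ℝ) : ℂ) := by
  have h1 : Filter.Tendsto (fun t : ℝ => ∫ b : ℝ, contSum k 1 b ^ d * e (-(b * t)))
      (nhdsWithin 1 (Set.Iio 1)) (nhds (∫ b : ℝ, contSum k 1 b ^ d * e (-(b * 1)))) :=
    ((continuous_integral_contSum_pow k hk d hd).tendsto 1).mono_left nhdsWithin_le_nhds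
  have h2 : ContinuousAt (fun t : ℝ => ((Real.Gamma (1 + 1 / k) ^ d / Real.Gamma (d / k) *
      t ^ ((d : ℝ) / k - 1) : ℝ) : ℂ)) 1 :=
    Complex.continuous_ofReal.continuousAt.comp
      (continuousAt_const.mul (Real.continuousAt_rpow_const _ _ (Or.inl one_ne_zero)))
  have h3 := h2.tendsto.mono_left (nhdsWithin_le_nhds (s := Set.Iio 1))
  have h4 : (fun t : ℝ => ∫ b : ℝ, contSum k 1 b ^ d * e (-(b * t))) =ᶠ[nhdsWithin 1 (Set.Iio 1)]
      fun t : ℝ => ((Real.Gamma (1 + 1 / k) ^ d / Real.Gamma (d / k) * t ^ ((d : ℝ) / k - 1) : ℝ) : ℂ) := by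
    filter_upwards [Ioo_mem_nhdsLT (zero_lt_one (α := ℝ))] with t ht
    exact integral_contSum_pow_of_mem k hk d hd t ht
  have := tendsto_nhds_unique h1 (h3.congr' h4.symm)
  simpa using this

/-- The singular integral. -/
theorem integral_contSum_pow (k : ℕ) (hk : 2 ≤ k) (d : ℕ) (hd : 2 * k ≤ d) (N : ℕ) (hN : 0 < N) :
    ∫ β : ℝ, contSum k ((N : ℝ) ^ (1 / k : ℝ)) β ^ d * e (-(β * N)) = (archFactor k d N : ℂ) := by
  have hk0 : (0 : ℝ) < k := by exact_mod_cast (by omega : 0 < k)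
  have hN0 : (0 : ℝ) < N := by exact_mod_cast hN
  set Y : ℝ := (N : ℝ) ^ (1 / k : ℝ) with hY
  have hYk : Y ^ k = N := by
    rw [hY, ← Real.rpow_natCast, ← Real.rpow_mul hN0.le, one_div_mul_cancel hk0.ne', Real.rpow_one]
  have hYd : Y ^ d = (N : ℝ) ^ ((d : ℝ) / k) := by
    rw [hY, ← Real.rpow_natCast, ← Real.rpow_mul hN0.le]; congr 1; ring
  have h := integral_contSum_comp k Y (Real.rpow_pos_of_pos hN0 _) (fun z b => z ^ d * e (-b))
  rw [hYk] at h
  rw [h]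
  simp_rw [mul_pow, mul_assoc]
  rw [MeasureTheory.integral_const_mul, integral_contSum_one_pow k hk d hd, archFactor,
    Real.rpow_sub hN0, Real.rpow_one, ← hYd, Complex.real_smul]
  push_cast
  ring

end WaringMajor

/-! ### Decomposition of the major arcs -/

namespace WaringMajor

open MeasureTheory

/-- The reduced fractions `a / q ∈ (0, 1]` with `q ≤ n`. -/
def fareyIndex (n : ℕ) : Finset (Σ _ : ℕ, ℕ) :=
  (Finset.Icc 1 n).sigma fun q => (Finset.Icc 1 q).filter fun a => Nat.Coprime a q

lemma mem_fareyIndex {n : ℕ} {i : Σ _ : ℕ, ℕ} :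
    i ∈ fareyIndex n ↔ (1 ≤ i.1 ∧ i.1 ≤ n) ∧ (1 ≤ i.2 ∧ i.2 ≤ i.1) ∧ Nat.Coprime i.2 i.1 := by
  simp [fareyIndex]

lemma one_div_le_abs_sub {a q a' q' : ℕ} (hq : 1 ≤ q) (hq' : 1 ≤ q') (hco : Nat.Coprime a q)
    (hco' : Nat.Coprime a' q') (hne : ¬(q = q' ∧ a = a')) :
    1 / ((q : ℝ) * q') ≤ |(a : ℝ) / q - (a' : ℝ) / q'| := by
  have hq0 : (0 : ℝ) < q := by exact_mod_cast hq
  have hq0' : (0 : ℝ) < q' := by exact_mod_cast hq'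
  have h1 : (a : ℝ) / q - (a' : ℝ) / q' = ((a * q' - a' * q : ℤ) : ℝ) / (q * q') := by
    push_cast; field_simp
  have h2 : (a * q' - a' * q : ℤ) ≠ 0 := by
    intro h
    have h3 : a * q' = a' * q := by
      have : (a : ℤ) * q' = a' * q := by linarith
      exact_mod_cast this
    have h4 : q ∣ q' := hco.symm.dvd_of_dvd_mul_left (h3 ▸ Dvd.intro_left _ rfl)
    have h5 : q' ∣ q := hco'.symm.dvd_of_dvd_mul_left (h3 ▸ Dvd.intro_left _ rfl)
    have h6 := Nat.dvd_antisymm h4 h5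
    subst h6
    exact hne ⟨rfl, Nat.eq_of_mul_eq_mul_right (by omega) h3⟩
  rw [h1, abs_div, abs_of_pos (by positivity : (0 : ℝ) < q * q')]
  gcongr
  rw [← Int.cast_abs]
  exact_mod_cast Int.one_le_abs h2

/-- Distinct reduced fractions are at least `1/(q q')` apart, so the arcs are disjoint. Only the arc
at `1` sticks out of `[0, 1]`; periodicity identifies its overhang with the half arc at `0`. -/
theorem setIntegral_arcs_eq {F : ℝ → ℂ} (hF : Continuous F) (hper : ∀ x, F (x + 1) = F x)
    {η U : ℝ} (hη : 0 < η) (hU : 1 ≤ U)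
    (hsep : ∀ q q' : ℕ, 1 ≤ q → 1 ≤ q' → (q : ℝ) ≤ U → (q' : ℝ) ≤ U → 2 * η < 1 / ((q : ℝ) * q')) :
    ∫ ξ in {ξ : ℝ | ∃ q a : ℕ, 1 ≤ q ∧ (q : ℝ) ≤ U ∧ a ≤ q ∧ Nat.Coprime a q ∧
        ξ ∈ Set.Icc (0 : ℝ) 1 ∧ |ξ - (a : ℝ) / (q : ℝ)| ≤ η}, F ξ =
      ∑ i ∈ fareyIndex ⌊U⌋₊, ∫ β in Set.Icc (-η) η, F ((i.2 : ℝ) / i.1 + β) := by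
  set n := ⌊U⌋₊ with hn
  have hnU : ∀ q : ℕ, q ≤ n ↔ (q : ℝ) ≤ U := fun q => Nat.le_floor_iff (by linarith)
  have hsep1 : ∀ q : ℕ, 1 ≤ q → q ≤ n → 2 * η < 1 / (q : ℝ) := by
    intro q h1 h2
    have := hsep q 1 h1 le_rfl ((hnU q).1 h2) (by simpa using hU)
    simpa using this
  have h2η : 2 * η < 1 := by simpa using hsep1 1 le_rfl ((hnU 1).2 (by simpa using hU))
  set arc : (Σ _ : ℕ, ℕ) → Set ℝ := fun i => Set.Icc ((i.2 : ℝ) / i.1 - η) ((i.2 : ℝ) / i.1 + η) with harc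
  set A : Set ℝ := ⋃ i ∈ fareyIndex n, arc i with hA
  have hmem : ∀ i x, x ∈ arc i ↔ |x - (i.2 : ℝ) / i.1| ≤ η := by
    intro i x
    rw [harc, abs_le]; simp only [Set.mem_Icc]
    constructor <;> intro h <;> constructor <;> linarith [h.1, h.2]
  have hlow : ∀ i ∈ fareyIndex n, ∀ x ∈ arc i, η < x := by
    intro i hi x hx
    obtain ⟨⟨h1, h2⟩, ⟨h3, _⟩, _⟩ := mem_fareyIndex.1 hi
    have hq0 : (0 : ℝ) < i.1 := by exact_mod_cast h1
    have h4 := hsep1 i.1 h1 h2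
    have h5 : 1 / (i.1 : ℝ) ≤ (i.2 : ℝ) / i.1 := by gcongr; exact_mod_cast h3
    have := hx.1
    linarith
  have hcompact : IsCompact A := (fareyIndex n).finite_toSet.isCompact_biUnion fun i _ => isCompact_Icc
  have hAint : IntegrableOn F A := hF.continuousOn.integrableOn_compact hcompact
  have hset : {ξ : ℝ | ∃ q a : ℕ, 1 ≤ q ∧ (q : ℝ) ≤ U ∧ a ≤ q ∧ Nat.Coprime a q ∧
      ξ ∈ Set.Icc (0 : ℝ) 1 ∧ |ξ - (a : ℝ) / (q : ℝ)| ≤ η} = (A ∩ Set.Iic 1) ∪ Set.Icc 0 η := by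
    ext x
    simp only [Set.mem_ofPred_eq, Set.mem_union, Set.mem_inter_iff, hA, Set.mem_iUnion, Set.mem_Iic]
    constructor
    · rintro ⟨q, a, hq, hqU, haq, hco, hx, hxa⟩
      rcases Nat.eq_zero_or_pos a with rfl | ha
      · right
        simp only [CharP.cast_eq_zero, zero_div, sub_zero] at hxa
        exact ⟨hx.1, (le_abs_self x).trans hxa⟩
      · left
        exact ⟨⟨⟨q, a⟩, mem_fareyIndex.2 ⟨⟨hq, (hnU q).2 hqU⟩, ⟨ha, haq⟩, hco⟩, (hmem _ _).2 hxa⟩, hx.2⟩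
    · rintro (⟨⟨i, hi, hxi⟩, hx1⟩ | hx)
      · obtain ⟨⟨h1, h2⟩, ⟨h3, h4⟩, h5⟩ := mem_fareyIndex.1 hi
        exact ⟨i.1, i.2, h1, (hnU _).1 h2, h4, h5, ⟨(hη.trans (hlow i hi x hxi)).le, hx1⟩, (hmem _ _).1 hxi⟩
      · refine ⟨1, 0, le_rfl, by simpa using hU, by simp, by simp, ⟨hx.1, by linarith [hx.2]⟩, ?_⟩
        simpa [abs_of_nonneg hx.1] using hx.2
  have hdiff : A \ Set.Iic 1 = Set.Ioc 1 (1 + η) := by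
    ext x
    simp only [Set.mem_sdiff, hA, Set.mem_iUnion, Set.mem_Iic, not_le, Set.mem_Ioc]
    constructor
    · rintro ⟨⟨i, hi, hxi⟩, hx1⟩
      obtain ⟨⟨h1, h2⟩, ⟨h3, h4⟩, h5⟩ := mem_fareyIndex.1 hi
      have hq0 : (0 : ℝ) < i.1 := by exact_mod_cast h1
      refine ⟨hx1, ?_⟩
      have h6 := hxi.2
      have h7 : (i.2 : ℝ) / i.1 ≤ 1 := by rw [div_le_one hq0]; exact_mod_cast h4
      linarith
    · rintro ⟨hx1, hx2⟩
      refine ⟨⟨⟨1, 1⟩, mem_fareyIndex.2 ⟨⟨le_rfl, (hnU 1).2 (by simpa using hU)⟩, ⟨le_rfl, le_rfl⟩, by simp⟩, ?_⟩, hx1⟩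
      simp only [harc, Nat.cast_one, div_one]
      constructor <;> linarith
  have hdisj : Disjoint (A ∩ Set.Iic 1) (Set.Icc 0 η) := by
    rw [Set.disjoint_left]
    rintro x ⟨hx, _⟩ hx2
    simp only [hA, Set.mem_iUnion] at hx
    obtain ⟨i, hi, hxi⟩ := hx
    exact absurd hx2.2 (not_le.2 (hlow i hi x hxi))
  rw [hset, setIntegral_union hdisj measurableSet_Icc (hAint.mono_set Set.inter_subset_left)
    (hF.continuousOn.integrableOn_compact isCompact_Icc)]
  have hshift : ∫ x in Set.Icc 0 η, F x = ∫ x in A \ Set.Iic 1, F x := by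
    rw [hdiff, integral_Icc_eq_integral_Ioc, ← intervalIntegral.integral_of_le hη.le,
      ← intervalIntegral.integral_of_le (by linarith)]
    have := intervalIntegral.integral_comp_add_right (a := 0) (b := η) F 1
    simp only [hper, zero_add] at this
    rw [this, add_comm η 1]
  rw [hshift, integral_inter_add_sdiff measurableSet_Iic hAint, hA,
    integral_biUnion_finset _ (fun i _ => measurableSet_Icc) _
      (fun i _ => hF.continuousOn.integrableOn_compact isCompact_Icc)]
  · refine Finset.sum_congr rfl fun i _ => ?_
    rw [integral_Icc_eq_integral_Ioc, integral_Icc_eq_integral_Ioc,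
      ← intervalIntegral.integral_of_le (by linarith), ← intervalIntegral.integral_of_le (by linarith),
      intervalIntegral.integral_comp_add_left]
    rfl
  · intro i hi j hj hij
    rw [Function.onFun, Set.disjoint_left]
    intro x hxi hxj
    obtain ⟨⟨h1, h2⟩, _, h5⟩ := mem_fareyIndex.1 hi
    obtain ⟨⟨h1', h2'⟩, _, h5'⟩ := mem_fareyIndex.1 hj
    have h6 := one_div_le_abs_sub h1 h1' h5 h5' (by
      rintro ⟨e1, e2⟩
      exact hij (Sigma.ext e1 (heq_of_eq e2)))
    have h7 := hsep i.1 j.1 h1 h1' ((hnU _).1 h2) ((hnU _).1 h2')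
    have h8 := (hmem _ _).1 hxi
    have h9 := (hmem _ _).1 hxj
    have h10 : |(i.2 : ℝ) / i.1 - (j.2 : ℝ) / j.1| ≤ 2 * η := by
      rw [abs_le] at *
      constructor <;> linarith [h8.1, h8.2, h9.1, h9.2]
    linarith

lemma e_mul_pow_add_one (k n : ℕ) (x : ℝ) : e ((x + 1) * (n : ℝ) ^ k) = e (x * (n : ℝ) ^ k) := by
  rw [add_mul, one_mul, e_add]
  have := e_natCast (n ^ k)
  push_cast at this
  rw [this, mul_one]

lemma continuous_expSum (k X : ℕ) : Continuous (expSum k X) := by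
  unfold expSum
  exact continuous_finsetSum _ fun n _ => continuous_e.comp (by fun_prop)

theorem majorIntegral_eq_sum (k d N : ℕ) (hk : 2 ≤ k) (α : ℝ) (hα : 0 < α) (hα3 : α < 1 / 3)
    (hX : 3 ≤ cutoff k N) :
    majorIntegral k d α N = ∑ i ∈ fareyIndex ⌊(cutoff k N : ℝ) ^ α⌋₊,
      ∫ β in Set.Icc (-((cutoff k N : ℝ) ^ (-(k : ℝ) + α))) ((cutoff k N : ℝ) ^ (-(k : ℝ) + α)),
        expSum k (cutoff k N) ((i.2 : ℝ) / i.1 + β) ^ d * e (-(((i.2 : ℝ) / i.1 + β) * N)) := by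
  set X := cutoff k N with hXdef
  have hX3 : (3 : ℝ) ≤ X := by exact_mod_cast hX
  have hX0 : (0 : ℝ) < X := by linarith
  have h := setIntegral_arcs_eq (F := fun ξ => expSum k X ξ ^ d * e (-(ξ * (N : ℝ))))
    (η := (X : ℝ) ^ (-(k : ℝ) + α)) (U := (X : ℝ) ^ α)
    (((continuous_expSum k X).pow d).mul (continuous_e.comp (by fun_prop))) (fun x => ?_)
    (Real.rpow_pos_of_pos hX0 _) (Real.one_le_rpow (by linarith) hα.le) (fun q q' hq hq' hqU hqU' => ?_)
  · exact h
  · have h1 : expSum k X (x + 1) = expSum k X x := by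
      simp only [expSum, e_mul_pow_add_one]
    have h2 : e (-((x + 1) * N)) = e (-(x * N)) := by
      rw [add_mul, one_mul, neg_add, e_add]
      have := e_intCast (-(N : ℤ))
      push_cast at this
      rw [this, mul_one]
    simp only [h1, h2]
  · have hq0 : (0 : ℝ) < q := by exact_mod_cast hq
    have hq0' : (0 : ℝ) < q' := by exact_mod_cast hq'
    rw [lt_div_iff₀ (by positivity)]
    have hk2 : (2 : ℝ) ≤ k := by exact_mod_cast hk
    -- Disjointness uses `3α < 1` and `k ≥ 2`: the exponent `3α - k` is below `-1`, and `2/X < 1`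
    -- once `X ≥ 3`.
    calc 2 * (X : ℝ) ^ (-(k : ℝ) + α) * (q * q')
        ≤ 2 * (X : ℝ) ^ (-(k : ℝ) + α) * ((X : ℝ) ^ α * (X : ℝ) ^ α) := by gcongr
      _ = 2 * (X : ℝ) ^ (-(k : ℝ) + 3 * α) := by
          rw [← Real.rpow_add hX0, mul_assoc, ← Real.rpow_add hX0]; congr 2; ring
      _ ≤ 2 * (X : ℝ) ^ (-1 : ℝ) := by
          gcongr
          · linarith
          · linarith
      _ < 1 := by
          rw [Real.rpow_neg_one, ← div_eq_mul_inv, div_lt_one hX0]; linarith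

end WaringMajor

/-! ### Replacing the exponential sum by its model, and completion -/

namespace WaringMajor

open MeasureTheory

lemma norm_pow_sub_pow_le_mul {z w : ℂ} {M : ℝ} (hz : ‖z‖ ≤ M) (hw : ‖w‖ ≤ M) (n : ℕ) :
    ‖z ^ (n + 1) - w ^ (n + 1)‖ ≤ (n + 1) * ‖z - w‖ * M ^ n := by
  have hM : 0 ≤ M := (norm_nonneg z).trans hz
  induction n with
  | zero => simp
  | succ n ih =>
    have h : z ^ (n + 2) - w ^ (n + 2) = z * (z ^ (n + 1) - w ^ (n + 1)) + (z - w) * w ^ (n + 1) := by ring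
    rw [h]
    refine (norm_add_le _ _).trans ?_
    rw [norm_mul, norm_mul, norm_pow]
    calc ‖z‖ * ‖z ^ (n + 1) - w ^ (n + 1)‖ + ‖z - w‖ * ‖w‖ ^ (n + 1)
        ≤ M * ((n + 1) * ‖z - w‖ * M ^ n) + ‖z - w‖ * M ^ (n + 1) := by gcongr
      _ = _ := by push_cast; ring

/-- Separating `‖w‖^n` from `Δ^n`, at the price of `2^n`, lets the first be summed by moment bounds
and the second by the measure of the arcs. -/
lemma norm_pow_sub_pow_le_of_close {z w : ℂ} {Δ : ℝ} (h : ‖z - w‖ ≤ Δ) (n : ℕ) :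
    ‖z ^ (n + 1) - w ^ (n + 1)‖ ≤ (n + 1) * Δ * 2 ^ n * (‖w‖ ^ n + Δ ^ n) := by
  have hΔ : 0 ≤ Δ := (norm_nonneg _).trans h
  have hz : ‖z‖ ≤ ‖w‖ + Δ := by
    have := norm_add_le w (z - w)
    rw [add_sub_cancel] at this
    linarith
  have h1 : (‖w‖ + Δ) ^ n ≤ 2 ^ n * (‖w‖ ^ n + Δ ^ n) := by
    refine (add_pow_le (norm_nonneg w) hΔ n).trans ?_
    gcongr
    · norm_num
    · omega
  calc _ ≤ (n + 1) * ‖z - w‖ * (‖w‖ + Δ) ^ n :=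
        norm_pow_sub_pow_le_mul hz (by linarith) n
    _ ≤ (n + 1) * Δ * (2 ^ n * (‖w‖ ^ n + Δ ^ n)) := by gcongr
    _ = _ := by ring

lemma sum_fareyIndex {E : Type*} [AddCommMonoid E] (n : ℕ) (F : ℕ → ℕ → E) :
    ∑ i ∈ fareyIndex n, F i.1 i.2 = ∑ q ∈ Finset.Icc 1 n,
      ∑ a ∈ (Finset.Icc 1 q).filter (fun a => Nat.Coprime a q), F q a := by
  rw [fareyIndex, Finset.sum_sigma]

lemma card_fareyIndex_le (n : ℕ) : (fareyIndex n).card ≤ n * n := by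
  rw [fareyIndex, Finset.card_sigma]
  calc _ ≤ ∑ q ∈ Finset.Icc 1 n, n := Finset.sum_le_sum fun q hq => by
        refine (Finset.card_filter_le _ _).trans ?_
        simpa using (Finset.mem_Icc.1 hq).2
    _ = n * n := by simp

/-- Approximation of the exponential sum on a major arc. -/
lemma norm_expSum_sub_le_of_major (k a q : ℕ) (hk : 1 ≤ k) (hq : 0 < q) (X : ℕ) (hX : 1 ≤ X) (Y α β : ℝ)
    (hα : 0 < α) (hqX : (q : ℝ) ≤ (X : ℝ) ^ α) (hβ : |β| ≤ (X : ℝ) ^ (-(k : ℝ) + α))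
    (hY : |Y - X| ≤ 1) :
    ‖expSum k X ((a : ℝ) / q + β) - gaussSum k a q * contSum k Y β‖ ≤
      (3 + 2 * Real.pi * k) * (X : ℝ) ^ (2 * α) := by
  have hX1 : (1 : ℝ) ≤ X := by exact_mod_cast hX
  have hX0 : (0 : ℝ) < X := by linarith
  set U : ℝ := (X : ℝ) ^ α with hU
  have hU1 : 1 ≤ U := Real.one_le_rpow hX1 hα.le
  have hU2 : (X : ℝ) ^ (2 * α) = U * U := by rw [hU, ← Real.rpow_add hX0]; congr 1; ring
  have hβ' : |β| * (X : ℝ) ^ k ≤ U := by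
    calc |β| * (X : ℝ) ^ k ≤ (X : ℝ) ^ (-(k : ℝ) + α) * (X : ℝ) ^ k := by gcongr
      _ = U := by rw [← Real.rpow_natCast, ← Real.rpow_add hX0]; congr 1; ring
  have h1 := norm_expSum_sub_le k a q hk hq β X
  have h2 : ‖gaussSum k a q * (contSum k Y β - contSum k X β)‖ ≤ 1 := by
    rw [norm_mul]
    calc _ ≤ 1 * |Y - X| := by
          gcongr
          · exact norm_gaussSum_le_one k a q
          · exact norm_contSum_sub_le _ _ _ _
      _ ≤ 1 := by linarith
  have h3 : expSum k X ((a : ℝ) / q + β) - gaussSum k a q * contSum k Y β =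
      (expSum k X ((a : ℝ) / q + β) - gaussSum k a q * contSum k X β) -
      gaussSum k a q * (contSum k Y β - contSum k X β) := by ring
  rw [h3, hU2]
  have hpi := Real.pi_pos
  calc _ ≤ q * (2 + 2 * Real.pi * k * (|β| * (X : ℝ) ^ k)) + 1 := (norm_sub_le _ _).trans (add_le_add h1 h2)
    _ ≤ U * (2 * U + 2 * Real.pi * k * U) + U * U := by
        gcongr
        · linarith
        · nlinarith
    _ = _ := by ring

lemma cutoff_bounds (k N : ℕ) : (cutoff k N : ℝ) ≤ (N : ℝ) ^ (1 / k : ℝ) ∧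
    (N : ℝ) ^ (1 / k : ℝ) < cutoff k N + 1 :=
  ⟨Nat.floor_le (by positivity), Nat.lt_floor_add_one _⟩

lemma four_mul_le_two_pow (k : ℕ) (hk : 2 ≤ k) : 4 * k ≤ 2 ^ (k + 1) := by
  induction k, hk using Nat.le_induction with
  | base => norm_num
  | succ n hn ih =>
    have h1 : 2 ^ (n + 1 + 1) = 2 * 2 ^ (n + 1) := by ring
    omega

/-- One of the `d + 1` factors is spent on the approximation error `Δ`. The remaining `d` still
exceed the thresholds for the Gauss-sum moments and for the integral moment, so the model part is
bounded uniformly in the number of arcs. -/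
theorem norm_majorIntegral_sub_main_le (k : ℕ) (hk : 2 ≤ k) :
    ∃ K : ℝ, 1 ≤ K ∧ ∀ d : ℕ, 2 ^ (k + 1) ≤ d + 1 → ∀ N : ℕ, 3 ≤ cutoff k N → ∀ α : ℝ, 0 < α →
      α < 1 / 3 → ∀ X Y η Δ : ℝ, X = cutoff k N → Y = (N : ℝ) ^ (1 / k : ℝ) →
      η = X ^ (-(k : ℝ) + α) → Δ = (3 + 2 * Real.pi * k) * X ^ (2 * α) →
      ‖majorIntegral k (d + 1) α N -
        (∑ q ∈ Finset.Icc 1 ⌊X ^ α⌋₊, singularTerm k (d + 1) N q) *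
          ∫ β in Set.Icc (-η) η, contSum k Y β ^ (d + 1) * e (-(β * N))‖ ≤
      (d + 1) * Δ * 2 ^ d * (K * (Y ^ d / Y ^ k) + X ^ (2 * α) * (2 * η * Δ ^ d)) := by
  obtain ⟨K, hK1, hK⟩ := sum_gaussMoment_le k hk
  refine ⟨K * (1 + contMoment k), one_le_mul_of_one_le_of_one_le hK1
    (by linarith [contMoment_nonneg k]), ?_⟩
  intro d hd N hN α hα hα3 X Y η Δ hX hY hη hΔ
  have hX3 : (3 : ℝ) ≤ X := by rw [hX]; exact_mod_cast hN
  have hX0 : 0 < X := by linarith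
  have hη0 : 0 < η := hη ▸ Real.rpow_pos_of_pos hX0 _
  have hpi := Real.pi_pos
  have hΔ0 : 0 < Δ := by rw [hΔ]; positivity
  obtain ⟨hXY, hYX⟩ := cutoff_bounds k N
  rw [← hX, ← hY] at hXY hYX
  have hY0 : 0 < Y := by linarith
  have hk4 := four_mul_le_two_pow k hk
  have hd3 : 3 * 2 ^ (k - 1) ≤ d := by
    obtain ⟨m, rfl⟩ : ∃ m, k = m + 1 := ⟨k - 1, by omega⟩
    have : 2 ^ (m + 1 + 1) = 4 * 2 ^ m := by ring
    have := Nat.one_le_two_pow (n := m)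
    simp only [Nat.add_sub_cancel]; omega
  set n := ⌊X ^ α⌋₊ with hn
  have hM := majorIntegral_eq_sum k (d + 1) N hk α hα hα3 hN
  rw [← hX, ← hη, ← hn] at hM
  have hmain : (∑ q ∈ Finset.Icc 1 n, singularTerm k (d + 1) N q) *
      (∫ β in Set.Icc (-η) η, contSum k Y β ^ (d + 1) * e (-(β * N))) =
      ∑ i ∈ fareyIndex n, ∫ β in Set.Icc (-η) η,
        (gaussSum k i.2 i.1 * contSum k Y β) ^ (d + 1) * e (-(((i.2 : ℝ) / i.1 + β) * N)) := by
    simp only [singularTerm]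
    rw [← sum_fareyIndex n (fun q a => gaussSum k a q ^ (d + 1) * e (-((N : ℝ) * (a : ℝ) / (q : ℝ)))),
      Finset.sum_mul]
    refine Finset.sum_congr rfl fun i _ => ?_
    rw [← integral_const_mul]
    congr 1; ext β
    have : -(((i.2 : ℝ) / i.1 + β) * N) = -((N : ℝ) * (i.2 : ℝ) / (i.1 : ℝ)) + -(β * N) := by ring
    rw [this, e_add]; ring
  have hcE := continuous_expSum k (cutoff k N)
  have hcV := continuous_contSum k Y
  have hcI : ∀ {F : ℝ → ℂ}, Continuous F → IntegrableOn F (Set.Icc (-η) η) := fun hF =>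
    hF.continuousOn.integrableOn_compact isCompact_Icc
  rw [hM, hmain, ← Finset.sum_sub_distrib]
  have hterm : ∀ i ∈ fareyIndex n,
      ‖(∫ β in Set.Icc (-η) η, expSum k (cutoff k N) ((i.2 : ℝ) / i.1 + β) ^ (d + 1) *
          e (-(((i.2 : ℝ) / i.1 + β) * N))) -
        ∫ β in Set.Icc (-η) η, (gaussSum k i.2 i.1 * contSum k Y β) ^ (d + 1) *
          e (-(((i.2 : ℝ) / i.1 + β) * N))‖ ≤
      (d + 1) * Δ * 2 ^ d * (‖gaussSum k i.2 i.1‖ ^ d * (contMoment k * (Y ^ d / Y ^ k)) + 2 * η * Δ ^ d) := by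
    intro i hi
    obtain ⟨⟨h1, h2⟩, ⟨h3, h4⟩, h5⟩ := mem_fareyIndex.1 hi
    have hce : Continuous fun β : ℝ => e (-(((i.2 : ℝ) / i.1 + β) * N)) := continuous_e.comp (by fun_prop)
    have hcE' : Continuous fun β : ℝ => expSum k (cutoff k N) ((i.2 : ℝ) / i.1 + β) :=
      hcE.comp (by fun_prop)
    have hia : IntegrableOn (fun β : ℝ => expSum k (cutoff k N) ((i.2 : ℝ) / i.1 + β) ^ (d + 1) *
        e (-(((i.2 : ℝ) / i.1 + β) * N))) (Set.Icc (-η) η) := hcI ((hcE'.pow _).mul hce)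
    have hib' : IntegrableOn (fun β : ℝ => (gaussSum k i.2 i.1 * contSum k Y β) ^ (d + 1) *
        e (-(((i.2 : ℝ) / i.1 + β) * N))) (Set.Icc (-η) η) :=
      hcI (((continuous_const.mul hcV).pow _).mul hce)
    rw [← integral_sub hia hib']
    have hiq : (i.1 : ℝ) ≤ X ^ α := (Nat.le_floor_iff (by positivity)).1 h2
    have hpt : ∀ β ∈ Set.Icc (-η) η,
        ‖expSum k (cutoff k N) ((i.2 : ℝ) / i.1 + β) ^ (d + 1) * e (-(((i.2 : ℝ) / i.1 + β) * N)) -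
          (gaussSum k i.2 i.1 * contSum k Y β) ^ (d + 1) * e (-(((i.2 : ℝ) / i.1 + β) * N))‖ ≤
        (d + 1) * Δ * 2 ^ d * (‖gaussSum k i.2 i.1‖ ^ d * ‖contSum k Y β‖ ^ d + Δ ^ d) := by
      intro β hβ
      rw [← sub_mul, norm_mul, norm_e, mul_one, ← mul_pow, ← norm_mul]
      refine norm_pow_sub_pow_le_of_close ?_ d
      rw [hΔ, hX]
      rw [hX] at hiq hη
      refine norm_expSum_sub_le_of_major k i.2 i.1 (by omega) h1 (cutoff k N) (by omega) Y α β hα hiq ?_ ?_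
      · rw [← hη]; exact abs_le.2 hβ
      · rw [← hX, abs_le]; constructor <;> linarith
    have hcb : Continuous fun β : ℝ => ‖contSum k Y β‖ ^ d := hcV.norm.pow d
    have hib : IntegrableOn (fun β : ℝ => ‖contSum k Y β‖ ^ d) (Set.Icc (-η) η) :=
      hcb.continuousOn.integrableOn_compact isCompact_Icc
    have hic : IntegrableOn (fun _ : ℝ => Δ ^ d) (Set.Icc (-η) η) :=
      continuousOn_const.integrableOn_compact isCompact_Icc
    calc _ ≤ ∫ β in Set.Icc (-η) η,
          (d + 1) * Δ * 2 ^ d * (‖gaussSum k i.2 i.1‖ ^ d * ‖contSum k Y β‖ ^ d + Δ ^ d) := by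
          refine norm_integral_le_of_norm_le (((hib.const_mul _).add hic).const_mul _) ?_
          exact (ae_restrict_iff' measurableSet_Icc).2 (Filter.Eventually.of_forall hpt)
      _ = (d + 1) * Δ * 2 ^ d * (‖gaussSum k i.2 i.1‖ ^ d * (∫ β in Set.Icc (-η) η, ‖contSum k Y β‖ ^ d) +
            2 * η * Δ ^ d) := by
          rw [integral_const_mul, integral_add (hib.const_mul _) hic, integral_const_mul,
            setIntegral_const, Real.volume_real_Icc_of_le (by linarith), smul_eq_mul]
          ring
      _ ≤ _ := by
          gcongr
          refine le_trans (setIntegral_le_integral (integrable_norm_contSum_pow k hk d (by omega) Y hY0)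
            (Filter.Eventually.of_forall fun β => by positivity)) ?_
          exact integral_norm_contSum_pow_le k hk d (by omega) Y hY0
  refine (norm_sum_le _ _).trans ((Finset.sum_le_sum hterm).trans ?_)
  rw [← Finset.mul_sum, Finset.sum_add_distrib, ← Finset.sum_mul, Finset.sum_const, nsmul_eq_mul]
  have hG : ∑ i ∈ fareyIndex n, ‖gaussSum k i.2 i.1‖ ^ d ≤ K := by
    rw [sum_fareyIndex n (fun q a => ‖gaussSum k a q‖ ^ d)]
    exact (hK d hd3).1 _
  have hcard : ((fareyIndex n).card : ℝ) ≤ X ^ (2 * α) := by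
    have h1 : (n : ℝ) ≤ X ^ α := Nat.floor_le (by positivity)
    calc ((fareyIndex n).card : ℝ) ≤ (n : ℝ) * n := by exact_mod_cast card_fareyIndex_le n
      _ ≤ X ^ α * X ^ α := by gcongr
      _ = _ := by rw [← Real.rpow_add hX0]; congr 1; ring
  have hW := contMoment_nonneg k
  have hA : (∑ i ∈ fareyIndex n, ‖gaussSum k i.2 i.1‖ ^ d) * (contMoment k * (Y ^ d / Y ^ k)) ≤
      K * (1 + contMoment k) * (Y ^ d / Y ^ k) := by
    calc _ ≤ K * ((1 + contMoment k) * (Y ^ d / Y ^ k)) := by gcongr; linarith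
      _ = _ := by ring
  refine mul_le_mul_of_nonneg_left (add_le_add hA ?_) (by positivity)
  gcongr

/-- Completing the singular series and the singular integral. -/
theorem norm_main_sub_le (k : ℕ) (hk : 2 ≤ k) :
    ∃ K : ℝ, 1 ≤ K ∧ ∀ d : ℕ, 2 ^ (k + 1) ≤ d → ∀ N : ℕ, 0 < N → ∀ U Y η : ℝ, 1 ≤ U →
      Y = (N : ℝ) ^ (1 / k : ℝ) → U ≤ η * N →
      ‖(∑ q ∈ Finset.Icc 1 ⌊U⌋₊, singularTerm k d N q) *
          (∫ β in Set.Icc (-η) η, contSum k Y β ^ d * e (-(β * N))) -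
        singularSeries k d N * (archFactor k d N : ℂ)‖ ≤
      K * (Y ^ d / Y ^ k) * (2 * U ^ (-(1 / k : ℝ))) ^ (d - 2 * k) +
        K * U ^ (-(1 / 4 : ℝ)) * |archFactor k d N| := by
  obtain ⟨K, hK1, hK⟩ := sum_gaussMoment_le k hk
  refine ⟨K * (1 + contMoment k), one_le_mul_of_one_le_of_one_le hK1
    (by linarith [contMoment_nonneg k]), ?_⟩
  intro d hd N hN U Y η hU hY hη
  have hW := contMoment_nonneg k
  have hk0 : (0 : ℝ) < k := by exact_mod_cast (by omega : 0 < k)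
  have hN0 : (0 : ℝ) < N := by exact_mod_cast hN
  have hY0 : 0 < Y := hY ▸ Real.rpow_pos_of_pos hN0 _
  have hYk : Y ^ k = N := by
    rw [hY, ← Real.rpow_natCast, ← Real.rpow_mul hN0.le, one_div_mul_cancel hk0.ne', Real.rpow_one]
  have hk4 := four_mul_le_two_pow k hk
  have hd3 : 3 * 2 ^ (k - 1) ≤ d := by
    obtain ⟨m, rfl⟩ : ∃ m, k = m + 1 := ⟨k - 1, by omega⟩
    have : 2 ^ (m + 1 + 1) = 4 * 2 ^ m := by ring
    simp only [Nat.add_sub_cancel]; omega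
  set n := ⌊U⌋₊ with hn
  set SQ := ∑ q ∈ Finset.Icc 1 n, singularTerm k d N q with hSQ
  set J := ∫ β in Set.Icc (-η) η, contSum k Y β ^ d * e (-(β * N)) with hJ
  have hSQ' : ‖SQ‖ ≤ K := by
    refine (norm_sum_le _ _).trans ((Finset.sum_le_sum fun q _ => norm_singularTerm_le k d N q).trans ?_)
    exact (hK d hd3).1 _
  have hS : ‖SQ - singularSeries k d N‖ ≤ K * U ^ (-(1 / 4 : ℝ)) := by
    have hsum := (summable_norm_singularTerm k d N hk hd3).of_norm.hasSum
    have hlim : Filter.Tendsto (fun s : Finset ℕ => ‖SQ - ∑ q ∈ s, singularTerm k d N q‖) Filter.atTop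
        (nhds ‖SQ - singularSeries k d N‖) := (tendsto_const_nhds.sub hsum).norm
    refine le_of_tendsto hlim ?_
    filter_upwards [Filter.eventually_ge_atTop (Finset.Icc 1 n)] with s hs
    rw [hSQ, ← Finset.sum_sdiff hs, sub_add_cancel_right, norm_neg]
    have h0 : singularTerm k d N 0 = 0 := by simp [singularTerm]
    -- The index `0` is dropped because the tail bound requires every remaining index to be at least
    -- `U`.
    rw [← Finset.sum_erase _ h0]
    refine (norm_sum_le _ _).trans ((Finset.sum_le_sum fun q _ => norm_singularTerm_le k d N q).trans ?_)
    refine (hK d hd3).2 U (by linarith) _ fun q hq => ?_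
    simp only [Finset.mem_erase, Finset.mem_sdiff, Finset.mem_Icc, not_and, not_le] at hq
    exact (Nat.lt_of_floor_lt (hq.2.2 (by omega))).le
  have hint : Integrable fun β => contSum k Y β ^ d * e (-(β * N)) := by
    refine (integrable_norm_iff ((((continuous_contSum k Y).pow d).mul
      (continuous_e.comp (by fun_prop))).aestronglyMeasurable)).1 ?_
    simpa [norm_e] using integrable_norm_contSum_pow k hk d (by omega) Y hY0
  have hJ' : ‖J - (archFactor k d N : ℂ)‖ ≤
      contMoment k * (Y ^ d / Y ^ k) * (2 * U ^ (-(1 / k : ℝ))) ^ (d - 2 * k) := by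
    have h1 : (archFactor k d N : ℂ) = ∫ β, contSum k Y β ^ d * e (-(β * N)) := by
      rw [hY]; exact (integral_contSum_pow k hk d (by omega) N hN).symm
    have hcompl : (Set.Icc (-η) η)ᶜ = {β : ℝ | η < |β|} := by
      ext β; simp only [Set.mem_compl_iff, Set.mem_ofPred_eq, ← not_le, abs_le, Set.mem_Icc]
    rw [h1, ← integral_add_compl (measurableSet_Icc (a := -η) (b := η)) hint, ← hJ, sub_add_cancel_left,
      norm_neg, hcompl]
    refine (norm_integral_le_integral_norm _).trans ?_
    simp only [norm_mul, norm_e, mul_one, norm_pow]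
    have h2 : 1 ≤ η * Y ^ k := by rw [hYk]; linarith
    refine (setIntegral_norm_contSum_pow_le k hk d (by omega) Y η hY0 h2).trans ?_
    have h3 : (η * Y ^ k) ^ (-(1 / k : ℝ)) ≤ U ^ (-(1 / k : ℝ)) := by
      rw [hYk]
      exact Real.rpow_le_rpow_of_nonpos (by linarith) hη (by simp)
    have h4 : 0 ≤ (η * Y ^ k) ^ (-(1 / k : ℝ)) := Real.rpow_nonneg (by linarith) _
    gcongr
  have h : SQ * J - singularSeries k d N * (archFactor k d N : ℂ) =
      SQ * (J - (archFactor k d N : ℂ)) + (SQ - singularSeries k d N) * (archFactor k d N : ℂ) := by ring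
  rw [h]
  refine (norm_add_le _ _).trans ?_
  rw [norm_mul, norm_mul, Complex.norm_real, Real.norm_eq_abs]
  have hK0 : 0 ≤ K := by linarith
  refine add_le_add ?_ ?_
  · calc ‖SQ‖ * ‖J - (archFactor k d N : ℂ)‖
        ≤ K * (contMoment k * (Y ^ d / Y ^ k) * (2 * U ^ (-(1 / k : ℝ))) ^ (d - 2 * k)) := by gcongr
      _ ≤ K * ((1 + contMoment k) * (Y ^ d / Y ^ k) * (2 * U ^ (-(1 / k : ℝ))) ^ (d - 2 * k)) := by
          gcongr; linarith
      _ = _ := by ring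
  · calc ‖SQ - singularSeries k d N‖ * |archFactor k d N| ≤ K * U ^ (-(1 / 4 : ℝ)) * |archFactor k d N| := by
          gcongr
      _ ≤ _ := by gcongr; nlinarith

end WaringMajor

/-! ### Error terms relative to the main term, uniformly in the number of variables -/

namespace WaringMajor

open MeasureTheory

lemma Gamma_le_rpow {x : ℝ} (hx : 2 ≤ x) {d : ℕ} (hd : x ≤ d) : Real.Gamma x ≤ (d : ℝ) ^ x := by
  obtain ⟨n, hn⟩ : ∃ n, ⌈x⌉₊ = n + 1 := ⟨⌈x⌉₊ - 1, by
    have : 0 < ⌈x⌉₊ := Nat.ceil_pos.2 (by linarith)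
    omega⟩
  have h1 : x ≤ ((n + 1 : ℕ) : ℝ) := hn ▸ Nat.le_ceil x
  have h2 : (n : ℝ) < x := by
    have := Nat.ceil_lt_add_one (show 0 ≤ x by linarith)
    rw [hn] at this; push_cast at this; linarith
  have h3 : n + 1 ≤ d := hn ▸ Nat.ceil_le.2 hd
  have hd1 : (1 : ℝ) ≤ d := by linarith
  calc Real.Gamma x ≤ Real.Gamma ((n + 1 : ℕ) : ℝ) :=
        Real.Gamma_strictMonoOn_Ici.monotoneOn hx (hx.trans h1) h1
    _ = (n.factorial : ℝ) := by push_cast; exact Real.Gamma_nat_eq_factorial n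
    _ ≤ (n : ℝ) ^ n := by exact_mod_cast Nat.factorial_le_pow n
    _ ≤ (d : ℝ) ^ n := by gcongr; omega
    _ = (d : ℝ) ^ (n : ℝ) := (Real.rpow_natCast _ _).symm
    _ ≤ (d : ℝ) ^ x := Real.rpow_le_rpow_of_exponent_le hd1 h2.le

/-- If `d ^ d ≤ Y ^ k`, then exponentials in `d` are smaller than any power of `Y`. -/
lemma exists_pow_le_rpow (k : ℕ) (hk : 1 ≤ k) {B κ : ℝ} (hB : 1 ≤ B) (hκ : 0 < κ) :
    ∃ C : ℝ, 1 ≤ C ∧ ∀ d : ℕ, ∀ Y : ℝ, 1 ≤ Y → (d : ℝ) ^ d ≤ Y ^ k → B ^ d ≤ C * Y ^ κ := by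
  have hk0 : (0 : ℝ) < k := by exact_mod_cast hk
  have hB0 : 0 < B := by linarith
  -- For `d ≥ T` one has `B ≤ d^{κ/k}`, so `B^d ≤ (d^d)^{κ/k} ≤ Y^κ`. Smaller `d` are absorbed in
  -- the constant `B^T`.
  set T : ℝ := B ^ ((k : ℝ) / κ) with hT
  have hT0 : 0 < T := Real.rpow_pos_of_pos hB0 _
  refine ⟨B ^ T, Real.one_le_rpow hB hT0.le, fun d Y hY hd => ?_⟩
  have hC : 1 ≤ B ^ T := Real.one_le_rpow hB hT0.le
  have hYκ : 1 ≤ Y ^ κ := Real.one_le_rpow hY hκ.le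
  rcases le_total T d with h | h
  · have h1 : B ^ d ≤ Y ^ κ := by
      calc B ^ d = (T ^ (κ / k)) ^ d := by
            rw [hT, ← Real.rpow_mul hB0.le]; field_simp; simp
        _ ≤ ((d : ℝ) ^ (κ / k)) ^ d := by gcongr
        _ = ((d : ℝ) ^ d) ^ (κ / k) := by
            rw [← Real.rpow_natCast, ← Real.rpow_natCast, ← Real.rpow_mul (by positivity),
              ← Real.rpow_mul (by positivity), mul_comm]
        _ ≤ (Y ^ k) ^ (κ / k) := by gcongr
        _ = Y ^ κ := by
            rw [← Real.rpow_natCast, ← Real.rpow_mul (by linarith)]; congr 1; field_simp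
    nlinarith
  · calc B ^ d = B ^ (d : ℝ) := (Real.rpow_natCast _ _).symm
      _ ≤ B ^ T := Real.rpow_le_rpow_of_exponent_le hB h
      _ ≤ B ^ T * Y ^ κ := by nlinarith

lemma archFactor_pos (k d N : ℕ) (hk : 0 < k) (hd : 0 < d) (hN : 0 < N) : 0 < archFactor k d N := by
  have hk0 : (0 : ℝ) < k := by exact_mod_cast hk
  have hd0 : (0 : ℝ) < d := by exact_mod_cast hd
  have hN0 : (0 : ℝ) < N := by exact_mod_cast hN
  rw [archFactor]
  have h1 : 0 < Real.Gamma (1 + 1 / k) := Real.Gamma_pos_of_pos (by positivity)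
  have h2 : 0 < Real.Gamma ((d : ℝ) / k) := Real.Gamma_pos_of_pos (by positivity)
  positivity

/-- The archimedean factor is `Y^{d-k}` times a ratio of Gamma values; the only superexponential
loss is `Γ(d/k) ≤ d^{d/k}`. -/
lemma pow_div_le_archFactor (k d N : ℕ) (hk : 0 < k) (hd : 2 * k ≤ d) (hN : 0 < N) {c Y : ℝ}
    (hc : 1 / Real.Gamma (1 + 1 / k) ≤ c) (hY : Y = (N : ℝ) ^ (1 / k : ℝ)) :
    Y ^ d / Y ^ k ≤ c ^ d * (d : ℝ) ^ ((d : ℝ) / k) * archFactor k d N := by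
  have hk0 : (0 : ℝ) < k := by exact_mod_cast hk
  have hk1 : (1 : ℝ) ≤ k := by exact_mod_cast hk
  have hd2 : (2 * k : ℝ) ≤ d := by exact_mod_cast hd
  have hd0 : (0 : ℝ) < d := by linarith
  have hN0 : (0 : ℝ) < N := by exact_mod_cast hN
  have hG1 : 0 < Real.Gamma (1 + 1 / k) := Real.Gamma_pos_of_pos (by positivity)
  have hG2 : 0 < Real.Gamma ((d : ℝ) / k) := Real.Gamma_pos_of_pos (by positivity)
  have hY0 : 0 < Y := hY ▸ Real.rpow_pos_of_pos hN0 _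
  have hYk : Y ^ k = N := by
    rw [hY, ← Real.rpow_natCast, ← Real.rpow_mul hN0.le, one_div_mul_cancel hk0.ne', Real.rpow_one]
  have hYd : Y ^ d = (N : ℝ) ^ ((d : ℝ) / k) := by
    rw [hY, ← Real.rpow_natCast, ← Real.rpow_mul hN0.le]; congr 1; ring
  have hG : Real.Gamma ((d : ℝ) / k) ≤ (d : ℝ) ^ ((d : ℝ) / k) := by
    refine Gamma_le_rpow ?_ ?_
    · rwa [le_div_iff₀ hk0]
    · rw [div_le_iff₀ hk0]; nlinarith
  have harch : archFactor k d N = Real.Gamma (1 + 1 / k) ^ d / Real.Gamma ((d : ℝ) / k) * (Y ^ d / Y ^ k) := by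
    rw [archFactor, Real.rpow_sub hN0, Real.rpow_one, ← hYd, hYk]
  have hcG : 1 ≤ (c * Real.Gamma (1 + 1 / k)) ^ d :=
    one_le_pow₀ (by rwa [div_le_iff₀ hG1] at hc)
  have hratio : 1 ≤ (d : ℝ) ^ ((d : ℝ) / k) / Real.Gamma ((d : ℝ) / k) := by
    rwa [le_div_iff₀ hG2, one_mul]
  rw [harch]
  calc Y ^ d / Y ^ k = 1 * 1 * (Y ^ d / Y ^ k) := by ring
    _ ≤ (c * Real.Gamma (1 + 1 / k)) ^ d * ((d : ℝ) ^ ((d : ℝ) / k) / Real.Gamma ((d : ℝ) / k)) *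
          (Y ^ d / Y ^ k) := by gcongr
    _ = _ := by rw [mul_pow]; ring

lemma rpow_neg_le_of_le_two_mul {X Y s : ℝ} (hX : 0 < X) (hY : 0 < Y) (hYX : Y ≤ 2 * X) (hs : 0 ≤ s) (hs1 : s ≤ 1) :
    X ^ (-s) ≤ 2 * Y ^ (-s) := by
  have h1 : (2 * X) ^ (-s) ≤ Y ^ (-s) := Real.rpow_le_rpow_of_nonpos hY hYX (by linarith)
  have h2 : (2 * X) ^ (-s) = 2 ^ (-s) * X ^ (-s) := Real.mul_rpow (by norm_num) hX.le
  have h3 : (2 : ℝ)⁻¹ ≤ 2 ^ (-s) := by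
    rw [← Real.rpow_neg_one]; exact Real.rpow_le_rpow_of_exponent_le (by norm_num) (by linarith)
  have h4 : 0 < X ^ (-s) := Real.rpow_pos_of_pos hX _
  nlinarith

lemma succ_mul_two_pow_le (d : ℕ) : ((d : ℝ) + 1) * 2 ^ d ≤ 4 ^ (d + 1) := by
  have h1 : ((d : ℝ) + 1) ≤ 2 ^ d := by exact_mod_cast Nat.lt_two_pow_self (n := d)
  calc ((d : ℝ) + 1) * 2 ^ d ≤ 2 ^ d * 2 ^ d := by gcongr
    _ = 4 ^ d := by rw [← mul_pow]; norm_num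
    _ ≤ _ := pow_le_pow_right₀ (by norm_num) (Nat.le_succ d)

/-- The part of the approximation error carried by the model, of relative size `Y^{2α-1+δ}` up to
exponentials in `d`. -/
lemma error_bound_one (d k : ℕ) {X Y α δ κ c c₁ D K C A : ℝ} (hX : 0 < X) (hXY : X ≤ Y) (hY : 1 ≤ Y)
    (hα : 0 < α) (hκ : 2 * κ ≤ 1 - δ - 2 * α) (hc : 0 ≤ c) (hc₁ : 0 ≤ c₁) (hD : 0 ≤ D) (hK : 0 ≤ K) (hA : 0 ≤ A)
    (hH : Y ^ (d + 1) / Y ^ k ≤ c₁ ^ (d + 1) * Y ^ δ * A)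
    (hC : (4 * D * c₁) ^ (d + 1) ≤ C * Y ^ κ) :
    D ^ (d + 1) * ((d + 1) * (c * X ^ (2 * α)) * 2 ^ d * (K * (Y ^ d / Y ^ k))) ≤
      K * c * C * Y ^ (-κ) * A := by
  have hY0 : 0 < Y := by linarith
  have hXα : X ^ (2 * α) ≤ Y ^ (2 * α) := Real.rpow_le_rpow hX.le hXY (by linarith)
  have h1 : Y ^ d / Y ^ k = Y ^ (-1 : ℝ) * (Y ^ (d + 1) / Y ^ k) := by
    rw [Real.rpow_neg_one, pow_succ]; field_simp
  have h2 := succ_mul_two_pow_le d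
  calc _ = K * c * (D ^ (d + 1) * (((d : ℝ) + 1) * 2 ^ d)) * X ^ (2 * α) * (Y ^ (-1 : ℝ) * (Y ^ (d + 1) / Y ^ k)) := by
        rw [h1]; ring
    _ ≤ K * c * (D ^ (d + 1) * 4 ^ (d + 1)) * Y ^ (2 * α) * (Y ^ (-1 : ℝ) * (c₁ ^ (d + 1) * Y ^ δ * A)) := by
        gcongr
    _ = K * c * (4 * D * c₁) ^ (d + 1) * (Y ^ (2 * α) * Y ^ (-1 : ℝ) * Y ^ δ) * A := by
        rw [mul_pow, mul_pow]; ring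
    _ ≤ K * c * (C * Y ^ κ) * (Y ^ (2 * α) * Y ^ (-1 : ℝ) * Y ^ δ) * A := by gcongr
    _ = K * c * C * (Y ^ (κ + (2 * α + -1 + δ))) * A := by
        rw [Real.rpow_add hY0, Real.rpow_add hY0, Real.rpow_add hY0]; ring
    _ ≤ K * c * C * Y ^ (-κ) * A := by
        have hC0 : 0 ≤ C := by
          have : 0 ≤ C * Y ^ κ := le_trans (by positivity) hC
          exact nonneg_of_mul_nonneg_left this (Real.rpow_pos_of_pos hY0 _)
        gcongr
        linarith

/-- The part where all factors are approximation errors. The exponent `(2α - 1)(d + 1) + 3α + δ` is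
below `1 - (d + 1)/3`, and `d ≥ 7` with `κ ≤ 1/3` brings it below `-2κ`. -/
lemma error_bound_two (d k : ℕ) {X Y α δ κ c c₁ D C A : ℝ} (hX : 0 < X) (hXY : X ≤ Y) (hYX : Y ≤ 2 * X)
    (hY : 1 ≤ Y) (hα : 0 < α) (hα3 : α < 1 / 3) (hδ : δ < 1 - 3 * α) (hκ : κ ≤ 1 / 3) (hd : 7 ≤ d)
    (hc : 0 ≤ c) (hc₁ : 0 ≤ c₁) (hD : 0 ≤ D) (hA : 0 ≤ A)
    (hH : Y ^ (d + 1) / Y ^ k ≤ c₁ ^ (d + 1) * Y ^ δ * A)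
    (hC : (4 * D * c₁ * c) ^ (d + 1) ≤ C * Y ^ κ) :
    D ^ (d + 1) * ((d + 1) * (c * X ^ (2 * α)) * 2 ^ d *
      (X ^ (2 * α) * (2 * X ^ (-(k : ℝ) + α) * (c * X ^ (2 * α)) ^ d))) ≤
      2 * 2 ^ k * C * Y ^ (-κ) * A := by
  have hY0 : 0 < Y := by linarith
  have h2 := succ_mul_two_pow_le d
  have hd' : (7 : ℝ) ≤ d := by exact_mod_cast hd
  have hXk : (X ^ k)⁻¹ ≤ 2 ^ k * (Y ^ k)⁻¹ := by
    rw [← inv_pow, ← inv_pow, ← mul_pow]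
    gcongr
    rw [← div_eq_mul_inv, le_div_iff₀ hY0, inv_mul_le_iff₀ hX]; linarith
  have h3 : X ^ (2 * α) * X ^ (2 * α) * X ^ (-(k : ℝ) + α) * (X ^ (2 * α)) ^ d =
      X ^ (2 * α * (d + 1) + 3 * α) * (X ^ k)⁻¹ := by
    rw [← Real.rpow_natCast (X ^ (2 * α)) d, ← Real.rpow_mul hX.le, ← Real.rpow_natCast X k,
      ← Real.rpow_neg hX.le, ← Real.rpow_add hX, ← Real.rpow_add hX, ← Real.rpow_add hX, ← Real.rpow_add hX]
    congr 1; ring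
  have hXY' : X ^ (2 * α * (d + 1) + 3 * α) ≤ Y ^ (2 * α * (d + 1) + 3 * α) :=
    Real.rpow_le_rpow hX.le hXY (by positivity)
  have h4 : (Y ^ k)⁻¹ = Y ^ (-((d : ℝ) + 1)) * (Y ^ (d + 1) / Y ^ k) := by
    have : Y ^ (-((d : ℝ) + 1)) = (Y ^ (d + 1))⁻¹ := by
      rw [Real.rpow_neg hY0.le, ← Real.rpow_natCast]; push_cast; rfl
    rw [this]; field_simp
  have hC0 : 0 ≤ C := by
    have : 0 ≤ C * Y ^ κ := le_trans (by positivity) hC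
    exact nonneg_of_mul_nonneg_left this (Real.rpow_pos_of_pos hY0 _)
  calc _ = 2 * (D ^ (d + 1) * (((d : ℝ) + 1) * 2 ^ d)) * c ^ (d + 1) *
        (X ^ (2 * α) * X ^ (2 * α) * X ^ (-(k : ℝ) + α) * (X ^ (2 * α)) ^ d) := by
        rw [mul_pow c]; ring
    _ = 2 * (D ^ (d + 1) * (((d : ℝ) + 1) * 2 ^ d)) * c ^ (d + 1) *
        (X ^ (2 * α * (d + 1) + 3 * α) * (X ^ k)⁻¹) := by rw [h3]
    _ ≤ 2 * (D ^ (d + 1) * 4 ^ (d + 1)) * c ^ (d + 1) *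
        (Y ^ (2 * α * (d + 1) + 3 * α) * (2 ^ k * (Y ^ k)⁻¹)) := by gcongr
    _ = 2 * (D ^ (d + 1) * 4 ^ (d + 1)) * c ^ (d + 1) *
        (Y ^ (2 * α * (d + 1) + 3 * α) * (2 ^ k * (Y ^ (-((d : ℝ) + 1)) * (Y ^ (d + 1) / Y ^ k)))) := by rw [h4]
    _ ≤ 2 * (D ^ (d + 1) * 4 ^ (d + 1)) * c ^ (d + 1) *
        (Y ^ (2 * α * (d + 1) + 3 * α) * (2 ^ k * (Y ^ (-((d : ℝ) + 1)) * (c₁ ^ (d + 1) * Y ^ δ * A)))) := by gcongr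
    _ = 2 * 2 ^ k * (4 * D * c₁ * c) ^ (d + 1) *
        (Y ^ (2 * α * (d + 1) + 3 * α) * Y ^ (-((d : ℝ) + 1)) * Y ^ δ) * A := by
        rw [mul_pow, mul_pow, mul_pow]; ring
    _ ≤ 2 * 2 ^ k * (C * Y ^ κ) * (Y ^ (2 * α * (d + 1) + 3 * α) * Y ^ (-((d : ℝ) + 1)) * Y ^ δ) * A := by gcongr
    _ = 2 * 2 ^ k * C * Y ^ (κ + (2 * α * (d + 1) + 3 * α + -((d : ℝ) + 1) + δ)) * A := by
        rw [Real.rpow_add hY0 κ, Real.rpow_add hY0 (2 * α * (d + 1) + 3 * α + -((d : ℝ) + 1)) δ,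
          Real.rpow_add hY0 (2 * α * (d + 1) + 3 * α) (-((d : ℝ) + 1))]
        ring
    _ ≤ _ := by
        gcongr
        nlinarith

lemma error_bound_three {d : ℕ} {X Y α κ D K C A : ℝ} (hX : 0 < X) (hYX : Y ≤ 2 * X)
    (hY : 1 ≤ Y) (hα : 0 < α) (hα3 : α < 1 / 3) (hκ : 8 * κ ≤ α) (hK : 0 ≤ K) (hA : 0 ≤ A) (hC0 : 0 ≤ C)
    (hC : D ^ d ≤ C * Y ^ κ) :
    D ^ d * (K * (X ^ α) ^ (-(1 / 4 : ℝ)) * A) ≤ 2 * K * C * Y ^ (-κ) * A := by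
  have hY0 : 0 < Y := by linarith
  have h1 : (X ^ α) ^ (-(1 / 4 : ℝ)) ≤ 2 * Y ^ (-(α / 4)) := by
    rw [← Real.rpow_mul hX.le, show α * -(1 / 4) = -(α / 4) by ring]
    exact rpow_neg_le_of_le_two_mul hX hY0 hYX (by positivity) (by linarith)
  calc _ ≤ (C * Y ^ κ) * (K * (2 * Y ^ (-(α / 4))) * A) := by gcongr
    _ = 2 * K * C * Y ^ (κ + -(α / 4)) * A := by rw [Real.rpow_add hY0]; ring
    _ ≤ _ := by
        gcongr
        linarith

/-- The tail of the singular integral. For small `d` its saving need not beat `Y^δ`, so `d^{d/k}` is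
not replaced by `Y^δ`. It is bounded by `d^d` and `d ≤ 2^d ≤ C Y^κ`; as `d - 2k ≥ d/2`, everything
becomes the `d`-th power of a quantity `O(Y^{-κ})`. -/
lemma error_bound_four {d k : ℕ} (hk : 2 ≤ k) (hd : 4 * k ≤ d) {X Y α κ c₁ D K C A : ℝ} (hX : 0 < X)
    (hYX : Y ≤ 2 * X) (hY : 1 ≤ Y) (hα : 0 < α) (hα3 : α < 1 / 3) (hκ : κ = α / (4 * k)) (hK : 0 ≤ K)
    (hA : 0 ≤ A) (hC1 : 1 ≤ C) (hD : 1 ≤ D) (hc₁ : 1 ≤ c₁)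
    (hH : Y ^ d / Y ^ k ≤ c₁ ^ d * (d : ℝ) ^ ((d : ℝ) / k) * A)
    (hC : 2 ^ d ≤ C * Y ^ κ) (hsmall : 2 * D * c₁ * C * Y ^ (-κ) ≤ 1) :
    D ^ d * (K * (Y ^ d / Y ^ k) * (2 * (X ^ α) ^ (-(1 / k : ℝ))) ^ (d - 2 * k)) ≤
      K * (2 * D * c₁ * C) * Y ^ (-κ) * A := by
  have hY0 : 0 < Y := by linarith
  have hk2 : (2 : ℝ) ≤ k := by exact_mod_cast hk
  have hk0 : (0 : ℝ) < k := by linarith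
  have hκ0 : 0 < κ := by rw [hκ]; positivity
  have hd1 : (1 : ℝ) ≤ d := by exact_mod_cast (by omega : 1 ≤ d)
  set z : ℝ := 2 * Y ^ (-(2 * κ)) with hz
  have hz0 : 0 ≤ z := by positivity
  have hYκ : Y ^ (-(2 * κ)) ≤ Y ^ (-κ) := Real.rpow_le_rpow_of_exponent_le hY (by linarith)
  have hcoef : 2 ≤ 2 * D * c₁ * C := by
    have : 1 ≤ D * c₁ * C := one_le_mul_of_one_le_of_one_le (one_le_mul_of_one_le_of_one_le hD hc₁) hC1
    linarith
  have hYκ0 : 0 < Y ^ (-κ) := Real.rpow_pos_of_pos hY0 _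
  have hz1 : z ≤ 1 := by rw [hz]; nlinarith
  have h1 : 2 * (X ^ α) ^ (-(1 / k : ℝ)) ≤ z ^ 2 := by
    have h2 : (X ^ α) ^ (-(1 / k : ℝ)) ≤ 2 * Y ^ (-(α / k)) := by
      rw [← Real.rpow_mul hX.le, show α * -(1 / k : ℝ) = -(α / k) by ring]
      refine rpow_neg_le_of_le_two_mul hX hY0 hYX (by positivity) ?_
      rw [div_le_one hk0]; linarith
    have h3 : z ^ 2 = 4 * Y ^ (-(α / k)) := by
      rw [hz, mul_pow, ← Real.rpow_natCast (Y ^ _), ← Real.rpow_mul hY0.le, hκ]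
      have : -(2 * (α / (4 * k))) * ((2 : ℕ) : ℝ) = -(α / k) := by push_cast; field_simp; norm_num
      rw [this]; norm_num
    linarith
  have h4 : (2 * (X ^ α) ^ (-(1 / k : ℝ))) ^ (d - 2 * k) ≤ z ^ d := by
    calc _ ≤ (z ^ 2) ^ (d - 2 * k) := by gcongr
      _ = z ^ (2 * (d - 2 * k)) := by rw [← pow_mul]
      _ ≤ z ^ d := pow_le_pow_of_le_one hz0 hz1 (by omega)
  have h5 : (d : ℝ) ^ ((d : ℝ) / k) ≤ (d : ℝ) ^ d := by
    rw [← Real.rpow_natCast (d : ℝ) d]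
    refine Real.rpow_le_rpow_of_exponent_le hd1 (div_le_self (by linarith) (by linarith))
  have h6 : (d : ℝ) ≤ C * Y ^ κ := by
    refine le_trans ?_ hC
    exact_mod_cast (Nat.lt_two_pow_self (n := d)).le
  have hbase : D * c₁ * d * z ≤ 2 * D * c₁ * C * Y ^ (-κ) := by
    calc D * c₁ * d * z ≤ D * c₁ * (C * Y ^ κ) * z := by gcongr
      _ = 2 * D * c₁ * C * (Y ^ κ * Y ^ (-(2 * κ))) := by rw [hz]; ring
      _ = _ := by rw [← Real.rpow_add hY0]; congr 2; ring
  calc _ ≤ D ^ d * (K * (c₁ ^ d * (d : ℝ) ^ ((d : ℝ) / k) * A) * z ^ d) := by gcongr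
    _ ≤ D ^ d * (K * (c₁ ^ d * (d : ℝ) ^ d * A) * z ^ d) := by gcongr
    _ = K * (D * c₁ * d * z) ^ d * A := by rw [mul_pow, mul_pow, mul_pow]; ring
    _ ≤ K * (2 * D * c₁ * C * Y ^ (-κ)) ^ d * A := by gcongr
    _ ≤ K * (2 * D * c₁ * C * Y ^ (-κ)) * A := by
        gcongr
        exact pow_le_of_le_one (by positivity) hsmall (by omega)
    _ = _ := by ring

end WaringMajor

/-! ### Assembly of the asymptotic formula -/

namespace WaringMajor

open MeasureTheory

lemma singularSeries_ne_zero (k d N : ℕ) (hk : 2 ≤ k) (hd : 2 ^ (k + 1) ≤ d) : singularSeries k d N ≠ 0 := by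
  obtain ⟨D, _, hD⟩ := exists_le_norm_singularSeries k hk
  intro h
  have := hD d hd N
  rw [h, norm_zero, mul_zero] at this
  linarith

lemma mul_le_of_le_add_four {M D F P Q R S a b c d Z A : ℝ} (hD : 0 ≤ D)
    (h : M ≤ F * (P + Q) + (R + S)) (h1 : D * (F * P) ≤ a * Z * A) (h2 : D * (F * Q) ≤ b * Z * A)
    (h3 : D * R ≤ c * Z * A) (h4 : D * S ≤ d * Z * A) : D * M ≤ (a + b + c + d) * Z * A := by
  have := mul_le_mul_of_nonneg_left h hD
  linarith

set_option maxHeartbeats 800000 in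
/-- The relative error in the major arc asymptotics is a power of `N`, uniformly in `d`. -/
theorem norm_majorIntegral_sub_le (k : ℕ) (hk : 2 ≤ k) {α δ : ℝ} (hα : 0 < α) (hα3 : α < 1 / 3)
    (hδ : 0 < δ) (hδ3 : δ < 1 - 3 * α) :
    ∃ C Y₀ : ℝ, ∀ d : ℕ, 2 ^ (k + 1) ≤ d → ∀ N : ℕ, (d : ℝ) ^ ((d : ℝ) / δ) ≤ N →
      Y₀ ≤ (N : ℝ) ^ (1 / k : ℝ) →
      ‖majorIntegral k d α N - singularSeries k d N * (archFactor k d N : ℂ)‖ ≤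
        C * ((N : ℝ) ^ (1 / k : ℝ)) ^ (-(α / (4 * k))) * ‖singularSeries k d N * (archFactor k d N : ℂ)‖ := by
  have hk2 : (2 : ℝ) ≤ k := by exact_mod_cast hk
  have hk0 : (0 : ℝ) < k := by linarith
  obtain ⟨D, hD1, hD⟩ := exists_le_norm_singularSeries k hk
  obtain ⟨K₁, hK₁, hmain₁⟩ := norm_majorIntegral_sub_main_le k hk
  obtain ⟨K₂, hK₂, hmain₂⟩ := norm_main_sub_le k hk
  set c₁ : ℝ := max 1 (1 / Real.Gamma (1 + 1 / k)) with hc₁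
  have hc₁1 : 1 ≤ c₁ := le_max_left _ _
  set c : ℝ := 3 + 2 * Real.pi * k with hc
  have hpi := Real.pi_pos
  have hc1 : 1 ≤ c := by
    have : 0 < 2 * Real.pi * k := by positivity
    linarith
  set κ : ℝ := α / (4 * k) with hκ
  have hκ0 : 0 < κ := by positivity
  have hκ8 : 8 * κ ≤ α := by
    rw [hκ, mul_div_assoc', div_le_iff₀ (by positivity)]; nlinarith
  have hDc : 1 ≤ D * c₁ := one_le_mul_of_one_le_of_one_le hD1 hc₁1
  have hDc₁ : D ≤ D * c₁ := le_mul_of_one_le_right (by linarith) hc₁1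
  have hDcc : D * c₁ ≤ D * c₁ * c := le_mul_of_one_le_right (by linarith) hc1
  -- A single base dominating `4 D c₁`, `D` and `2`, so that one constant serves all four error
  -- terms.
  obtain ⟨C, hC1, hC⟩ := exists_pow_le_rpow k (by omega) (B := 4 * D * c₁ * c) (κ := κ)
    (by nlinarith) hκ0
  have hY₁ : ∃ Y₁ : ℝ, ∀ Y ≥ Y₁, 2 * D * c₁ * C * Y ^ (-κ) ≤ 1 := by
    have h := (tendsto_rpow_neg_atTop hκ0).const_mul (2 * D * c₁ * C)
    rw [mul_zero] at h
    exact Filter.eventually_atTop.1 (h.eventually_le_const zero_lt_one)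
  obtain ⟨Y₁, hY₁⟩ := hY₁
  refine ⟨K₁ * c * C + 2 * 2 ^ k * C + K₂ * (2 * D * c₁ * C) + 2 * K₂ * C, max 6 Y₁, ?_⟩
  intro d' hd' N hN hY₀
  have hk4 := four_mul_le_two_pow k hk
  obtain ⟨d, rfl⟩ : ∃ d, d' = d + 1 := ⟨d' - 1, by omega⟩
  set Y : ℝ := (N : ℝ) ^ (1 / k : ℝ) with hY
  have hY6 : 6 ≤ Y := (le_max_left _ _).trans hY₀
  have hY0 : 0 < Y := by linarith
  have hY1 : 1 ≤ Y := by linarith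
  have hsmall := hY₁ Y ((le_max_right _ _).trans hY₀)
  obtain ⟨hXY, hYX⟩ := cutoff_bounds k N
  rw [← hY] at hXY hYX
  have hX3 : 3 ≤ cutoff k N := by
    have : (2 : ℝ) < cutoff k N := by linarith
    exact_mod_cast this
  set X : ℝ := (cutoff k N : ℝ) with hX
  have hX0 : 0 < X := by linarith
  have hY2X : Y ≤ 2 * X := by linarith
  have hd1 : (1 : ℝ) ≤ ((d + 1 : ℕ) : ℝ) := by exact_mod_cast Nat.succ_le_succ (Nat.zero_le d)
  have hN0 : 0 < N := by
    rcases Nat.eq_zero_or_pos N with h | h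
    · rw [h, Nat.cast_zero] at hN
      have : (0 : ℝ) < ((d + 1 : ℕ) : ℝ) ^ (((d + 1 : ℕ) : ℝ) / δ) := by positivity
      linarith
    · exact h
  have hN0' : (0 : ℝ) < N := by exact_mod_cast hN0
  have hYk : Y ^ k = N := by
    rw [hY, ← Real.rpow_natCast, ← Real.rpow_mul hN0'.le, one_div_mul_cancel hk0.ne', Real.rpow_one]
  have hdd : ((d + 1 : ℕ) : ℝ) ^ (d + 1) ≤ Y ^ k := by
    rw [hYk]
    refine le_trans ?_ hN
    rw [← Real.rpow_natCast]
    refine Real.rpow_le_rpow_of_exponent_le hd1 ?_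
    rw [le_div_iff₀ hδ]
    nlinarith
  have hdk : ((d + 1 : ℕ) : ℝ) ^ (((d + 1 : ℕ) : ℝ) / k) ≤ Y ^ δ := by
    calc _ = (((d + 1 : ℕ) : ℝ) ^ (((d + 1 : ℕ) : ℝ) / δ)) ^ (δ / k) := by
          rw [← Real.rpow_mul (by linarith)]; congr 1; field_simp
      _ ≤ (N : ℝ) ^ (δ / k) := by gcongr
      _ = Y ^ δ := by rw [hY, ← Real.rpow_mul hN0'.le]; congr 1; ring
  set A : ℝ := archFactor k (d + 1) N with hA
  have hA0 : 0 < A := archFactor_pos k (d + 1) N (by omega) (by omega) hN0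
  have hH := pow_div_le_archFactor k (d + 1) N (by omega) (by omega) hN0
    (c := c₁) (le_max_right _ _) hY
  rw [← hA] at hH
  have hH' : Y ^ (d + 1) / Y ^ k ≤ c₁ ^ (d + 1) * Y ^ δ * A := hH.trans (by gcongr)
  have hB : (4 * D * c₁ * c) ^ (d + 1) ≤ C * Y ^ κ := hC (d + 1) Y hY1 hdd
  have hB1 : (4 * D * c₁) ^ (d + 1) ≤ C * Y ^ κ :=
    (pow_le_pow_left₀ (by linarith) (by linarith) _).trans hB
  have hB2 : D ^ (d + 1) ≤ C * Y ^ κ :=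
    (pow_le_pow_left₀ (by linarith) (by linarith) _).trans hB
  have hB3 : 2 ^ (d + 1) ≤ C * Y ^ κ :=
    (pow_le_pow_left₀ (by linarith) (by linarith) _).trans hB
  have hC0 : 0 ≤ C := by linarith
  set U : ℝ := X ^ α with hU
  have hU1 : 1 ≤ U := Real.one_le_rpow (by linarith) hα.le
  have hηN : U ≤ X ^ (-(k : ℝ) + α) * N := by
    calc U = X ^ (-(k : ℝ) + α) * X ^ k := by
          rw [← Real.rpow_natCast, ← Real.rpow_add hX0, hU]; congr 1; ring
      _ ≤ X ^ (-(k : ℝ) + α) * N := by rw [← hYk]; gcongr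
  have e1 := hmain₁ d hd' N hX3 α hα hα3 X Y _ _ hX hY rfl rfl
  have e2 := hmain₂ (d + 1) hd' N hN0 U Y _ hU1 hY hηN
  rw [← hU] at e1
  rw [← hA, abs_of_pos hA0] at e2
  clear hmain₁ hmain₂ hC hY₁
  set MT := (∑ q ∈ Finset.Icc 1 ⌊U⌋₊, singularTerm k (d + 1) N q) *
    ∫ β in Set.Icc (-(X ^ (-(k : ℝ) + α))) (X ^ (-(k : ℝ) + α)), contSum k Y β ^ (d + 1) * e (-(β * N)) with hMT
  set SA := singularSeries k (d + 1) N * (A : ℂ) with hSA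
  have h1 := error_bound_one d k (K := K₁) (c := c) (D := D) hX0 hXY hY1 hα (by linarith : 2 * κ ≤ 1 - δ - 2 * α)
    (by linarith) (by linarith) (by linarith) (by linarith) hA0.le hH' hB1
  have h2 := error_bound_two d k hX0 hXY hY2X hY1 hα hα3 hδ3 (by linarith : κ ≤ 1 / 3)
    (by have : 2 ^ (2 + 1) ≤ 2 ^ (k + 1) := Nat.pow_le_pow_right (by norm_num) (by omega)
        omega)
    (by linarith) (by linarith) (by linarith) hA0.le hH' hB
  have h3 := error_bound_three (d := d + 1) (K := K₂) hX0 hY2X hY1 hα hα3 hκ8 (by linarith) hA0.le hC0 hB2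
  have h4 := error_bound_four (d := d + 1) hk (by omega) hX0 hY2X hY1 hα hα3 hκ (by linarith : 0 ≤ K₂) hA0.le hC1
    hD1 hc₁1 hH hB3 hsmall
  have hDpos : 0 < D ^ (d + 1) := by positivity
  have htri : ‖majorIntegral k (d + 1) α N - SA‖ ≤
      (d + 1) * (c * X ^ (2 * α)) * 2 ^ d * (K₁ * (Y ^ d / Y ^ k) + X ^ (2 * α) *
        (2 * X ^ (-(k : ℝ) + α) * (c * X ^ (2 * α)) ^ d)) +
      (K₂ * (Y ^ (d + 1) / Y ^ k) * (2 * U ^ (-(1 / k : ℝ))) ^ (d + 1 - 2 * k) + K₂ * U ^ (-(1 / 4 : ℝ)) * A) := by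
    rw [← sub_add_sub_cancel _ MT _]
    exact (norm_add_le _ _).trans (add_le_add e1 e2)
  have htot : D ^ (d + 1) * ‖majorIntegral k (d + 1) α N - SA‖ ≤
      (K₁ * c * C + 2 * 2 ^ k * C + K₂ * (2 * D * c₁ * C) + 2 * K₂ * C) * Y ^ (-κ) * A := by
    exact mul_le_of_le_add_four hDpos.le htri h1 h2 h4 h3
  have hSnorm : A ≤ D ^ (d + 1) * ‖SA‖ := by
    rw [hSA, norm_mul, Complex.norm_real, Real.norm_of_nonneg hA0.le]
    nlinarith [hD (d + 1) hd' N]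
  have hYκ0 : 0 < Y ^ (-κ) := Real.rpow_pos_of_pos hY0 _
  refine le_of_mul_le_mul_left (htot.trans ?_) hDpos
  calc _ ≤ (K₁ * c * C + 2 * 2 ^ k * C + K₂ * (2 * D * c₁ * C) + 2 * K₂ * C) * Y ^ (-κ) *
        (D ^ (d + 1) * ‖SA‖) := by gcongr
    _ = _ := by ring

end WaringMajor

theorem mainTheorem4 (k : ℕ) (hk : 2 ≤ k) :
    ∃ C : ℝ, 0 < C ∧
      ∀ α : ℝ, 0 < α → α < 1 / 3 → ∀ δ : ℝ, 0 < δ → δ < 1 - 3 * α →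
        ∃ E : ℕ → ℝ, Filter.Tendsto E Filter.atTop (nhds 0) ∧
          ∀ d : ℕ, 2 ^ (k + 1) ≤ d → ∀ N : ℕ, C * (d : ℝ) ^ ((d : ℝ) / δ) ≤ (N : ℝ) →
            Summable (WaringMajor.singularTerm k d N) ∧
            ∃ ε : ℂ, ‖ε‖ ≤ E N ∧
              WaringMajor.majorIntegral k d α N =
                WaringMajor.singularSeries k d N * (WaringMajor.archFactor k d N : ℂ) *
                  (1 + ε) := by
  -- The threshold constant `1` works, because finitely many exceptional `N` are absorbed in `E`.
  refine ⟨1, one_pos, fun α hα hα3 δ hδ hδ3 => ?_⟩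
  obtain ⟨C, Y₀, hmain⟩ := WaringMajor.norm_majorIntegral_sub_le k hk hα hα3 hδ hδ3
  have hk2 : (2 : ℝ) ≤ k := by exact_mod_cast hk
  have hk0 : (0 : ℝ) < k := by linarith
  have htY : Filter.Tendsto (fun N : ℕ => (N : ℝ) ^ (1 / k : ℝ)) Filter.atTop Filter.atTop :=
    (tendsto_rpow_atTop (by positivity)).comp tendsto_natCast_atTop_atTop
  obtain ⟨N₀, hN₀⟩ := Filter.eventually_atTop.1 (htY.eventually_ge_atTop Y₀)
  set main : ℕ → ℕ → ℂ := fun d N =>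
    WaringMajor.singularSeries k d N * (WaringMajor.archFactor k d N : ℂ) with hmaindef
  set err : ℕ → ℕ → ℂ := fun d N => (WaringMajor.majorIntegral k d α N - main d N) / main d N with herr
  -- For `N < N₀` the bound only has to be finite and independent of `d`. The hypothesis forces `d ≤
  -- N`, so the sum of all relative errors over `d ≤ N` will do.
  refine ⟨fun N => if N₀ ≤ N then C * ((N : ℝ) ^ (1 / k : ℝ)) ^ (-(α / (4 * k)))
    else ∑ d ∈ Finset.range (N + 1), ‖err d N‖, ?_, ?_⟩
  · have h := ((tendsto_rpow_neg_atTop (by positivity : 0 < α / (4 * k))).comp htY).const_mul C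
    rw [mul_zero] at h
    refine h.congr' ?_
    filter_upwards [Filter.eventually_ge_atTop N₀] with N hN
    rw [if_pos hN]; rfl
  · intro d hd N hN
    rw [one_mul] at hN
    have hk4 := WaringMajor.four_mul_le_two_pow k hk
    have hd1 : (1 : ℝ) ≤ d := by exact_mod_cast (by omega : 1 ≤ d)
    have hdN : (d : ℝ) ≤ N := by
      refine le_trans ?_ hN
      refine Real.self_le_rpow_of_one_le hd1 ?_
      rw [le_div_iff₀ hδ]; linarith
    have hdN' : d ≤ N := by exact_mod_cast hdN
    have hne : main d N ≠ 0 := mul_ne_zero (WaringMajor.singularSeries_ne_zero k d N hk hd)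
      (by exact_mod_cast (WaringMajor.archFactor_pos k d N (by omega) (by omega) (by omega)).ne')
    have hd3 : 3 * 2 ^ (k - 1) ≤ d := by
      obtain ⟨m, rfl⟩ : ∃ m, k = m + 1 := ⟨k - 1, by omega⟩
      have : 2 ^ (m + 1 + 1) = 4 * 2 ^ m := by ring
      simp only [Nat.add_sub_cancel]; omega
    refine ⟨(WaringMajor.summable_norm_singularTerm k d N hk hd3).of_norm, err d N, ?_, ?_⟩
    · beta_reduce
      split_ifs with h
      · rw [herr]
        simp only
        rw [norm_div, div_le_iff₀ (norm_pos_iff.2 hne)]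
        exact hmain d hd N hN (hN₀ N h)
      · exact Finset.single_le_sum (f := fun d => ‖err d N‖) (fun _ _ => norm_nonneg _)
          (Finset.mem_range.2 (by omega))
    · change _ = main d N * (1 + err d N)
      rw [herr]
      simp only
      field_simp
      ring
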